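/- **Model.** Wi-Fi access points (APs) $\Phi_W=\{x_i\}$ and LTE base stations (eNBs) $\Phi_L=\{y_m\}$ are independent homogeneous Poisson point processes in $\mathbb R^2$ with intensities $\lambda_W,\lambda_L>0$. The path loss is $\ell(d)=(4\pi/\lambda_c)^2d^{\alpha}$ with $\lambda_c,\alpha>0$; the transmit powers are $P_W,P_L>0$ and the thresholds are $\Gamma_{cs},\Gamma_{ed}>0$. Under listen-before-talk with contention window $(0,1)$, all APs and eNBs have timers $t^W_i,t^L_m$ uniform on $[0,1]$; the fading variables $G^W_{ji}$ (AP $x_j$ to AP $x_i$) and $G^{LW}_{mi}$ (eNB $y_m$ to AP $x_i$) are exponential with parameter $\mu>0$. All these marks are independent of each other and of $\Phi_W,\Phi_L$. AP $x_i$ transmits ($e^W_i=1$) if and only if $G^W_{ji}/\ell(\|x_j-x_i\|)\le\Gamma_{cs}/P_W$ for every other AP $x_j$ with $t^W_j<t^W_i$ and $G^{LW}_{mi}/\ell(\|y_m-x_i\|)\le\Gamma_{ed}/P_L$ for every eNB $y_m$ with $t^L_m<t^W_i$. The tagged AP $x_0$ is the AP closest to the origin. **Functions.** With $B(0,r)$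 the closed ball, put $$N^W_0(y,r,\Gamma)=\lambda_W\int_{\mathbb R^2\setminus B(0,r)}e^{-\mu\frac{\Gamma}{P_W}\ell(\|x-y\|)}\,dx,\qquad C^W_0(y_1,\Gamma_1,y_2,\Gamma_2)=\lambda_W\int_{\mathbb R^2\setminus B(0,\|y_2\|)}e^{-\mu\frac{\Gamma_1}{P_W}\ell(\|x-y_1\|)-\mu\frac{\Gamma_2}{P_W}\ell(\|x-y_2\|)}\,dx,$$ and define $N^L_0,C^L_0$ in the same way with $\lambda_L,P_L$ in place of $\lambda_W,P_W$. Let $N^W_2(r)=N^W_0((r,0),r,\Gamma_{cs})$, $N^L=N^L_0(o,0,\Gamma_{ed})$, $C^W_1(y_1,y_2)=C^W_0(y_1,\Gamma_{cs},y_2,\Gamma_{cs})$, $C^L_2(y)=C^L_0(y,\Gamma_{ed},o,\Gamma_{ed})$, and $$M(N_1,N_2,N_3)=\frac{\frac{1-e^{-N_1}}{N_1}-\frac{1-e^{-N_1-N_2+N_3}}{N_1+N_2-N_3}}{N_2-N_3},$$ $$V(x,s_1,s_2,N_1,N_2,N_3)=(1-e^{-\mu s_1\ell(\|x\|)})M(N_1,N_2,N_3)+(1-e^{-\mu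 s_2\ell(\|x\|)})M(N_2,N_1,N_3),$$ $$U(x,s,N)=\frac{1-e^{-N}}{N}-e^{-\mu s\ell(\|x\|)}\Bigl(\frac{1-e^{-N}}{N^2}-\frac{e^{-N}}{N}\Bigr).$$ **Statement.** Conditionally on the fact that the tagged AP is at $x_0=(r_0,0)$ and transmits, the probability for another AP at $x_i$, $\|x_i\|>r_0$, to transmit is $$h_2^W(r_0,x_i)=\frac{V\bigl(x_i-x_0,\frac{\Gamma_{cs}}{P_W},\frac{\Gamma_{cs}}{P_W},N_1,N_2,N_3\bigr)}{U\bigl(x_i-x_0,\frac{\Gamma_{cs}}{P_W},N_2\bigr)},$$ where $N_1=N^W_0(x_i,r_0,\Gamma_{cs})+N^L$, $N_2=N^W_2(r_0)+N^L$ and $N_3=C^W_1(x_i,x_0)+C^L_2(x_i-x_0)$. The conditional probability is understood in the Palm sense, in both of the following ways. (a) Write $h(x_0,x)$ for the same expression with an arbitrary $x_0\in\mathbb R^2$ and $r_0=\|x_0\|$. Then for every Borel set $A\subseteq\mathbb R^2\times\mathbb R^2$, the expected number of pairs $(x_0,x)\in A$ of distinct APs such that $x_0$ is the tagged AP and both transmit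 equals $\int_A h\,d\mathcal C$, where $\mathcal C(A)$ is the expected number of such pairs for which only $x_0$ is required to transmit. (b) For every $r_0\ge 0$ and every $x_i$ with $\|x_i\|>r_0$: when the APs are $x_0=(r_0,0)$, $x_i$ and the points of $\Phi_W$, the event that $x_0$ transmits and no AP is closer to the origin than $x_0$ has positive probability, and given this event, $x_i$ transmits with probability exactly $h_2^W(r_0,x_i)$. -/

import Mathlib

open MeasureTheory ProbabilityTheory Set
open scoped ENNReal

/-- The plane `ℝ²` with its Euclidean norm and Lebesgue measure. -/
abbrev Plane : Type := EuclideanSpace ℝ (Fin 2)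

/-- Parameters of the Wi-Fi / LTE coexistence model. -/
structure LBTParams where
  /-- intensity of the Wi-Fi access points (APs) -/
  lamW : ℝ
  /-- intensity of the LTE base stations (eNBs) -/
  lamL : ℝ
  /-- transmit power of an AP -/
  powW : ℝ
  /-- transmit power of an eNB -/
  powL : ℝ
  /-- carrier sensing threshold -/
  Γcs : ℝ
  /-- energy detection threshold -/
  Γed : ℝ
  /-- parameter of the exponentially distributed fading -/
  μ : ℝ
  /-- carrier wavelength -/
  wavelength : ℝ
  /-- path loss exponent -/
  α : ℝ
  lamW_pos : 0 < lamW
  lamL_pos : 0 < lamL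
  powW_pos : 0 < powW
  powL_pos : 0 < powL
  Γcs_pos : 0 < Γcs
  Γed_pos : 0 < Γed
  μ_pos : 0 < μ
  wavelength_pos : 0 < wavelength
  α_pos : 0 < α

noncomputable section

namespace LBTParams

variable (c : LBTParams)

/-- The path loss at distance `d`; in decibels it is
`20 log₁₀ (4 π / wavelength) + 10 α log₁₀ d`. -/
def pathLoss (d : ℝ) : ℝ := (4 * Real.pi / c.wavelength) ^ 2 * d ^ c.α

/-- Mean number of APs outside the closed ball `B(0,r)` whose power received at `y` exceeds `Γ`. -/
def N₀W (y : Plane) (r Γ : ℝ) : ℝ :=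
  c.lamW * ∫ x in (Metric.closedBall (0 : Plane) r)ᶜ,
    Real.exp (-c.μ * (Γ / c.powW) * c.pathLoss ‖x - y‖)

/-- Mean number of eNBs outside the closed ball `B(0,r)` whose power received at `y` exceeds `Γ`. -/
def N₀L (y : Plane) (r Γ : ℝ) : ℝ :=
  c.lamL * ∫ x in (Metric.closedBall (0 : Plane) r)ᶜ,
    Real.exp (-c.μ * (Γ / c.powL) * c.pathLoss ‖x - y‖)

def N₂W (r : ℝ) : ℝ := c.N₀W !₂[r, 0] r c.Γcs

def NL : ℝ := c.N₀L 0 0 c.Γed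

/-- Mean number of APs outside `B(0,‖y₂‖)` whose powers received at `y₁` and `y₂` exceed `Γ₁` and
`Γ₂` respectively. -/
def C₀W (y₁ : Plane) (Γ₁ : ℝ) (y₂ : Plane) (Γ₂ : ℝ) : ℝ :=
  c.lamW * ∫ x in (Metric.closedBall (0 : Plane) ‖y₂‖)ᶜ,
    Real.exp (-c.μ * (Γ₁ / c.powW) * c.pathLoss ‖x - y₁‖
      - c.μ * (Γ₂ / c.powW) * c.pathLoss ‖x - y₂‖)

/-- Mean number of eNBs outside `B(0,‖y₂‖)` whose powers received at `y₁` and `y₂` exceed `Γ₁` and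
`Γ₂` respectively. -/
def C₀L (y₁ : Plane) (Γ₁ : ℝ) (y₂ : Plane) (Γ₂ : ℝ) : ℝ :=
  c.lamL * ∫ x in (Metric.closedBall (0 : Plane) ‖y₂‖)ᶜ,
    Real.exp (-c.μ * (Γ₁ / c.powL) * c.pathLoss ‖x - y₁‖
      - c.μ * (Γ₂ / c.powL) * c.pathLoss ‖x - y₂‖)

def C₁W (y₁ y₂ : Plane) : ℝ := c.C₀W y₁ c.Γcs y₂ c.Γcs

def C₂L (y : Plane) : ℝ := c.C₀L y c.Γed 0 c.Γed

def M (N₁ N₂ N₃ : ℝ) : ℝ :=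
  ((1 - Real.exp (-N₁)) / N₁ - (1 - Real.exp (-N₁ - N₂ + N₃)) / (N₁ + N₂ - N₃)) / (N₂ - N₃)

def V (x : Plane) (s₁ s₂ N₁ N₂ N₃ : ℝ) : ℝ :=
  (1 - Real.exp (-c.μ * s₁ * c.pathLoss ‖x‖)) * M N₁ N₂ N₃
    + (1 - Real.exp (-c.μ * s₂ * c.pathLoss ‖x‖)) * M N₂ N₁ N₃

def U (x : Plane) (s N₁ : ℝ) : ℝ :=
  (1 - Real.exp (-N₁)) / N₁
    - Real.exp (-c.μ * s * c.pathLoss ‖x‖)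
      * ((1 - Real.exp (-N₁)) / N₁ ^ 2 - Real.exp (-N₁) / N₁)

/-- The ratio `V / U` for the tagged AP at `x₀` (at distance `r₀ = ‖x₀‖` from the user at the
origin) and another AP at `x`. -/
def h₂W (x₀ x : Plane) : ℝ :=
  let N₁ := c.N₀W x ‖x₀‖ c.Γcs + c.NL
  let N₂ := c.N₂W ‖x₀‖ + c.NL
  let N₃ := c.C₁W x x₀ + c.C₂L (x - x₀)
  c.V (x - x₀) (c.Γcs / c.powW) (c.Γcs / c.powW) N₁ N₂ N₃ / c.U (x - x₀) (c.Γcs / c.powW) N₂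

end LBTParams

/-- The points `X 0, X 1, …` form a homogeneous Poisson point process of intensity `lam`: the
numbers of points in pairwise disjoint Borel sets of finite area are independent, and Poisson
distributed with mean `lam` times the area. -/
structure IsPoissonProcess {Ω : Type*} [MeasurableSpace Ω] (P : Measure Ω) (lam : ℝ)
    (X : ℕ → Ω → Plane) : Prop where
  measurable : ∀ n, Measurable (X n)
  count : ∀ (m : ℕ) (A : Fin m → Set Plane), (∀ a, MeasurableSet (A a)) →
    (∀ a, volume (A a) ≠ ∞) → Pairwise (fun a b => Disjoint (A a) (A b)) →
    ∀ k : Fin m → ℕ,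
      P {ω | ∀ a, {n | X n ω ∈ A a}.encard = k a} =
        ∏ a, poissonMeasure (Real.toNNReal (lam * (volume (A a)).toReal)) {k a}

/-- A network under listen-before-talk with LTE contention window `(0,1)`: APs indexed by `ι` at
random locations `ap i`, eNBs at the points of a Poisson process, independent back-off timers that
are uniform on `[0,1]`, independent exponential fading variables (`fadeW (j, i)` from AP `j` to
AP `i`, `fadeLW (m, i)` from eNB `m` to AP `i`); the AP locations, the eNB locations and all these
marks are independent. The law of the AP locations is left open here. -/
structure LBTNetwork {Ω : Type*} [MeasurableSpace Ω] (c : LBTParams) (P : Measure Ω)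
    (ι : Type) where
  ap : ι → Ω → Plane
  enb : ℕ → Ω → Plane
  timerW : ι → Ω → ℝ
  timerL : ℕ → Ω → ℝ
  fadeW : ι × ι → Ω → ℝ
  fadeLW : ℕ × ι → Ω → ℝ
  measurable_ap : ∀ i, Measurable (ap i)
  measurable_timerW : ∀ i, Measurable (timerW i)
  measurable_timerL : ∀ m, Measurable (timerL m)
  measurable_fadeW : ∀ p, Measurable (fadeW p)
  measurable_fadeLW : ∀ p, Measurable (fadeLW p)
  enb_poisson : IsPoissonProcess P c.lamL enb
  timerW_law : ∀ i, P.map (timerW i) = volume.restrict (Icc (0 : ℝ) 1)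
  timerL_law : ∀ m, P.map (timerL m) = volume.restrict (Icc (0 : ℝ) 1)
  fadeW_law : ∀ p, P.map (fadeW p) = expMeasure c.μ
  fadeLW_law : ∀ p, P.map (fadeLW p) = expMeasure c.μ
  indep_marks : iIndepFun (Sum.elim timerW (Sum.elim timerL (Sum.elim fadeW fadeLW))) P
  indep_locations : IndepFun (fun ω i => ap i ω) (fun ω m => enb m ω) P
  indep_locations_marks :
    IndepFun (fun ω => ((fun i => ap i ω), (fun m => enb m ω)))
      (fun ω a => Sum.elim timerW (Sum.elim timerL (Sum.elim fadeW fadeLW)) a ω) P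

namespace LBTNetwork

variable {Ω : Type*} [MeasurableSpace Ω] {c : LBTParams} {P : Measure Ω} {ι : Type}

/-- The event that the medium access indicator of AP `i` equals `1`: every factor of the product of
indicators over the other APs and over the eNBs equals `1`. -/
def transmits (net : LBTNetwork c P ι) (i : ι) : Set Ω :=
  {ω | (∀ j, j ≠ i → net.timerW i ω ≤ net.timerW j ω ∨
          net.fadeW (j, i) ω / c.pathLoss ‖net.ap j ω - net.ap i ω‖ ≤ c.Γcs / c.powW) ∧
       (∀ m, net.timerW i ω ≤ net.timerL m ω ∨
          net.fadeLW (m, i) ω / c.pathLoss ‖net.enb m ω - net.ap i ω‖ ≤ c.Γed / c.powL)}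

/-- The event that AP `i` is the tagged AP, i.e. closest to the typical user at the origin. -/
def tagged (net : LBTNetwork c P ι) (i : ι) : Set Ω :=
  {ω | ∀ j, ‖net.ap i ω‖ ≤ ‖net.ap j ω‖}

/-- The second-order Campbell measure: `A` is sent to the expected number of ordered pairs
`(i, j)` of distinct APs with `(ap i, ap j) ∈ A` for which the event `E i j` occurs. -/
def campbell (net : LBTNetwork c P ι) (E : ι → ι → Set Ω) : Measure (Plane × Plane) :=
  Measure.sum fun p : {p : ι × ι // p.1 ≠ p.2} =>
    (P.restrict (E p.1.1 p.1.2)).map fun ω => (net.ap p.1.1 ω, net.ap p.1.2 ω)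

end LBTNetwork

end

open Filter Topology
open scoped NNReal

noncomputable section

/-! The tagged AP `x₀` and the other AP `x` have timers `t` and `s`. Fix both timers and all
locations. Every further node then acts through its own independent marks, so the probability that
nobody blocks the two APs is a product over the nodes. A node with uniform timer `u` blocks `x₀` if
`u < t` and its fading is strong, which has probability `t p`; it blocks `x` with probability `s
p'`, and both with probability `min t s * (p * p')`. Hence it blocks neither with probability `1 -
(t p + s p' - min t s * (p * p'))`, which is `passProb`.

The generating functional of the Poisson processes turns these products into exponentials. Together
the eNBs and the APs give `exp (-(t N₂ + s N₁ - min t s N₃))`. The requirement that no AP is closer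
to the origin than `x₀` adds a void probability that depends on `x₀` only. Between the two APs only
the later one can be blocked by the earlier one, and it escapes with probability `1 - p₀`, where
`p₀` is the exceedance probability over `x - x₀`. If only `x₀` has to transmit, the marks blocking
`x` are ignored: the exponential is `exp (-t N₂)` and the factor `1 - p₀` appears only for `s < t`.
Integrating over `t` and `s` gives `V` in the first case (`pairMass_true`) and `U` in the second
(`pairMass_false`), each times the same void probability, which cancels in the quotient.

Part (b) is this computation for fixed `x₀` and `x` (`measure_event_inl`). For part (a) the
second-order Mecke formula (`IsPoissonProcess.pairMeasure_eq`) shows that both Campbell measures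
have density `lamW ^ 2 * pairMass` with respect to Lebesgue measure (`campbell_event`), so one has
density `h₂W` with respect to the other. The Mecke formula is itself derived from the laws of the
counts: for step functions it is a statement on factorial moments of Poisson variables, and limits
extend it to factors depending on the pair. -/

/-! ### Infinite products of numbers in `[0,1]`. -/

/-- The infinite product of a sequence of numbers in `[0,1]`. -/
def infProd (f : ℕ → ℝ≥0∞) : ℝ≥0∞ := ⨅ n, ∏ k ∈ Finset.range n, f k

lemma antitone_prod_range {f : ℕ → ℝ≥0∞} (hf : ∀ k, f k ≤ 1) :
    Antitone fun n => ∏ k ∈ Finset.range n, f k :=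
  antitone_nat_of_succ_le fun n => by
    rw [Finset.prod_range_succ]
    exact mul_le_of_le_one_right' (hf n)

lemma tendsto_prod_range_infProd {f : ℕ → ℝ≥0∞} (hf : ∀ k, f k ≤ 1) :
    Tendsto (fun n => ∏ k ∈ Finset.range n, f k) atTop (𝓝 (infProd f)) :=
  tendsto_atTop_iInf (antitone_prod_range hf)

lemma infProd_le_one (f : ℕ → ℝ≥0∞) : infProd f ≤ 1 :=
  (iInf_le _ 0).trans (by simp)

lemma infProd_eq_prod {f : ℕ → ℝ≥0∞} (hf : ∀ k, f k ≤ 1) (s : Finset ℕ)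
    (hs : ∀ k ∉ s, f k = 1) : infProd f = ∏ k ∈ s, f k := by
  refine tendsto_nhds_unique (tendsto_prod_range_infProd hf) ?_
  obtain ⟨n₀, hn₀⟩ := s.exists_nat_subset_range
  refine tendsto_const_nhds.congr' ?_
  filter_upwards [eventually_ge_atTop n₀] with n hn
  exact Finset.prod_subset (hn₀.trans (Finset.range_mono hn)) fun k _ hk => hs k hk

lemma measurable_infProd {α : Type*} [MeasurableSpace α] {f : ℕ → α → ℝ≥0∞}
    (hf : ∀ k, Measurable (f k)) : Measurable fun a => infProd fun k => f k a := by
  unfold infProd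
  exact .iInf fun n => Finset.measurable_fun_prod _ fun k _ => hf k

/-- Infinite products need not be continuous under factorwise limits. If a single finite set carries
all factors different from `1`, they reduce to finite products, which are. -/
lemma tendsto_infProd_of_finite {f : ℕ → ℕ → ℝ≥0∞} {g : ℕ → ℝ≥0∞} (hf : ∀ n k, f n k ≤ 1)
    (s : Finset ℕ) (hs : ∀ n, ∀ k ∉ s, f n k = 1)
    (h : ∀ k, Tendsto (fun n => f n k) atTop (𝓝 (g k))) :
    Tendsto (fun n => infProd (f n)) atTop (𝓝 (infProd g)) := by
  have hg : ∀ k, g k ≤ 1 := fun k => le_of_tendsto' (h k) fun n => hf n k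
  have hgs : ∀ k ∉ s, g k = 1 := fun k hk =>
    tendsto_nhds_unique (h k) (by simp [hs _ k hk])
  simp_rw [fun n => infProd_eq_prod (hf n) s (hs n), infProd_eq_prod hg s hgs]
  exact ENNReal.tendsto_finsetProd_of_ne_top _ (fun k _ => h k)
    fun k _ => ((hg k).trans_lt ENNReal.one_lt_top).ne

/-- Both sides are double infima, and a finite product of decreasing factors commutes with the
infimum over `n`. -/
lemma infProd_iInf {f : ℕ → ℕ → ℝ≥0∞} (hf : ∀ n k, f n k ≤ 1) (hanti : ∀ k, Antitone fun n => f n k) :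
    infProd (fun k => ⨅ n, f n k) = ⨅ n, infProd (f n) := by
  unfold infProd
  rw [iInf_comm]
  congr 1 with m
  have hg : ∀ k, ⨅ n, f n k ≤ 1 := fun k => (iInf_le _ 0).trans (hf 0 k)
  have h1 : Tendsto (fun n => ∏ k ∈ Finset.range m, f n k) atTop
      (𝓝 (∏ k ∈ Finset.range m, ⨅ n, f n k)) :=
    ENNReal.tendsto_finsetProd_of_ne_top _ (fun k _ => tendsto_atTop_iInf (hanti k))
      fun k _ => ((hg k).trans_lt ENNReal.one_lt_top).ne
  have h2 : Antitone fun n => ∏ k ∈ Finset.range m, f n k := fun a b hab =>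
    Finset.prod_le_prod' fun k _ => hanti k hab
  exact tendsto_nhds_unique h1 (tendsto_atTop_iInf h2)

/-! ### Factorial moments of Poisson variables and the joint law of the counts. -/

/-- This is the `r`-th derivative at `c` of the probability generating function `exp (v (c - 1))`.
It is needed for `r ≤ 2`, when up to two points of a cell are singled out and every other one
contributes a factor `c`. -/
lemma tsum_poissonMeasure_descFactorial (v c : ℝ≥0) (r : ℕ) :
    ∑' k, poissonMeasure v {k} * ((k.descFactorial r : ℝ≥0∞) * (c : ℝ≥0∞) ^ (k - r)) =
      (v : ℝ≥0∞) ^ r * ENNReal.ofReal (Real.exp (-(v * (1 - c)))) := by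
  have key : ∀ l : ℕ, poissonMeasure v {l + r} *
      (((l + r).descFactorial r : ℝ≥0∞) * (c : ℝ≥0∞) ^ (l + r - r)) =
      ENNReal.ofReal ((v : ℝ) ^ r * Real.exp (-v) * (((v : ℝ) * c) ^ l / (l.factorial : ℝ))) := by
    intro l
    have h1 : ((l + r).descFactorial r : ℝ≥0∞) * (c : ℝ≥0∞) ^ (l + r - r) =
        ENNReal.ofReal (((l + r).descFactorial r : ℝ) * (c : ℝ) ^ l) := by
      rw [ENNReal.ofReal_mul (by positivity), ENNReal.ofReal_natCast,
        ENNReal.ofReal_pow (by positivity), ENNReal.ofReal_coe_nnreal, Nat.add_sub_cancel]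
    rw [poissonMeasure_singleton, h1, ← ENNReal.ofReal_mul (by positivity)]
    congr 1
    have h2 : (l.factorial : ℝ) * ((l + r).descFactorial r : ℝ) = ((l + r).factorial : ℝ) := by
      have := Nat.factorial_mul_descFactorial (n := l + r) (k := r) (by omega)
      rw [Nat.add_sub_cancel] at this
      exact_mod_cast this
    have h3 : (l.factorial : ℝ) ≠ 0 := by positivity
    have h4 : ((l + r).factorial : ℝ) ≠ 0 := by positivity
    field_simp
    rw [← h2]
    ring
  -- The falling factorial vanishes for `k < r`, so the truncated difference `k - r` does no harm,
  -- and shifting the index by `r` leaves an exponential series.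
  rw [← (ENNReal.summable.sum_add_tsum_nat_add' (k := r)), Finset.sum_eq_zero, zero_add]
  · simp_rw [key]
    have hs : HasSum (fun l : ℕ => (v : ℝ) ^ r * Real.exp (-v) * (((v : ℝ) * c) ^ l / (l.factorial : ℝ)))
        ((v : ℝ) ^ r * Real.exp (-v) * Real.exp (v * c)) := by
      have := NormedSpace.expSeries_div_hasSum_exp ((v : ℝ) * c)
      rw [← Real.exp_eq_exp_ℝ] at this
      exact this.mul_left _
    rw [← ENNReal.ofReal_tsum_of_nonneg (fun l => by positivity) hs.summable, hs.tsum_eq,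
      mul_assoc, ← Real.exp_add, ENNReal.ofReal_mul (by positivity),
      ENNReal.ofReal_pow (by positivity), ENNReal.ofReal_coe_nnreal]
    congr 3
    ring
  · intro k hk
    rw [Nat.descFactorial_of_lt (Finset.mem_range.1 hk)]
    simp

namespace IsPoissonProcess

variable {Ω : Type*} [MeasurableSpace Ω] {P : Measure Ω} {lam : ℝ} {X : ℕ → Ω → Plane}

lemma measurable_encard_mem (hX : IsPoissonProcess P lam X) {A : Set Plane}
    (hA : MeasurableSet A) : Measurable fun ω => {n | X n ω ∈ A}.encard := by
  refine measurable_encard.comp (measurable_set_iff.2 fun n => ?_)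
  exact measurable_to_prop (by simpa [preimage] using hX.measurable n hA)

lemma measurable_ncard_mem (hX : IsPoissonProcess P lam X) {A : Set Plane}
    (hA : MeasurableSet A) : Measurable fun ω => {n | X n ω ∈ A}.ncard :=
  (measurable_from_top (f := ENat.toNat)).comp (hX.measurable_encard_mem hA)

/-- The finite values of `encard` already carry a Poisson law of total mass `1`, which leaves
nothing for `∞`. -/
lemma ae_finite [IsProbabilityMeasure P] (hX : IsPoissonProcess P lam X) {A : Set Plane}
    (hA : MeasurableSet A) (hA' : volume A ≠ ∞) : ∀ᵐ ω ∂P, {n | X n ω ∈ A}.Finite := by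
  have hm := hX.measurable_encard_mem hA
  have h1 : ∀ k : ℕ, P {ω | {n | X n ω ∈ A}.encard = k} =
      poissonMeasure (Real.toNNReal (lam * (volume A).toReal)) {k} := fun k => by
    simpa using hX.count 1 (fun _ => A) (fun _ => hA) (fun _ => hA')
      (fun a b hab => absurd (Subsingleton.elim a b) hab) (fun _ => k)
  have h2 : P (⋃ k : ℕ, {ω | {n | X n ω ∈ A}.encard = k}) = 1 := by
    rw [measure_iUnion]
    · simp_rw [h1]
      rw [← measure_univ (μ := poissonMeasure (Real.toNNReal (lam * (volume A).toReal))),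
        ← lintegral_one, lintegral_countable']
      simp
    · intro a b hab
      refine Set.disjoint_left.2 fun ω ha hb => hab ?_
      simp only [mem_ofPred_eq] at ha hb
      exact_mod_cast ha.symm.trans hb
    · exact fun k => hm (measurableSet_singleton _)
  have h3 : ∀ᵐ ω ∂P, ω ∈ ⋃ k : ℕ, {ω | {n | X n ω ∈ A}.encard = k} := by
    rw [← prob_compl_eq_zero_iff] at h2
    · exact h2
    · exact .iUnion fun k => hm (measurableSet_singleton _)
  filter_upwards [h3] with ω hω
  obtain ⟨k, hk⟩ := mem_iUnion.1 hω
  exact finite_of_encard_eq_coe hk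

lemma map_ncard [IsProbabilityMeasure P] (hX : IsPoissonProcess P lam X) {m : ℕ}
    {A : Fin m → Set Plane} (hA : ∀ a, MeasurableSet (A a)) (hA' : ∀ a, volume (A a) ≠ ∞)
    (hd : Pairwise (fun a b => Disjoint (A a) (A b))) :
    P.map (fun ω a => {n | X n ω ∈ A a}.ncard) =
      Measure.pi fun a => poissonMeasure (Real.toNNReal (lam * (volume (A a)).toReal)) := by
  have hm : Measurable fun ω a => {n | X n ω ∈ A a}.ncard :=
    measurable_pi_lambda _ fun a => hX.measurable_ncard_mem (hA a)
  have : IsProbabilityMeasure (P.map (fun ω a => {n | X n ω ∈ A a}.ncard)) :=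
    Measure.isProbabilityMeasure_map hm.aemeasurable
  refine Measure.ext_of_singleton fun k => ?_
  rw [Measure.map_apply hm (measurableSet_singleton _), Measure.pi_singleton,
    ← hX.count m A hA hA' hd k]
  refine measure_congr ?_
  have := ae_all_iff.2 fun a => hX.ae_finite (hA a) (hA' a)
  filter_upwards [this] with ω hω
  refine propext ?_
  change (fun a => {n | X n ω ∈ A a}.ncard) = k ↔ ∀ a, {n | X n ω ∈ A a}.encard = k a
  rw [funext_iff]
  refine forall_congr' fun a => ?_
  rw [← (hω a).cast_ncard_eq]
  exact Nat.cast_inj.symm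

lemma lintegral_prod_ncard [IsProbabilityMeasure P] (hX : IsPoissonProcess P lam X)
    {κ : Type*} (S : Finset κ) {A : κ → Set Plane} (hA : ∀ a, MeasurableSet (A a))
    (hA' : ∀ a ∈ S, volume (A a) ≠ ∞) (hd : Pairwise (fun a b => Disjoint (A a) (A b)))
    (h : κ → ℕ → ℝ≥0∞) :
    ∫⁻ ω, ∏ a ∈ S, h a {n | X n ω ∈ A a}.ncard ∂P =
      ∏ a ∈ S, ∑' k, poissonMeasure (Real.toNNReal (lam * (volume (A a)).toReal)) {k} * h a k := by
  let e := S.equivFin.symm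
  let B : Fin S.card → Set Plane := fun a => A (e a)
  have hB := hX.map_ncard (A := B) (fun a => hA _) (fun a => hA' _ (e a).2)
    (fun a b hab => hd fun hc => hab (e.injective (Subtype.ext hc)))
  have hm : Measurable fun ω a => {n | X n ω ∈ B a}.ncard :=
    measurable_pi_lambda _ fun a => hX.measurable_ncard_mem (hA _)
  have hre : ∀ f : κ → ℝ≥0∞, ∏ a ∈ S, f a = ∏ a : Fin S.card, f (e a) := fun f => by
    rw [← Finset.prod_coe_sort, ← e.prod_comp]
  simp_rw [hre]
  have h1 : ∫⁻ ω, ∏ a, h (e a) {n | X n ω ∈ B a}.ncard ∂P =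
      ∫⁻ k, ∏ a, h (e a) (k a) ∂(P.map (fun ω a => {n | X n ω ∈ B a}.ncard)) := by
    rw [lintegral_map (measurable_of_countable _) hm]
  refine h1.trans ?_
  rw [hB, lintegral_prod_eq_prod_lintegral_of_indepFun Finset.univ
    (fun a (k : Fin S.card → ℕ) => h (e a) (k a))
    (iIndepFun_pi fun a => (measurable_of_countable (h (e a))).aemeasurable)
    fun a => measurable_of_countable _]
  refine Finset.prod_congr rfl fun a _ => ?_
  rw [(measurePreserving_eval _ a).lintegral_comp (measurable_of_countable (h (e a))),
    lintegral_countable']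
  simp_rw [mul_comm]
  rfl

end IsPoissonProcess

lemma tendsto_infProd_of_antitone {f : ℕ → ℕ → ℝ≥0∞} {g : ℕ → ℝ≥0∞} (hf : ∀ n k, f n k ≤ 1)
    (hanti : ∀ k, Antitone fun n => f n k) (hg : ∀ k, ⨅ n, f n k = g k) :
    Tendsto (fun n => infProd (f n)) atTop (𝓝 (infProd g)) := by
  rw [← funext hg, infProd_iInf hf hanti]
  refine tendsto_atTop_iInf fun a b hab => ?_
  exact iInf_mono fun n => Finset.prod_le_prod' fun k _ => hanti k hab

/-! ### The generating functional and points grouped by colour. -/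

/-- The value `exp (-lam ∫ (1 - g))` of the generating functional of a Poisson process. -/
def genFun (lam : ℝ) (g : Plane → ℝ≥0∞) : ℝ≥0∞ :=
  ENNReal.ofReal (Real.exp (-(lam * (∫⁻ z, 1 - g z).toReal)))

lemma genFun_le_one {lam : ℝ} (hlam : 0 ≤ lam) (g : Plane → ℝ≥0∞) : genFun lam g ≤ 1 := by
  rw [genFun, ENNReal.ofReal_le_one, Real.exp_le_one_iff, neg_nonpos]
  positivity

lemma tendsto_genFun {lam : ℝ} {g : ℕ → Plane → ℝ≥0∞} {g' : Plane → ℝ≥0∞}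
    (hg' : ∫⁻ z, 1 - g' z ≠ ∞)
    (h : Tendsto (fun n => ∫⁻ z, 1 - g n z) atTop (𝓝 (∫⁻ z, 1 - g' z))) :
    Tendsto (fun n => genFun lam (g n)) atTop (𝓝 (genFun lam g')) := by
  refine ENNReal.tendsto_ofReal ?_
  refine (Real.continuous_exp.tendsto _).comp (Tendsto.neg (Tendsto.const_mul _ ?_))
  exact (ENNReal.tendsto_toReal hg').comp h

/-- Here `s n` is the colour of the `n`-th point. Collecting equal factors replaces the product over
points by powers indexed by colours, with the indices in `R` removed from the counts. -/
lemma infProd_color {β : Type*} [DecidableEq β] (s : ℕ → β) (S : Finset β) (c : β → ℝ≥0)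
    (hc : ∀ b, c b ≤ 1) (hcS : ∀ n, s n ∉ S → c (s n) = 1) (hfin : ∀ b ∈ S, {n | s n = b}.Finite)
    (R : Finset ℕ) :
    infProd (fun k => if k ∈ R then 1 else (c (s k) : ℝ≥0∞)) =
      ∏ b ∈ S, (c b : ℝ≥0∞) ^ ({n | s n = b}.ncard - (R.filter fun n => s n = b).card) := by
  have hT : {n | s n ∈ S}.Finite := by
    have : {n | s n ∈ S} = ⋃ b ∈ S, {n | s n = b} := by ext; simp
    rw [this]
    exact S.finite_toSet.biUnion hfin
  have hmem : ∀ k, k ∈ hT.toFinset ↔ s k ∈ S := fun k => by simp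
  rw [infProd_eq_prod (fun k => ?_) (hT.toFinset \ R) fun k hk => ?_]
  · rw [← Finset.prod_fiberwise_of_maps_to (t := S) (g := s)
      (fun k hk => (hmem k).1 (Finset.mem_sdiff.1 hk).1)]
    refine Finset.prod_congr rfl fun b hb => ?_
    have h1 : ∀ k ∈ (hT.toFinset \ R).filter (fun k => s k = b),
        (if k ∈ R then 1 else (c (s k) : ℝ≥0∞)) = c b := fun k hk => by
      rw [Finset.mem_filter, Finset.mem_sdiff] at hk
      rw [if_neg hk.1.2, hk.2]
    rw [Finset.prod_congr rfl h1, Finset.prod_const]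
    congr 1
    have h2 : (hT.toFinset \ R).filter (fun k => s k = b) =
        (hfin b hb).toFinset \ R.filter (fun k => s k = b) := by
      ext k
      simp only [Finset.mem_filter, Finset.mem_sdiff, hmem, Finite.mem_toFinset, mem_ofPred_eq]
      constructor
      · rintro ⟨⟨_, h⟩, h'⟩
        exact ⟨h', fun h'' => h h''.1⟩
      · rintro ⟨h, h'⟩
        exact ⟨⟨h ▸ hb, fun h'' => h' ⟨h'', h⟩⟩, h⟩
    rw [h2, Finset.card_sdiff_of_subset, ncard_eq_toFinset_card _ (hfin b hb)]
    intro k hk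
    simpa using (Finset.mem_filter.1 hk).2
  · split_ifs
    · exact le_rfl
    · exact_mod_cast hc _
  · split_ifs with h
    · rfl
    · rw [hcS, ENNReal.coe_one]
      intro h'
      exact hk (Finset.mem_sdiff.2 ⟨(hmem k).2 h', h⟩)

/-- All admissible pairs contribute the same product, with the counts lowered by the colours used.
Their number is `N_a * (N_a - 1)` if the two colours agree and `N_a * N_b` otherwise; both are
products of falling factorials, the form in which Poisson expectations are explicit. -/
lemma tsum_pair_color {β : Type*} [DecidableEq β] (s : ℕ → β) (S : Finset β) (c : β → ℝ≥0)
    (hc : ∀ b, c b ≤ 1) (hcS : ∀ n, s n ∉ S → c (s n) = 1) (hfin : ∀ b ∈ S, {n | s n = b}.Finite)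
    {a b : β} (ha : a ∈ S) (hb : b ∈ S) :
    ∑' p : ℕ × ℕ, (if p.1 = p.2 then 0 else
      (if s p.1 = a ∧ s p.2 = b then 1 else 0) *
        infProd (fun k => if k = p.1 ∨ k = p.2 then 1 else (c (s k) : ℝ≥0∞))) =
      ∏ d ∈ S, (({n | s n = d}.ncard.descFactorial
          ((if d = a then 1 else 0) + (if d = b then 1 else 0)) : ℕ) : ℝ≥0∞) *
        (c d : ℝ≥0∞) ^ ({n | s n = d}.ncard -
          ((if d = a then 1 else 0) + (if d = b then 1 else 0))) := by
  set r : β → ℕ := fun d => (if d = a then 1 else 0) + (if d = b then 1 else 0) with hr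
  set K : ℝ≥0∞ := ∏ d ∈ S, (c d : ℝ≥0∞) ^ ({n | s n = d}.ncard - r d) with hK
  set Fa := (hfin a ha).toFinset
  set Fb := (hfin b hb).toFinset
  have hFa : ∀ k, k ∈ Fa ↔ s k = a := fun k => by simp [Fa]
  have hFb : ∀ k, k ∈ Fb ↔ s k = b := fun k => by simp [Fb]
  set Q : Finset (ℕ × ℕ) := (Fa ×ˢ Fb).filter fun p => p.1 ≠ p.2
  have hQ : ∀ p, p ∈ Q ↔ (s p.1 = a ∧ s p.2 = b) ∧ p.1 ≠ p.2 := fun p => by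
    simp only [Q, Finset.mem_filter, Finset.mem_product, hFa, hFb]
  have hterm : ∀ p : ℕ × ℕ, (if p.1 = p.2 then 0 else
      (if s p.1 = a ∧ s p.2 = b then 1 else 0) *
        infProd (fun k => if k = p.1 ∨ k = p.2 then 1 else (c (s k) : ℝ≥0∞))) =
      if p ∈ Q then K else 0 := by
    intro p
    by_cases h1 : p.1 = p.2
    · rw [if_pos h1, if_neg fun h => ((hQ p).1 h).2 h1]
    by_cases h2 : s p.1 = a ∧ s p.2 = b
    · rw [if_neg h1, if_pos h2, if_pos ((hQ p).2 ⟨h2, h1⟩), one_mul, hK]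
      have h3 := infProd_color s S c hc hcS hfin {p.1, p.2}
      simp only [Finset.mem_insert, Finset.mem_singleton] at h3
      rw [h3]
      refine Finset.prod_congr rfl fun d _ => ?_
      congr 2
      rw [Finset.filter_insert, Finset.filter_singleton, h2.1, h2.2, hr]
      dsimp only
      by_cases hda : a = d
      · by_cases hdb : b = d
        · rw [if_pos hda, if_pos hdb, if_pos hda.symm, if_pos hdb.symm, Finset.card_pair h1]
        · rw [if_pos hda, if_neg hdb, if_pos hda.symm, if_neg (Ne.symm hdb)]
          rfl
      · by_cases hdb : b = d
        · rw [if_neg hda, if_pos hdb, if_neg (Ne.symm hda), if_pos hdb.symm]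
          rfl
        · rw [if_neg hda, if_neg hdb, if_neg (Ne.symm hda), if_neg (Ne.symm hdb)]
          rfl
    · rw [if_neg h1, if_neg h2, if_neg fun h => h2 ((hQ p).1 h).1, zero_mul]
  simp_rw [hterm]
  rw [tsum_eq_sum (s := Q) (fun p hp => if_neg hp), Finset.sum_congr rfl fun p hp => if_pos hp,
    Finset.sum_const, Finset.prod_mul_distrib, nsmul_eq_mul]
  congr 1
  rw [← Nat.cast_prod]
  congr 1
  have hca : Fa.card = {n | s n = a}.ncard := (ncard_eq_toFinset_card _ _).symm
  have hcb : Fb.card = {n | s n = b}.ncard := (ncard_eq_toFinset_card _ _).symm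
  by_cases hab : a = b
  · subst hab
    have : Q = Fa.offDiag := by
      ext p
      rw [hQ, Finset.mem_offDiag, hFa, hFa, and_assoc]
    rw [this, Finset.offDiag_card, Finset.prod_eq_single a, hca]
    · simp [Nat.descFactorial_succ, Nat.mul_sub, mul_comm]
    · intro d _ hd
      simp [hd]
    · exact fun h => absurd ha h
  · have : Q = Fa ×ˢ Fb := by
      ext p
      rw [hQ, Finset.mem_product, hFa, hFb]
      refine ⟨fun h => h.1, fun h => ⟨h, fun h' => hab ?_⟩⟩
      rw [← h.1, ← h.2, h']
    rw [this, Finset.card_product, Finset.prod_eq_mul a b hab, hca, hcb]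
    · simp [hab, Ne.symm hab]
    · intro d _ hd
      simp [hd.1, hd.2]
    · exact fun h => absurd ha h
    · exact fun h => absurd hb h

lemma _root_.MeasureTheory.SimpleFunc.eq_of_notMem_erase {α β : Type*} [MeasurableSpace α]
    [DecidableEq β] (σ : SimpleFunc α β) {b₀ : β} {z : α} (h : σ z ∉ σ.range.erase b₀) :
    σ z = b₀ := by
  by_contra h'
  exact h (Finset.mem_erase.2 ⟨h', σ.mem_range_self z⟩)

namespace IsPoissonProcess

variable {Ω : Type*} [MeasurableSpace Ω] {P : Measure Ω} [IsProbabilityMeasure P] {lam : ℝ}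
  {X : ℕ → Ω → Plane}

-- Cells of different colours have independent Poisson counts, so the expectation factorises into
-- factorial moments. The background colour `b₀` may fill infinite area; it drops out because its
-- factor is `1`.
open Classical in
lemma lintegral_color (hX : IsPoissonProcess P lam X) (hlam : 0 ≤ lam) {β : Type*}
    (σ : SimpleFunc Plane β) (b₀ : β) (hσ : ∀ b, b ≠ b₀ → volume (σ ⁻¹' {b}) ≠ ∞)
    (c : β → ℝ≥0) (hc : ∀ b, c b ≤ 1) (hc₀ : c b₀ = 1) (r : β → ℕ) :
    ∫⁻ ω, ∏ d ∈ σ.range.erase b₀, (({n | σ (X n ω) = d}.ncard.descFactorial (r d) : ℕ) : ℝ≥0∞) *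
        (c d : ℝ≥0∞) ^ ({n | σ (X n ω) = d}.ncard - r d) ∂P =
      (∏ d ∈ σ.range.erase b₀, (ENNReal.ofReal lam * volume (σ ⁻¹' {d})) ^ r d) *
        genFun lam fun z => c (σ z) := by
  set S := σ.range.erase b₀
  have hS : ∀ d ∈ S, volume (σ ⁻¹' {d}) ≠ ∞ := fun d hd => hσ d (Finset.mem_erase.1 hd).1
  have h1 := hX.lintegral_prod_ncard S (A := fun d => σ ⁻¹' {d}) (fun d => σ.measurableSet_fiber d)
    hS (fun a b hab => Disjoint.preimage _ (disjoint_singleton.2 hab))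
    (fun d k => ((k.descFactorial (r d) : ℕ) : ℝ≥0∞) * (c d : ℝ≥0∞) ^ (k - r d))
  refine h1.trans ?_
  simp_rw [tsum_poissonMeasure_descFactorial]
  rw [Finset.prod_mul_distrib]
  congr 1
  · refine Finset.prod_congr rfl fun d hd => ?_
    congr 1
    change ENNReal.ofReal _ = _
    rw [ENNReal.ofReal_mul hlam, ENNReal.ofReal_toReal (hS d hd)]
  · rw [← ENNReal.ofReal_prod_of_nonneg (fun _ _ => by positivity), ← Real.exp_sum, genFun]
    congr 2
    rw [Finset.sum_neg_distrib]
    congr 1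
    have h2 : ∫⁻ z, 1 - (c (σ z) : ℝ≥0∞) = ∑ d ∈ S, (1 - (c d : ℝ≥0∞)) * volume (σ ⁻¹' {d}) := by
      have := (σ.map_lintegral (fun d => 1 - (c d : ℝ≥0∞)) (μ := volume))
      rw [← SimpleFunc.lintegral_eq_lintegral] at this
      refine this.trans (Finset.sum_subset (Finset.erase_subset _ _) fun d hd hd' => ?_).symm
      have : d = b₀ := by
        by_contra h
        exact hd' (Finset.mem_erase.2 ⟨h, hd⟩)
      rw [this, hc₀]
      simp
    rw [h2, ENNReal.toReal_sum fun d hd => ENNReal.mul_ne_top (by finiteness) (hS d hd),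
      Finset.mul_sum]
    refine Finset.sum_congr rfl fun d _ => ?_
    rw [ENNReal.toReal_mul, Real.coe_toNNReal _ (by positivity), ENNReal.toReal_sub_of_le
      (by exact_mod_cast hc d) ENNReal.one_ne_top, ENNReal.toReal_one, ENNReal.coe_toReal]
    ring

open Classical in
lemma ae_finite_color (hX : IsPoissonProcess P lam X) {β : Type*}
    (σ : SimpleFunc Plane β) (b₀ : β) (hσ : ∀ b, b ≠ b₀ → volume (σ ⁻¹' {b}) ≠ ∞) :
    ∀ᵐ ω ∂P, ∀ b ∈ σ.range.erase b₀, {n | σ (X n ω) = b}.Finite := by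
  have : ∀ᵐ ω ∂P, ∀ b : (σ.range.erase b₀ : Finset β), {n | X n ω ∈ σ ⁻¹' {b.1}}.Finite :=
    ae_all_iff.2 fun b => hX.ae_finite (σ.measurableSet_fiber _) (hσ _ (Finset.mem_erase.1 b.2).1)
  filter_upwards [this] with ω hω b hb using hω ⟨b, hb⟩

lemma lintegral_infProd_simple (hX : IsPoissonProcess P lam X) (hlam : 0 ≤ lam) {β : Type*}
    (σ : SimpleFunc Plane β) (b₀ : β) (hσ : ∀ b, b ≠ b₀ → volume (σ ⁻¹' {b}) ≠ ∞)
    (c : β → ℝ≥0) (hc : ∀ b, c b ≤ 1) (hc₀ : c b₀ = 1) :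
    ∫⁻ ω, infProd (fun k => c (σ (X k ω))) ∂P = genFun lam fun z => c (σ z) := by
  classical
  have h := hX.lintegral_color hlam σ b₀ hσ c hc hc₀ 0
  simp only [Pi.zero_apply, pow_zero, Finset.prod_const_one, one_mul] at h
  rw [← h]
  refine lintegral_congr_ae ?_
  filter_upwards [hX.ae_finite_color σ b₀ hσ] with ω hω
  have := infProd_color (fun n => σ (X n ω)) (σ.range.erase b₀) c hc
    (fun n hn => hc₀ ▸ congrArg c (σ.eq_of_notMem_erase hn)) hω ∅
  simpa using this

/-- The Mecke formula for step functions. Expanding `u` and `w` over the colours reduces it to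
`tsum_pair_color` and `lintegral_color`; since both vanish at `b₀`, only cells of finite area
matter. -/
lemma lintegral_pair_simple (hX : IsPoissonProcess P lam X) (hlam : 0 ≤ lam) {β : Type*}
    (σ : SimpleFunc Plane β) (b₀ : β) (hσ : ∀ b, b ≠ b₀ → volume (σ ⁻¹' {b}) ≠ ∞)
    (c : β → ℝ≥0) (hc : ∀ b, c b ≤ 1) (hc₀ : c b₀ = 1) (u w : β → ℝ≥0∞)
    (hu : u b₀ = 0) (hw : w b₀ = 0) :
    ∫⁻ ω, ∑' p : ℕ × ℕ, (if p.1 = p.2 then 0 else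
      u (σ (X p.1 ω)) * w (σ (X p.2 ω)) *
        infProd (fun k => if k = p.1 ∨ k = p.2 then 1 else (c (σ (X k ω)) : ℝ≥0∞))) ∂P =
      ENNReal.ofReal lam ^ 2 * ((∫⁻ z, u (σ z)) * ∫⁻ z, w (σ z)) * genFun lam fun z => c (σ z) := by
  classical
  set S := σ.range.erase b₀
  let r : β → β → β → ℕ := fun a b d => (if d = a then 1 else 0) + (if d = b then 1 else 0)
  have hone : ∀ v : β → ℝ≥0∞, v b₀ = 0 → ∀ z, v (σ z) =
      ∑ a ∈ S, v a * if σ z = a then 1 else 0 := by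
    intro v hv z
    simp only [mul_ite, mul_one, mul_zero]
    rw [Finset.sum_ite_eq]
    split_ifs with h
    · rfl
    · rw [σ.eq_of_notMem_erase h, hv]
  have hint : ∀ v : β → ℝ≥0∞, v b₀ = 0 → ∫⁻ z, v (σ z) = ∑ a ∈ S, v a * volume (σ ⁻¹' {a}) := by
    intro v hv
    have := σ.map_lintegral v (μ := volume)
    rw [← SimpleFunc.lintegral_eq_lintegral] at this
    refine this.trans (Finset.sum_subset (Finset.erase_subset _ _) fun d hd hd' => ?_).symm
    have : d = b₀ := by
      by_contra h
      exact hd' (Finset.mem_erase.2 ⟨h, hd⟩)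
    rw [this, hv, zero_mul]
  have hpt : ∀ᵐ ω ∂P, ∑' p : ℕ × ℕ, (if p.1 = p.2 then 0 else
      u (σ (X p.1 ω)) * w (σ (X p.2 ω)) *
        infProd (fun k => if k = p.1 ∨ k = p.2 then 1 else (c (σ (X k ω)) : ℝ≥0∞))) =
      ∑ a ∈ S, ∑ b ∈ S, u a * w b * ∏ d ∈ S, (({n | σ (X n ω) = d}.ncard.descFactorial
        (r a b d) : ℕ) : ℝ≥0∞) * (c d : ℝ≥0∞) ^ ({n | σ (X n ω) = d}.ncard - r a b d) := by
    filter_upwards [hX.ae_finite_color σ b₀ hσ] with ω hω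
    have h1 := fun a (ha : a ∈ S) b (hb : b ∈ S) => tsum_pair_color (fun n => σ (X n ω)) S c hc
      (fun n hn => hc₀ ▸ congrArg c (σ.eq_of_notMem_erase hn)) hω ha hb
    rw [Finset.sum_congr rfl fun a ha => Finset.sum_congr rfl fun b hb => by
      rw [← h1 a ha b hb, ← ENNReal.tsum_mul_left]]
    rw [Finset.sum_congr rfl fun a _ => (Summable.tsum_finsetSum fun _ _ => ENNReal.summable).symm,
      ← Summable.tsum_finsetSum fun _ _ => ENNReal.summable]
    refine tsum_congr fun p => ?_
    by_cases hp : p.1 = p.2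
    · simp [hp]
    · simp_rw [if_neg hp, ← mul_assoc, ← Finset.sum_mul]
      congr 1
      rw [hone u hu, hone w hw, Finset.sum_mul_sum]
      refine Finset.sum_congr rfl fun a _ => Finset.sum_congr rfl fun b _ => ?_
      by_cases h3 : σ (X p.1 ω) = a <;> by_cases h4 : σ (X p.2 ω) = b <;> simp [h3, h4]
  have hmeas : ∀ a b, Measurable fun ω => ∏ d ∈ S, (({n | σ (X n ω) = d}.ncard.descFactorial
        (r a b d) : ℕ) : ℝ≥0∞) * (c d : ℝ≥0∞) ^ ({n | σ (X n ω) = d}.ncard - r a b d) :=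
    fun a b => Finset.measurable_fun_prod _ fun d _ =>
      (measurable_of_countable (fun k : ℕ => ((k.descFactorial (r a b d) : ℕ) : ℝ≥0∞) *
        (c d : ℝ≥0∞) ^ (k - r a b d))).comp
          (hX.measurable_ncard_mem (σ.measurableSet_fiber d))
  rw [lintegral_congr_ae hpt, lintegral_finsetSum _ fun a _ =>
    Finset.measurable_fun_sum _ fun b _ => (hmeas a b).const_mul _, hint u hu, hint w hw,
    Finset.sum_mul_sum, Finset.mul_sum, Finset.sum_mul]
  refine Finset.sum_congr rfl fun a ha => ?_
  rw [lintegral_finsetSum _ fun b _ => (hmeas a b).const_mul _, Finset.mul_sum, Finset.sum_mul]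
  refine Finset.sum_congr rfl fun b hb => ?_
  rw [lintegral_const_mul _ (hmeas a b), hX.lintegral_color hlam σ b₀ hσ c hc hc₀ (r a b)]
  have hprod : ∏ d ∈ S, (ENNReal.ofReal lam * volume (σ ⁻¹' {d})) ^ r a b d =
      (ENNReal.ofReal lam * volume (σ ⁻¹' {a})) * (ENNReal.ofReal lam * volume (σ ⁻¹' {b})) := by
    simp only [r, pow_add, Finset.prod_mul_distrib, pow_ite, pow_one, pow_zero]
    rw [Finset.prod_ite_eq' S a, Finset.prod_ite_eq' S b, if_pos ha, if_pos hb]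
  rw [hprod]
  ring

/-- The generating functional of a Poisson process. -/
theorem lintegral_infProd (hX : IsPoissonProcess P lam X) (hlam : 0 ≤ lam) {g : Plane → ℝ≥0∞}
    (hg : Measurable g) (hg1 : ∀ z, g z ≤ 1) (hfin : ∫⁻ z, 1 - g z ≠ ∞) :
    ∫⁻ ω, infProd (fun k => g (X k ω)) ∂P = genFun lam g := by
  have hφ : Measurable fun z => 1 - g z := measurable_const.sub hg
  -- Approximating `1 - g` from below, rather than `g`, gives every cell with a nonzero value finite
  -- area, because the integrals stay below that of `1 - g`.
  set ψ := SimpleFunc.eapprox fun z => 1 - g z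
  have hψ1 : ∀ n z, ψ n z ≤ 1 - g z := fun n z => by
    rw [← SimpleFunc.iSup_eapprox_apply hφ z]
    exact le_iSup (fun n => ψ n z) n
  have hmono : ∀ z, Monotone fun n => ψ n z := fun z a b hab => SimpleFunc.monotone_eapprox _ hab z
  have hgn : ∀ z, ⨅ n, (1 - ψ n z) = g z := fun z => by
    rw [← ENNReal.sub_iSup ENNReal.one_ne_top, SimpleFunc.iSup_eapprox_apply hφ z,
      ENNReal.sub_sub_cancel ENNReal.one_ne_top (hg1 z)]
  have hanti : ∀ z, Antitone fun n => 1 - ψ n z := fun z a b hab => tsub_le_tsub_left (hmono z hab) _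
  have hstep : ∀ n, ∫⁻ ω, infProd (fun k => 1 - ψ n (X k ω)) ∂P =
      genFun lam fun z => 1 - ψ n z := fun n => by
    have hlt : (ψ n).lintegral volume ≠ ∞ := by
      rw [← SimpleFunc.lintegral_eq_lintegral]
      exact ((lintegral_mono (hψ1 n)).trans_lt hfin.lt_top).ne
    have := hX.lintegral_infProd_simple hlam (ψ n) 0
      (fun b hb => (SimpleFunc.finMeasSupp_iff.1 (SimpleFunc.FinMeasSupp.of_lintegral_ne_top hlt) b hb).ne)
      (fun b => (1 - b).toNNReal) (fun b => by simpa using ENNReal.toNNReal_mono ENNReal.one_ne_top (tsub_le_self (a := 1) (b := b))) (by simp)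
    simpa [ENNReal.coe_toNNReal, (tsub_le_self.trans_lt ENNReal.one_lt_top).ne] using this
  have hmeas : ∀ n k, Measurable fun ω => 1 - ψ n (X k ω) := fun n k =>
    measurable_const.sub ((ψ n).measurable.comp (hX.measurable k))
  have hL : Tendsto (fun n => ∫⁻ ω, infProd (fun k => 1 - ψ n (X k ω)) ∂P) atTop
      (𝓝 (∫⁻ ω, infProd (fun k => g (X k ω)) ∂P)) := by
    refine tendsto_lintegral_of_dominated_convergence 1 (fun n => measurable_infProd (hmeas n))
      (fun n => ae_of_all _ fun ω => infProd_le_one _) (by simp) (ae_of_all _ fun ω => ?_)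
    exact tendsto_infProd_of_antitone (fun n k => tsub_le_self) (fun k => hanti _)
      fun k => hgn _
  refine tendsto_nhds_unique hL ?_
  simp_rw [hstep]
  refine tendsto_genFun hfin ?_
  have h1 : ∀ n z, 1 - (1 - ψ n z) = ψ n z := fun n z =>
    ENNReal.sub_sub_cancel ENNReal.one_ne_top ((hψ1 n z).trans tsub_le_self)
  simp_rw [h1]
  refine lintegral_tendsto_of_tendsto_of_monotone (fun n => (ψ n).measurable.aemeasurable)
    (ae_of_all _ hmono) (ae_of_all _ fun z => ?_)
  exact SimpleFunc.tendsto_eapprox hφ z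

end IsPoissonProcess

/-! ### The pair measure and the second-order Mecke formula. -/

section PairMeasure

variable {Ω : Type*} [MeasurableSpace Ω]

/-- The measure sending `D` to the expectation of the sum, over the ordered pairs `(i, j)` of
distinct indices with `(X i, X j) ∈ D`, of the product of `G (X i, X j) (X k)` over the other `k`. -/
def pairMeasure (P : Measure Ω) (X : ℕ → Ω → Plane) (G : Plane × Plane → Plane → ℝ≥0∞) :
    Measure (Plane × Plane) :=
  Measure.sum fun p : ℕ × ℕ => if p.1 = p.2 then 0 else
    (P.withDensity fun ω => infProd fun k =>
      if k = p.1 ∨ k = p.2 then 1 else G (X p.1 ω, X p.2 ω) (X k ω)).map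
        fun ω => (X p.1 ω, X p.2 ω)

/-- The summand of `pairMeasure` as a function of the pair of indices. -/
def pairTerm (X : ℕ → Ω → Plane) (F : Plane × Plane → ℝ≥0∞) (G : Plane × Plane → Plane → ℝ≥0∞)
    (p : ℕ × ℕ) (ω : Ω) : ℝ≥0∞ :=
  if p.1 = p.2 then 0 else F (X p.1 ω, X p.2 ω) *
    infProd fun k => if k = p.1 ∨ k = p.2 then 1 else G (X p.1 ω, X p.2 ω) (X k ω)

section

variable {X : ℕ → Ω → Plane} {G : Plane × Plane → Plane → ℝ≥0∞}

lemma measurable_infProd_pair (hX : ∀ n, Measurable (X n))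
    (hG : Measurable (Function.uncurry G)) (p : ℕ × ℕ) :
    Measurable fun ω => infProd fun k =>
      if k = p.1 ∨ k = p.2 then 1 else G (X p.1 ω, X p.2 ω) (X k ω) := by
  refine measurable_infProd fun k => ?_
  split_ifs
  · exact measurable_const
  · exact hG.comp (((hX _).prodMk (hX _)).prodMk (hX k))

lemma measurable_pairTerm (hX : ∀ n, Measurable (X n)) {F : Plane × Plane → ℝ≥0∞}
    (hF : Measurable F) (hG : Measurable (Function.uncurry G)) (p : ℕ × ℕ) :
    Measurable (pairTerm X F G p) := by
  unfold pairTerm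
  split_ifs
  · exact measurable_const
  · exact (hF.comp ((hX _).prodMk (hX _))).mul (measurable_infProd_pair hX hG p)

lemma lintegral_pairMeasure {P : Measure Ω} (hX : ∀ n, Measurable (X n)) {F : Plane × Plane → ℝ≥0∞}
    (hF : Measurable F) (hG : Measurable (Function.uncurry G)) :
    ∫⁻ z, F z ∂pairMeasure P X G = ∑' p, ∫⁻ ω, pairTerm X F G p ω ∂P := by
  rw [pairMeasure, lintegral_sum_measure]
  refine tsum_congr fun p => ?_
  unfold pairTerm
  split_ifs with h
  · simp
  · rw [lintegral_map hF ((hX _).prodMk (hX _)),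
      lintegral_withDensity_eq_lintegral_mul _ (measurable_infProd_pair hX hG p)
        (g := fun ω => F (X p.1 ω, X p.2 ω)) (hF.comp ((hX _).prodMk (hX _)))]
    simp only [Pi.mul_apply, mul_comm]

/-- With the sum over pairs written as an integral against counting measure, one application of
dominated convergence handles pairs and randomness together. -/
lemma lintegral_pairMeasure' {P : Measure Ω} [SFinite P] (hX : ∀ n, Measurable (X n))
    {F : Plane × Plane → ℝ≥0∞} (hF : Measurable F) (hG : Measurable (Function.uncurry G)) :
    ∫⁻ z, F z ∂pairMeasure P X G =
      ∫⁻ q, pairTerm X F G q.1 q.2 ∂((Measure.count : Measure (ℕ × ℕ)).prod P) := by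
  rw [lintegral_pairMeasure hX hF hG, lintegral_prod, lintegral_count]
  exact (measurable_from_prod_countable_right fun p =>
    measurable_pairTerm hX hF hG p).aemeasurable

/-- The dominating function is the summand with all factors replaced by `1`, integrable by `hfin`.
Convergence matters only for pairs at which `F` does not vanish. -/
lemma tendsto_lintegral_pairMeasure {P : Measure Ω} [SFinite P] (hX : ∀ n, Measurable (X n))
    {F : Plane × Plane → ℝ≥0∞} (hF : Measurable F)
    (hfin : ∫⁻ z, F z ∂pairMeasure P X (fun _ _ => 1) ≠ ∞)
    {Gn : ℕ → Plane × Plane → Plane → ℝ≥0∞} (hGn : ∀ n, Measurable (Function.uncurry (Gn n)))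
    (hG : Measurable (Function.uncurry G))
    (h : ∀ᵐ ω ∂P, ∀ p : ℕ × ℕ, p.1 ≠ p.2 → F (X p.1 ω, X p.2 ω) ≠ 0 →
      Tendsto (fun n => infProd fun k =>
          if k = p.1 ∨ k = p.2 then 1 else Gn n (X p.1 ω, X p.2 ω) (X k ω)) atTop
        (𝓝 (infProd fun k => if k = p.1 ∨ k = p.2 then 1 else G (X p.1 ω, X p.2 ω) (X k ω)))) :
    Tendsto (fun n => ∫⁻ z, F z ∂pairMeasure P X (Gn n)) atTop
      (𝓝 (∫⁻ z, F z ∂pairMeasure P X G)) := by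
  rw [lintegral_pairMeasure' hX hF measurable_const] at hfin
  simp_rw [fun n => lintegral_pairMeasure' (P := P) hX hF (hGn n), lintegral_pairMeasure' hX hF hG]
  have hle : ∀ (G' : Plane × Plane → Plane → ℝ≥0∞) (p : ℕ × ℕ) (ω : Ω),
      pairTerm X F G' p ω ≤ pairTerm X F (fun _ _ => 1) p ω := by
    intro G' p ω
    unfold pairTerm
    split_ifs
    · exact le_rfl
    · gcongr
      have : (infProd fun k => if k = p.1 ∨ k = p.2 then (1 : ℝ≥0∞) else 1) = 1 := by
        simp [infProd]
      rw [this]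
      exact infProd_le_one _
  have hfinF : ∀ᵐ q ∂((Measure.count : Measure (ℕ × ℕ)).prod P),
      pairTerm X F (fun _ _ => 1) q.1 q.2 < ∞ :=
    ae_lt_top (measurable_from_prod_countable_right fun p =>
      measurable_pairTerm hX hF measurable_const p) hfin
  refine tendsto_lintegral_of_dominated_convergence
    (fun q => pairTerm X F (fun _ _ => 1) q.1 q.2)
    (fun n => measurable_from_prod_countable_right fun p => measurable_pairTerm hX hF (hGn n) p)
    (fun n => ae_of_all _ fun q => hle _ _ _) hfin ?_
  have h' : ∀ᵐ q ∂((Measure.count : Measure (ℕ × ℕ)).prod P), ∀ p : ℕ × ℕ, p.1 ≠ p.2 →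
      F (X p.1 q.2, X p.2 q.2) ≠ 0 →
      Tendsto (fun n => infProd fun k =>
          if k = p.1 ∨ k = p.2 then 1 else Gn n (X p.1 q.2, X p.2 q.2) (X k q.2)) atTop
        (𝓝 (infProd fun k =>
          if k = p.1 ∨ k = p.2 then 1 else G (X p.1 q.2, X p.2 q.2) (X k q.2))) :=
    Measure.quasiMeasurePreserving_snd.ae h
  filter_upwards [h', hfinF] with q hq hq'
  unfold pairTerm at hq' ⊢
  split_ifs at hq' ⊢ with h1
  · exact tendsto_const_nhds
  · by_cases h2 : F (X q.1.1 q.2, X q.1.2 q.2) = 0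
    · simp [h2]
    · have hF' : F (X q.1.1 q.2, X q.1.2 q.2) ≠ ∞ := by
        intro h3
        simp [h3, infProd] at hq'
      exact ENNReal.Tendsto.const_mul (hq q.1 h1 h2) (Or.inr hF')

end

namespace IsPoissonProcess

variable {P : Measure Ω} [IsProbabilityMeasure P] {lam : ℝ} {X : ℕ → Ω → Plane}

/-- Each point is coloured by its membership in `A`, its membership in `B` and its value of `ψ`,
with background colour `((0, 0), 0)`. -/
lemma pairMeasure_rectangle_simple (hX : IsPoissonProcess P lam X) (hlam : 0 ≤ lam)
    (ψ : SimpleFunc Plane ℝ≥0∞) (hψ : ∀ b, b ≠ 0 → volume (ψ ⁻¹' {b}) ≠ ∞)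
    {A B : Set Plane} (hA : MeasurableSet A) (hB : MeasurableSet B) (hA' : volume A ≠ ∞)
    (hB' : volume B ≠ ∞) :
    pairMeasure P X (fun _ z => 1 - ψ z) (A ×ˢ B) =
      ENNReal.ofReal lam ^ 2 * (volume A * volume B) * genFun lam fun z => 1 - ψ z := by
  let σA : SimpleFunc Plane ℝ≥0∞ := (SimpleFunc.const _ 1).piecewise A hA (SimpleFunc.const _ 0)
  let σB : SimpleFunc Plane ℝ≥0∞ := (SimpleFunc.const _ 1).piecewise B hB (SimpleFunc.const _ 0)
  let σ := (σA.pair σB).pair ψ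
  have hσA : ∀ z, σA z = A.indicator 1 z := fun z => by
    simp only [σA, SimpleFunc.piecewise_apply]; rfl
  have hσB : ∀ z, σB z = B.indicator 1 z := fun z => by
    simp only [σB, SimpleFunc.piecewise_apply]; rfl
  have hσ : ∀ z, σ z = ((A.indicator 1 z, B.indicator 1 z), ψ z) := fun z => by
    rw [← hσA, ← hσB]; rfl
  have key := hX.lintegral_pair_simple hlam σ ((0, 0), 0) (fun b hb => ?_)
    (fun b => (1 - b.2).toNNReal)
    (fun b => by simpa using ENNReal.toNNReal_mono ENNReal.one_ne_top (tsub_le_self (a := 1) (b := b.2)))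
    (by simp) (fun b => b.1.1) (fun b => b.1.2) rfl rfl
  · have h1 : ∀ z, 1 - ψ z ≠ ∞ := fun z => (tsub_le_self.trans_lt ENNReal.one_lt_top).ne
    simp only [hσ, ENNReal.coe_toNNReal (h1 _), lintegral_indicator_one hA,
      lintegral_indicator_one hB] at key
    have hG : Measurable (Function.uncurry fun (_ : Plane × Plane) z => 1 - ψ z) :=
      measurable_const.sub (ψ.measurable.comp measurable_snd)
    rw [← key, ← lintegral_indicator_one (hA.prod hB), lintegral_pairMeasure hX.measurable
      (measurable_one.indicator (hA.prod hB)) hG, ← lintegral_tsum]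
    · refine lintegral_congr fun ω => tsum_congr fun p => ?_
      unfold pairTerm
      have h2 : ∀ x y, (A ×ˢ B).indicator (1 : Plane × Plane → ℝ≥0∞) (x, y) =
          A.indicator 1 x * B.indicator 1 y := fun x y => by
        by_cases hx : x ∈ A <;> by_cases hy : y ∈ B <;> simp [hx, hy]
      rw [h2]
    · exact fun p => (measurable_pairTerm hX.measurable (measurable_one.indicator (hA.prod hB)) hG p).aemeasurable
  · by_cases hb2 : b.2 = 0
    · refine ne_top_of_le_ne_top (measure_union_lt_top hA'.lt_top hB'.lt_top).ne
        (measure_mono fun z hz => ?_)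
      by_contra h
      rw [mem_union, not_or] at h
      refine hb ?_
      rw [mem_preimage, mem_singleton_iff, hσ, indicator_of_notMem h.1,
        indicator_of_notMem h.2] at hz
      rw [← hz] at hb2 ⊢
      exact Prod.ext rfl hb2
    · refine ne_top_of_le_ne_top (hψ _ hb2) (measure_mono fun z hz => ?_)
      rw [mem_preimage, mem_singleton_iff, hσ] at hz
      rw [← hz]
      rfl

end IsPoissonProcess

end PairMeasure

lemma MeasureTheory.Measure.ext_of_measure_ne_top {α : Type*} [MeasurableSpace α]
    {ρ μ ν : Measure α} [SigmaFinite ρ]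
    (h : ∀ D, MeasurableSet D → ρ D ≠ ∞ → μ D = ν D) : μ = ν := by
  rw [← Measure.restrict_univ (μ := μ), ← Measure.restrict_univ (μ := ν), ← iUnion_spanningSets ρ,
    Measure.restrict_iUnion_congr]
  intro n
  ext D hD
  rw [Measure.restrict_apply hD, Measure.restrict_apply hD]
  exact h _ (hD.inter (measurableSet_spanningSets ρ n))
    (ne_top_of_le_ne_top (measure_spanningSets_lt_top ρ n).ne (measure_mono inter_subset_right))

namespace IsPoissonProcess

variable {Ω : Type*} [MeasurableSpace Ω] {P : Measure Ω} [IsProbabilityMeasure P] {lam : ℝ}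
  {X : ℕ → Ω → Plane}

lemma pairMeasure_rectangle_one (hX : IsPoissonProcess P lam X) (hlam : 0 ≤ lam)
    {A B : Set Plane} (hA : MeasurableSet A) (hB : MeasurableSet B) (hA' : volume A ≠ ∞)
    (hB' : volume B ≠ ∞) :
    pairMeasure P X (fun _ _ => 1) (A ×ˢ B) =
      ENNReal.ofReal lam ^ 2 * (volume A * volume B) := by
  have := hX.pairMeasure_rectangle_simple hlam 0 (fun b hb => by
    have : (⇑(0 : SimpleFunc Plane ℝ≥0∞) ⁻¹' {b}) = ∅ := by
      ext z; simpa using Ne.symm hb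
    rw [this, measure_empty]
    exact ENNReal.zero_ne_top) hA hB hA' hB'
  simpa [genFun] using this

lemma pairMeasure_rectangle (hX : IsPoissonProcess P lam X) (hlam : 0 ≤ lam)
    {g : Plane → ℝ≥0∞} (hg : Measurable g) (hg1 : ∀ z, g z ≤ 1) (hfin : ∫⁻ z, 1 - g z ≠ ∞)
    {A B : Set Plane} (hA : MeasurableSet A) (hB : MeasurableSet B) (hA' : volume A ≠ ∞)
    (hB' : volume B ≠ ∞) :
    pairMeasure P X (fun _ => g) (A ×ˢ B) =
      ENNReal.ofReal lam ^ 2 * (volume A * volume B) * genFun lam g := by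
  have hφ : Measurable fun z => 1 - g z := measurable_const.sub hg
  set ψ := SimpleFunc.eapprox fun z => 1 - g z
  have hψ1 : ∀ n z, ψ n z ≤ 1 - g z := fun n z => by
    rw [← SimpleFunc.iSup_eapprox_apply hφ z]
    exact le_iSup (fun n => ψ n z) n
  have hmono : ∀ z, Monotone fun n => ψ n z := fun z a b hab => SimpleFunc.monotone_eapprox _ hab z
  have hgn : ∀ z, ⨅ n, (1 - ψ n z) = g z := fun z => by
    rw [← ENNReal.sub_iSup ENNReal.one_ne_top, SimpleFunc.iSup_eapprox_apply hφ z,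
      ENNReal.sub_sub_cancel ENNReal.one_ne_top (hg1 z)]
  have hanti : ∀ z, Antitone fun n => 1 - ψ n z := fun z a b hab => tsub_le_tsub_left (hmono z hab) _
  have hstep : ∀ n, pairMeasure P X (fun _ z => 1 - ψ n z) (A ×ˢ B) =
      ENNReal.ofReal lam ^ 2 * (volume A * volume B) * genFun lam fun z => 1 - ψ n z := fun n => by
    have hlt : (ψ n).lintegral volume ≠ ∞ := by
      rw [← SimpleFunc.lintegral_eq_lintegral]
      exact ((lintegral_mono (hψ1 n)).trans_lt hfin.lt_top).ne
    exact hX.pairMeasure_rectangle_simple hlam (ψ n) (fun b hb => (SimpleFunc.finMeasSupp_iff.1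
      (SimpleFunc.FinMeasSupp.of_lintegral_ne_top hlt) b hb).ne) hA hB hA' hB'
  have hAB : Measurable ((A ×ˢ B).indicator (1 : Plane × Plane → ℝ≥0∞)) :=
    measurable_one.indicator (hA.prod hB)
  have hL := tendsto_lintegral_pairMeasure (P := P) (X := X) hX.measurable hAB
    (Gn := fun n _ z => 1 - ψ n z) (G := fun _ => g)
    (by rw [lintegral_indicator_one (hA.prod hB), hX.pairMeasure_rectangle_one hlam hA hB hA' hB']
        finiteness)
    (fun n => measurable_const.sub ((ψ n).measurable.comp measurable_snd)) (hg.comp measurable_snd)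
    (ae_of_all _ fun ω p _ _ => by
      refine tendsto_infProd_of_antitone (fun n k => ?_) (fun k => ?_) fun k => ?_
      · split_ifs
        · exact le_rfl
        · exact tsub_le_self
      · split_ifs
        · exact antitone_const
        · exact hanti _
      · split_ifs
        · exact iInf_const
        · exact hgn _)
  simp_rw [lintegral_indicator_one (hA.prod hB), hstep] at hL
  refine tendsto_nhds_unique hL (ENNReal.Tendsto.const_mul (tendsto_genFun hfin ?_)
    (Or.inr (by finiteness)))
  have h1 : ∀ n z, 1 - (1 - ψ n z) = ψ n z := fun n z =>
    ENNReal.sub_sub_cancel ENNReal.one_ne_top ((hψ1 n z).trans tsub_le_self)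
  simp_rw [h1]
  exact lintegral_tendsto_of_tendsto_of_monotone (fun n => (ψ n).measurable.aemeasurable)
    (ae_of_all _ hmono) (ae_of_all _ fun z => SimpleFunc.tendsto_eapprox hφ z)

/-- On a square of finite measure both sides are finite and agree on rectangles, hence coincide;
such squares exhaust the plane squared. -/
lemma pairMeasure_const (hX : IsPoissonProcess P lam X) (hlam : 0 ≤ lam)
    {g : Plane → ℝ≥0∞} (hg : Measurable g) (hg1 : ∀ z, g z ≤ 1) (hfin : ∫⁻ z, 1 - g z ≠ ∞) :
    pairMeasure P X (fun _ => g) = (ENNReal.ofReal lam ^ 2 * genFun lam g) • volume := by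
  have hgen : genFun lam g ≠ ∞ := ENNReal.ofReal_ne_top
  let K : ℕ → Set (Plane × Plane) := fun n =>
    spanningSets (volume : Measure Plane) n ×ˢ spanningSets (volume : Measure Plane) n
  have hK : ⋃ n, K n = univ := by
    refine eq_univ_of_forall fun z => mem_iUnion.2 ?_
    have h1 := mem_spanningSetsIndex (volume : Measure Plane) z.1
    have h2 := mem_spanningSetsIndex (volume : Measure Plane) z.2
    refine ⟨max _ _, monotone_spanningSets _ (le_max_left _ _) h1,
      monotone_spanningSets _ (le_max_right _ _) h2⟩
  rw [← Measure.restrict_univ (μ := pairMeasure P X _), ← Measure.restrict_univ (μ := _ • volume),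
    ← hK, Measure.restrict_iUnion_congr]
  intro n
  set B := spanningSets (volume : Measure Plane) n
  have hB : MeasurableSet B := measurableSet_spanningSets _ _
  have hB' : volume B ≠ ∞ := (measure_spanningSets_lt_top _ _).ne
  have : IsFiniteMeasure ((pairMeasure P X fun _ => g).restrict (B ×ˢ B)) := ⟨by
    rw [Measure.restrict_apply_univ, hX.pairMeasure_rectangle hlam hg hg1 hfin hB hB hB' hB']
    finiteness⟩
  refine Measure.ext_prod fun {s t} hs ht => ?_
  rw [Measure.restrict_apply (hs.prod ht), Measure.restrict_apply (hs.prod ht), prod_inter_prod,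
    hX.pairMeasure_rectangle hlam hg hg1 hfin (hs.inter hB) (ht.inter hB)
      (ne_top_of_le_ne_top hB' (measure_mono inter_subset_right))
      (ne_top_of_le_ne_top hB' (measure_mono inter_subset_right)), Measure.smul_apply,
    Measure.volume_eq_prod, Measure.prod_prod, smul_eq_mul]
  ring

lemma pairMeasure_one (hX : IsPoissonProcess P lam X) (hlam : 0 ≤ lam) :
    pairMeasure P X (fun _ _ => 1) = (ENNReal.ofReal lam ^ 2) • volume := by
  have := hX.pairMeasure_const hlam (g := fun _ => 1) measurable_const (fun _ => le_rfl) (by simp)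
  simpa [genFun] using this

lemma volume_norm_eq_norm : volume {z : Plane × Plane | ‖z.1‖ = ‖z.2‖} = 0 := by
  have hD : MeasurableSet {z : Plane × Plane | ‖z.1‖ = ‖z.2‖} :=
    measurableSet_eq_fun (by fun_prop) (by fun_prop)
  rw [Measure.volume_eq_prod, Measure.measure_prod_null hD]
  refine ae_of_all _ fun x => ?_
  have : Prod.mk x ⁻¹' {z : Plane × Plane | ‖z.1‖ = ‖z.2‖} = Metric.sphere (0 : Plane) ‖x‖ := by
    ext z
    simp [eq_comm]
  exact (congrArg volume this).trans (Measure.addHaar_sphere _ _ _)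

/-- The pair measure without extra factors is a multiple of Lebesgue measure, for which pairs of
equal norm are negligible because spheres are null. In particular the points are almost surely
distinct. -/
lemma ae_norm_ne (hX : IsPoissonProcess P lam X) (hlam : 0 ≤ lam) :
    ∀ᵐ ω ∂P, ∀ i j, i ≠ j → ‖X i ω‖ ≠ ‖X j ω‖ := by
  set D : Set (Plane × Plane) := {z | ‖z.1‖ = ‖z.2‖}
  have hD : MeasurableSet D := measurableSet_eq_fun (by fun_prop) (by fun_prop)
  have hD0 : volume D = 0 := volume_norm_eq_norm
  have h1 : ∫⁻ z, D.indicator 1 z ∂pairMeasure P X (fun _ _ => 1) = 0 := by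
    rw [lintegral_indicator_one hD, hX.pairMeasure_one hlam]
    simp [hD0]
  rw [lintegral_pairMeasure hX.measurable (measurable_one.indicator hD) measurable_const,
    ENNReal.tsum_eq_zero] at h1
  have h2 : ∀ p : ℕ × ℕ, ∀ᵐ ω ∂P, p.1 ≠ p.2 → ‖X p.1 ω‖ ≠ ‖X p.2 ω‖ := by
    intro p
    have := (lintegral_eq_zero_iff (measurable_pairTerm hX.measurable
      (measurable_one.indicator hD) measurable_const p)).1 (h1 p)
    filter_upwards [this] with ω hω hp h3
    have h4 : (X p.1 ω, X p.2 ω) ∈ D := h3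
    simp [pairTerm, hp, h4, infProd] at hω
  filter_upwards [ae_all_iff.2 h2] with ω hω i j hij using hω (i, j) hij

end IsPoissonProcess

lemma measurable_genFun (lam : ℝ) {α : Type*} [MeasurableSpace α] {G : α → Plane → ℝ≥0∞}
    (hG : Measurable (Function.uncurry G)) : Measurable fun z => genFun lam (G z) := by
  unfold genFun
  have : Measurable fun z => ∫⁻ w, 1 - G z w :=
    Measurable.lintegral_prod_right' (f := fun q : α × Plane => 1 - G q.1 q.2)
      (measurable_const.sub hG)
  fun_prop

namespace IsPoissonProcess

variable {Ω : Type*} [MeasurableSpace Ω] {P : Measure Ω} [IsProbabilityMeasure P] {lam : ℝ}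
  {X : ℕ → Ω → Plane}

/-- On each fibre of `d` the factor no longer depends on the pair, so `pairMeasure_const` applies
fibre by fibre. -/
lemma pairMeasure_comp_simpleFunc (hX : IsPoissonProcess P lam X) (hlam : 0 ≤ lam)
    {G : Plane × Plane → Plane → ℝ≥0∞} (hG : Measurable (Function.uncurry G))
    (hG1 : ∀ z w, G z w ≤ 1) (hfin : ∀ z, ∫⁻ w, 1 - G z w ≠ ∞)
    (d : SimpleFunc (Plane × Plane) (Plane × Plane)) :
    pairMeasure P X (fun z => G (d z)) =
      volume.withDensity fun z => ENNReal.ofReal lam ^ 2 * genFun lam (G (d z)) := by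
  have hK : ⋃ q : d.range, d ⁻¹' {q.1} = univ := by
    refine eq_univ_of_forall fun z => mem_iUnion.2 ⟨⟨d z, d.mem_range_self z⟩, rfl⟩
  rw [← Measure.restrict_univ (μ := pairMeasure P X _),
    ← Measure.restrict_univ (μ := volume.withDensity _), ← hK, Measure.restrict_iUnion_congr]
  rintro ⟨q, hq⟩
  have hm : MeasurableSet (d ⁻¹' {q}) := d.measurableSet_fiber q
  have hGq : Measurable (G q) := hG.comp (measurable_const.prodMk measurable_id)
  have hGd : Measurable (Function.uncurry fun z => G (d z)) :=
    hG.comp ((d.measurable.comp measurable_fst).prodMk measurable_snd)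
  have h1 : (pairMeasure P X fun z => G (d z)).restrict (d ⁻¹' {q}) =
      (pairMeasure P X fun _ => G q).restrict (d ⁻¹' {q}) := by
    ext D hD
    rw [Measure.restrict_apply hD, Measure.restrict_apply hD, ← lintegral_indicator_one (hD.inter hm),
      ← lintegral_indicator_one (hD.inter hm),
      lintegral_pairMeasure hX.measurable (measurable_one.indicator (hD.inter hm)) hGd,
      lintegral_pairMeasure (G := fun _ => G q) hX.measurable
        (measurable_one.indicator (hD.inter hm)) (hGq.comp measurable_snd)]
    refine tsum_congr fun p => lintegral_congr fun ω => ?_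
    unfold pairTerm
    by_cases h : (X p.1 ω, X p.2 ω) ∈ D ∩ d ⁻¹' {q}
    · have : d (X p.1 ω, X p.2 ω) = q := h.2
      dsimp only
      rw [this]
    · rw [indicator_of_notMem h, zero_mul, zero_mul]
  rw [h1, hX.pairMeasure_const hlam hGq (hG1 q) (hfin q), restrict_withDensity hm,
    Measure.restrict_smul, ← withDensity_const]
  refine withDensity_congr_ae ?_
  filter_upwards [ae_restrict_mem hm] with z hz
  have : d z = q := hz
  rw [this]

/-- The pair in the factor is replaced by simple functions tending to it. Only the almost surely
finitely many points in the window `K` have factors different from `1`, so factorwise convergence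
suffices. -/
lemma pairMeasure_eq_of_window (hX : IsPoissonProcess P lam X) (hlam : 0 ≤ lam)
    {G : Plane × Plane → Plane → ℝ≥0∞} (hG : Measurable (Function.uncurry G))
    (hG1 : ∀ z w, G z w ≤ 1) {K : Set Plane} (hK : MeasurableSet K) (hK' : volume K ≠ ∞)
    (hGK : ∀ z, ∀ w ∉ K, G z w = 1)
    (hcont : ∀ z w, ‖w‖ ≠ ‖z.1‖ → ‖w‖ ≠ ‖z.2‖ → ContinuousAt (fun z' => G z' w) z) :
    pairMeasure P X G = volume.withDensity fun z => ENNReal.ofReal lam ^ 2 * genFun lam (G z) := by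
  have hbd : ∀ z w, 1 - G z w ≤ K.indicator 1 w := fun z w => by
    by_cases h : w ∈ K
    · simp [h]
    · simp [h, hGK z w h]
  have hKint : ∫⁻ w, K.indicator 1 w ≠ ∞ := by rwa [lintegral_indicator_one hK]
  have hfin : ∀ z, ∫⁻ w, 1 - G z w ≠ ∞ := fun z =>
    ne_top_of_le_ne_top hKint (lintegral_mono (hbd z))
  set d : ℕ → SimpleFunc (Plane × Plane) (Plane × Plane) :=
    (stronglyMeasurable_id (α := Plane × Plane)).approx
  have hd : ∀ z, Tendsto (fun n => d n z) atTop (𝓝 z) :=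
    (stronglyMeasurable_id (α := Plane × Plane)).tendsto_approx
  have hGd : ∀ n, Measurable (Function.uncurry fun z => G (d n z)) := fun n =>
    hG.comp (((d n).measurable.comp measurable_fst).prodMk measurable_snd)
  have hlim : ∀ z w, ‖w‖ ≠ ‖z.1‖ → ‖w‖ ≠ ‖z.2‖ →
      Tendsto (fun n => G (d n z) w) atTop (𝓝 (G z w)) := fun z w h1 h2 =>
    (hcont z w h1 h2).tendsto.comp (hd z)
  refine Measure.ext_of_measure_ne_top (ρ := volume) fun D hD hD' => ?_
  have hDm : Measurable (D.indicator (1 : Plane × Plane → ℝ≥0∞)) := measurable_one.indicator hD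
  have hL := tendsto_lintegral_pairMeasure (P := P) (X := X) hX.measurable hDm
    (Gn := fun n z => G (d n z)) (G := G)
    (by rw [lintegral_indicator_one hD, hX.pairMeasure_one hlam, Measure.smul_apply, smul_eq_mul]
        finiteness)
    hGd hG (by
      -- Almost surely no other point shares its norm with a point of the pair, so the exceptional
      -- norms in `hcont` never occur.
      filter_upwards [hX.ae_norm_ne hlam, hX.ae_finite hK hK'] with ω hω hfinω p hp _
      refine tendsto_infProd_of_finite (fun n k => ?_) hfinω.toFinset (fun n k hk => ?_) fun k => ?_
      · split_ifs
        exacts [le_rfl, hG1 _ _]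
      · split_ifs
        · rfl
        · exact hGK _ _ (by simpa using hk)
      · split_ifs with h
        · exact tendsto_const_nhds
        · rw [not_or] at h
          exact hlim _ _ (hω _ _ h.1) (hω _ _ h.2))
  simp_rw [lintegral_indicator_one hD,
    fun n => hX.pairMeasure_comp_simpleFunc hlam hG hG1 hfin (d n)] at hL
  refine tendsto_nhds_unique hL ?_
  simp_rw [withDensity_apply _ hD]
  refine tendsto_lintegral_of_dominated_convergence (fun _ => ENNReal.ofReal lam ^ 2)
    (fun n => measurable_const.mul (measurable_genFun lam (hGd n)))
    (fun n => ae_of_all _ fun z => mul_le_of_le_one_right' (genFun_le_one hlam _))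
    (by rw [setLIntegral_const]; finiteness) (ae_of_all _ fun z => ?_)
  refine ENNReal.Tendsto.const_mul (tendsto_genFun (hfin z) ?_) (Or.inr (by finiteness))
  refine tendsto_lintegral_of_dominated_convergence (K.indicator 1)
    (fun n => measurable_const.sub (hG.comp (measurable_const.prodMk measurable_id)))
    (fun n => ae_of_all _ fun w => hbd _ w) hKint ?_
  have hnull : ∀ r : ℝ, ∀ᵐ w : Plane, ‖w‖ ≠ r := fun r => by
    have : volume (Metric.sphere (0 : Plane) r) = 0 := Measure.addHaar_sphere _ _ _
    rw [ae_iff]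
    convert this using 2
    ext w
    simp
  filter_upwards [hnull ‖z.1‖, hnull ‖z.2‖] with w h1 h2
  exact ENNReal.Tendsto.sub tendsto_const_nhds (hlim z w h1 h2) (Or.inl ENNReal.one_ne_top)

/-- The second-order Mecke formula for products over the points of a Poisson process. -/
theorem pairMeasure_eq (hX : IsPoissonProcess P lam X) (hlam : 0 ≤ lam)
    {G : Plane × Plane → Plane → ℝ≥0∞} (hG : Measurable (Function.uncurry G))
    (hG1 : ∀ z w, G z w ≤ 1) (hfin : ∀ z, ∫⁻ w, 1 - G z w ≠ ∞)
    (hcont : ∀ z w, ‖w‖ ≠ ‖z.1‖ → ‖w‖ ≠ ‖z.2‖ → ContinuousAt (fun z' => G z' w) z) :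
    pairMeasure P X G = volume.withDensity fun z => ENNReal.ofReal lam ^ 2 * genFun lam (G z) := by
  classical
  -- Only the points in a growing ball are made to count. The truncated factors decrease to the
  -- original ones, so the products converge without any finiteness.
  set K : ℕ → Set Plane := fun n => Metric.closedBall 0 n
  have hK : ∀ n, MeasurableSet (K n) := fun n => Metric.isClosed_closedBall.measurableSet
  have hKmono : Monotone K := fun a b hab => Metric.closedBall_subset_closedBall (by exact_mod_cast hab)
  have hKmem : ∀ w, ∀ᶠ n in atTop, w ∈ K n := fun w => by
    obtain ⟨n, hn⟩ := exists_nat_ge ‖w‖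
    filter_upwards [eventually_ge_atTop n] with m hm
    exact hKmono hm (by simpa [K] using hn)
  set Gn : ℕ → Plane × Plane → Plane → ℝ≥0∞ := fun n z w => if w ∈ K n then G z w else 1
  have hGn : ∀ n, Measurable (Function.uncurry (Gn n)) := fun n =>
    Measurable.ite (measurable_snd (hK n)) hG measurable_const
  have hGn1 : ∀ n z w, Gn n z w ≤ 1 := fun n z w => by
    simp only [Gn]
    split_ifs
    exacts [hG1 z w, le_rfl]
  have hanti : ∀ z w, Antitone fun n => Gn n z w := fun z w a b hab => by
    simp only [Gn]
    by_cases ha : w ∈ K a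
    · rw [if_pos ha, if_pos (hKmono hab ha)]
    · rw [if_neg ha]
      exact hGn1 b z w
  have hlim : ∀ z w, Tendsto (fun n => Gn n z w) atTop (𝓝 (G z w)) := fun z w => by
    refine tendsto_const_nhds.congr' ?_
    filter_upwards [hKmem w] with n hn
    exact (if_pos hn).symm
  have hinf : ∀ z w, ⨅ n, Gn n z w = G z w := fun z w =>
    tendsto_nhds_unique (tendsto_atTop_iInf (hanti z w)) (hlim z w)
  have hstep : ∀ n, pairMeasure P X (Gn n) =
      volume.withDensity fun z => ENNReal.ofReal lam ^ 2 * genFun lam (Gn n z) := fun n =>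
    hX.pairMeasure_eq_of_window hlam (hGn n) (hGn1 n) (hK n) measure_closedBall_lt_top.ne
      (fun z w hw => if_neg hw) fun z w h1 h2 => by
        by_cases hw : w ∈ K n
        · simpa only [Gn, if_pos hw] using hcont z w h1 h2
        · simpa only [Gn, if_neg hw] using continuousAt_const
  refine Measure.ext_of_measure_ne_top (ρ := volume) fun D hD hD' => ?_
  have hL := tendsto_lintegral_pairMeasure (P := P) (X := X) hX.measurable
    (measurable_one.indicator hD) (Gn := Gn) (G := G)
    (by rw [lintegral_indicator_one hD, hX.pairMeasure_one hlam, Measure.smul_apply, smul_eq_mul]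
        finiteness)
    hGn hG (ae_of_all _ fun ω p _ _ => by
      refine tendsto_infProd_of_antitone (fun n k => ?_) (fun k => ?_) fun k => ?_
      · split_ifs
        exacts [le_rfl, hGn1 _ _ _]
      · split_ifs
        exacts [antitone_const, hanti _ _]
      · split_ifs
        exacts [iInf_const, hinf _ _])
  simp_rw [lintegral_indicator_one hD, hstep] at hL
  refine tendsto_nhds_unique hL ?_
  simp_rw [withDensity_apply _ hD]
  refine tendsto_lintegral_of_dominated_convergence (fun _ => ENNReal.ofReal lam ^ 2)
    (fun n => measurable_const.mul (measurable_genFun lam (hGn n)))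
    (fun n => ae_of_all _ fun z => mul_le_of_le_one_right' (genFun_le_one hlam _))
    (by rw [setLIntegral_const]; finiteness) (ae_of_all _ fun z => ?_)
  refine ENNReal.Tendsto.const_mul (tendsto_genFun (hfin z) ?_) (Or.inr (by finiteness))
  refine lintegral_tendsto_of_tendsto_of_monotone (fun n => (measurable_const.sub
      ((hGn n).comp (measurable_const.prodMk measurable_id))).aemeasurable)
    (ae_of_all _ fun w a b hab => tsub_le_tsub_left (hanti z w hab) _) (ae_of_all _ fun w => ?_)
  exact ENNReal.Tendsto.sub tendsto_const_nhds (hlim z w) (Or.inl ENNReal.one_ne_top)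

end IsPoissonProcess

/-! ### Conditioning on and grouping of independent variables. -/

namespace ProbabilityTheory

variable {Ω : Type*} [MeasurableSpace Ω] {P : Measure Ω} [IsProbabilityMeasure P]

lemma IndepFun.lintegral_prodMk {α β : Type*} [MeasurableSpace α] [MeasurableSpace β]
    {X : Ω → α} {Y : Ω → β} (h : IndepFun X Y P) (hX : Measurable X) (hY : Measurable Y)
    {f : α × β → ℝ≥0∞} (hf : Measurable f) :
    ∫⁻ ω, f (X ω, Y ω) ∂P = ∫⁻ ω, ∫⁻ ω', f (X ω, Y ω') ∂P ∂P := by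
  have := Measure.isProbabilityMeasure_map (μ := P) hY.aemeasurable
  rw [← lintegral_map hf (hX.prodMk hY),
    (indepFun_iff_map_prod_eq_prod_map_map hX.aemeasurable hY.aemeasurable).1 h,
    lintegral_prod _ hf.aemeasurable, lintegral_map hf.lintegral_prod_right' hX]
  refine lintegral_congr fun ω => ?_
  exact lintegral_map (f := fun y => f (X ω, y)) (hf.comp (measurable_const.prodMk measurable_id)) hY

lemma IndepFun.measure_prodMk {α β : Type*} [MeasurableSpace α] [MeasurableSpace β]
    {X : Ω → α} {Y : Ω → β} (h : IndepFun X Y P) (hX : Measurable X) (hY : Measurable Y)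
    {D : Set (α × β)} (hD : MeasurableSet D) :
    P {ω | (X ω, Y ω) ∈ D} = ∫⁻ ω, P {ω' | (X ω, Y ω') ∈ D} ∂P := by
  have h1 := h.lintegral_prodMk hX hY (measurable_one.indicator hD)
  have h2 : ∀ ω, ∫⁻ ω', D.indicator 1 (X ω, Y ω') ∂P = P {ω' | (X ω, Y ω') ∈ D} := fun ω =>
    lintegral_indicator_one (s := {ω' | (X ω, Y ω') ∈ D}) ((measurable_const.prodMk hY) hD)
  simp_rw [h2] at h1
  rw [← h1]
  exact (lintegral_indicator_one (s := {ω | (X ω, Y ω) ∈ D}) ((hX.prodMk hY) hD)).symm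

/-- The joint law is an infinite product measure, and currying along the fibres of `π` writes it as
a product of products. -/
lemma iIndepFun.fibers {I B : Type*} {Z : I → Ω → ℝ} (hZ : iIndepFun Z P)
    (hm : ∀ a, Measurable (Z a)) (π : I → B) :
    iIndepFun (fun b ω (a : {a // π a = b}) => Z a ω) P := by
  have : ∀ a, IsProbabilityMeasure (P.map (Z a)) := fun a =>
    Measure.isProbabilityMeasure_map (hm a).aemeasurable
  have hs := hZ.precomp (Equiv.sigmaFiberEquiv π).injective
  have hb : ∀ b, P.map (fun ω (a : {a // π a = b}) => Z a ω) =
      Measure.infinitePi fun a : {a // π a = b} => P.map (Z a) := fun b =>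
    (iIndepFun_iff_map_fun_eq_infinitePi_map fun a : {a // π a = b} => hm a.1).1
      (hZ.precomp Subtype.val_injective)
  rw [iIndepFun_iff_map_fun_eq_infinitePi_map
    (X := fun b ω (a : {a // π a = b}) => Z a ω) (fun b => measurable_pi_lambda _ fun a => hm a.1)]
  simp_rw [hb]
  rw [← Measure.infinitePi_map_piCurry (X := fun (b : B) (_ : {a // π a = b}) => ℝ)
    (fun b a => P.map (Z a.1))]
  have h3 := (iIndepFun_iff_map_fun_eq_infinitePi_map fun a => hm _).1 hs
  have h4 : Measure.infinitePi (fun p : (b : B) × {a // π a = b} => P.map (Z p.2.1)) =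
      P.map (fun ω (p : (b : B) × {a // π a = b}) => Z p.2.1 ω) := h3.symm
  rw [h4, Measure.map_map (by fun_prop) (measurable_pi_lambda _ fun a => hm _)]
  rfl

/-- Given the value of `V b₀`, the conditions concern different independent variables and their
probabilities multiply. In the application `V b₀` is the pair of timers. -/
lemma iIndepFun.measure_forall_mem {B β : Type*} [MeasurableSpace β] {V : B → Ω → β}
    (hV : iIndepFun V P) (hm : ∀ b, Measurable (V b)) {b₀ : B} {S : Finset B} (hb : b₀ ∉ S)
    {D : B → Set (β × β)} (hD : ∀ b, MeasurableSet (D b)) :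
    P {ω | ∀ b ∈ S, (V b₀ ω, V b ω) ∈ D b} =
      ∫⁻ ω, ∏ b ∈ S, P {ω' | (V b₀ ω, V b ω') ∈ D b} ∂P := by
  have hind : IndepFun (V b₀) (fun ω (b : S) => V b ω) P := by
    have := hV.indepFun_finset {b₀} S (by simpa using hb) hm
    exact this.comp (φ := fun f : (({b₀} : Finset B) → β) => f ⟨b₀, by simp⟩) (ψ := id)
      (measurable_pi_apply _) measurable_id
  have hmS : Measurable fun ω (b : S) => V b ω := measurable_pi_lambda _ fun b => hm b
  have hD' : MeasurableSet {q : β × (S → β) | ∀ b : S, (q.1, q.2 b) ∈ D b} := by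
    rw [ofPred_forall]
    exact .iInter fun b => (measurable_fst.prodMk ((measurable_pi_apply b).comp measurable_snd)) (hD b)
  have h1 := hind.measure_prodMk (hm b₀) hmS hD'
  simp only [mem_ofPred_eq, Subtype.forall] at h1
  rw [h1]
  refine lintegral_congr fun ω => ?_
  have h2 := (hV.precomp (Subtype.val_injective (p := (· ∈ S)))).meas_iInter
    (s := fun b : S => {ω' | (V b₀ ω, V b ω') ∈ D b})
    fun b => ⟨Prod.mk (V b₀ ω) ⁻¹' D b, measurable_prodMk_left (hD b), rfl⟩
  rw [← Finset.prod_coe_sort, ← h2]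
  congr 1
  ext ω'
  simp

lemma iIndepFun.map_triple {I : Type*} {Z : I → Ω → ℝ} (hZ : iIndepFun Z P)
    (hm : ∀ a, Measurable (Z a)) {a b d : I} (hab : a ≠ b) (had : a ≠ d) (hbd : b ≠ d) :
    P.map (fun ω => (Z a ω, Z b ω, Z d ω)) =
      (P.map (Z a)).prod ((P.map (Z b)).prod (P.map (Z d))) := by
  rw [← (indepFun_iff_map_prod_eq_prod_map_map (hm b).aemeasurable (hm d).aemeasurable).1
      (hZ.indepFun hbd), ← (indepFun_iff_map_prod_eq_prod_map_map (hm a).aemeasurable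
      ((hm b).prodMk (hm d)).aemeasurable).1]
  exact (hZ.indepFun_prodMk hm b d a hab.symm had.symm).symm

end ProbabilityTheory

/-! ### Blocking by a single node. -/

namespace LBTParams

variable (c : LBTParams)

/-- The probability that the power received over the displacement `v`, divided by the transmit
power, exceeds `θ`. -/
def exceedProb (θ : ℝ) (v : Plane) : ℝ :=
  if v = 0 then 0 else Real.exp (-c.μ * θ * c.pathLoss ‖v‖)

/-- `exceedProb` if the receiver is listening, as told by `κ`, and `0` otherwise. -/
def exceedProb' (κ : Bool) (θ : ℝ) (v : Plane) : ℝ := if κ then c.exceedProb θ v else 0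

/-- The probability that a node at displacements `v` and `v'` from two receivers with timers `t`
and `s` blocks neither of them; the second one counts only if `κ` is true. -/
def passProb (κ : Bool) (θ t s : ℝ) (v v' : Plane) : ℝ :=
  1 - (t * c.exceedProb θ v + s * c.exceedProb' κ θ v' -
    min t s * (c.exceedProb θ v * c.exceedProb' κ θ v'))

lemma pathLoss_nonneg {d : ℝ} (hd : 0 ≤ d) : 0 ≤ c.pathLoss d := by
  unfold pathLoss
  positivity

lemma pathLoss_pos {d : ℝ} (hd : 0 < d) : 0 < c.pathLoss d := by
  have := c.wavelength_pos
  unfold pathLoss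
  positivity

lemma exceedProb_nonneg (θ : ℝ) (v : Plane) : 0 ≤ c.exceedProb θ v := by
  unfold exceedProb
  split_ifs
  exacts [le_rfl, (Real.exp_pos _).le]

lemma exceedProb_le_one {θ : ℝ} (hθ : 0 ≤ θ) (v : Plane) : c.exceedProb θ v ≤ 1 := by
  unfold exceedProb
  split_ifs
  · exact zero_le_one
  · rw [Real.exp_le_one_iff]
    have := c.pathLoss_nonneg (norm_nonneg v)
    have := c.μ_pos
    rw [neg_mul, neg_mul, neg_nonpos]
    positivity

lemma exceedProb'_nonneg (κ : Bool) (θ : ℝ) (v : Plane) : 0 ≤ c.exceedProb' κ θ v := by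
  unfold exceedProb'
  split_ifs
  exacts [c.exceedProb_nonneg θ v, le_rfl]

lemma exceedProb'_le_one (κ : Bool) {θ : ℝ} (hθ : 0 ≤ θ) (v : Plane) :
    c.exceedProb' κ θ v ≤ 1 := by
  unfold exceedProb'
  split_ifs
  exacts [c.exceedProb_le_one hθ v, zero_le_one]

lemma measurable_exceedProb (θ : ℝ) : Measurable (c.exceedProb θ) := by
  unfold exceedProb pathLoss
  exact Measurable.ite (measurableSet_singleton _) measurable_const (by fun_prop)

lemma measurable_exceedProb' (κ : Bool) (θ : ℝ) : Measurable (c.exceedProb' κ θ) := by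
  unfold exceedProb'
  split_ifs
  exacts [c.measurable_exceedProb θ, measurable_const]

lemma expMeasure_div_pathLoss_le {θ : ℝ} (hθ : 0 ≤ θ) (v : Plane) :
    expMeasure c.μ {f | f / c.pathLoss ‖v‖ ≤ θ} = ENNReal.ofReal (1 - c.exceedProb θ v) := by
  have := isProbabilityMeasure_expMeasure c.μ_pos
  unfold exceedProb
  split_ifs with hv
  -- At zero displacement the path loss is `0` and the quotient is `0` by the convention on
  -- division, so such a node never blocks. This is why `exceedProb` is `0` there and not the value
  -- `1` of the exponential.
  · have : {f : ℝ | f / c.pathLoss ‖v‖ ≤ θ} = univ := by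
      have h0 : c.pathLoss ‖v‖ = 0 := by simp [pathLoss, hv, Real.zero_rpow c.α_pos.ne']
      ext f
      simp [h0, hθ]
    rw [this]
    simp
  · have hl := c.pathLoss_pos (norm_pos_iff.2 hv)
    have : {f : ℝ | f / c.pathLoss ‖v‖ ≤ θ} = Iic (θ * c.pathLoss ‖v‖) := by
      ext f
      simp [div_le_iff₀ hl]
    rw [this, ← ofReal_cdf, cdf_expMeasure_eq c.μ_pos, if_pos (by positivity)]
    congr 3
    ring

/-- The uniform distribution on `[0,1]`. -/
abbrev unif : Measure ℝ := volume.restrict (Icc (0 : ℝ) 1)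

instance : IsProbabilityMeasure unif := ⟨by simp [unif]⟩

/-- Neither of two receivers with timers `t` and `s` is blocked by a node at displacements `v` and
`v'` with timer `u` and fading variables `f`, `f'`; the second receiver counts only if `κ`. -/
def Pass (κ : Bool) (θ : ℝ) (v v' : Plane) (τ r : ℝ × ℝ × ℝ) : Prop :=
  (τ.1 ≤ r.1 ∨ r.2.1 / c.pathLoss ‖v‖ ≤ θ) ∧
    (κ = true → τ.2.1 ≤ r.1 ∨ r.2.2 / c.pathLoss ‖v'‖ ≤ θ)

lemma measurableSet_pass (κ : Bool) (θ : ℝ) (v v' : Plane) :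
    MeasurableSet {q : (ℝ × ℝ × ℝ) × (ℝ × ℝ × ℝ) | c.Pass κ θ v v' q.1 q.2} := by
  have h1 := measurableSet_le (f := fun q : (ℝ × ℝ × ℝ) × (ℝ × ℝ × ℝ) => q.1.1)
    (g := fun q => q.2.1) (by fun_prop) (by fun_prop)
  have h2 := measurableSet_le (f := fun q : (ℝ × ℝ × ℝ) × (ℝ × ℝ × ℝ) => q.2.2.1 / c.pathLoss ‖v‖)
    (g := fun _ => θ) (by fun_prop) (by fun_prop)
  have h3 := measurableSet_le (f := fun q : (ℝ × ℝ × ℝ) × (ℝ × ℝ × ℝ) => q.1.2.1)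
    (g := fun q => q.2.1) (by fun_prop) (by fun_prop)
  have h4 := measurableSet_le (f := fun q : (ℝ × ℝ × ℝ) × (ℝ × ℝ × ℝ) => q.2.2.2 / c.pathLoss ‖v'‖)
    (g := fun _ => θ) (by fun_prop) (by fun_prop)
  cases κ
  · convert h1.union h2 using 1
    ext q
    simp [Pass]
  · convert (h1.union h2).inter (h3.union h4) using 1
    ext q
    simp [Pass]

lemma measurableSet_pass_right (κ : Bool) (θ : ℝ) (v v' : Plane) (τ : ℝ × ℝ × ℝ) :
    MeasurableSet {r | c.Pass κ θ v v' τ r} :=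
  measurable_prodMk_left (c.measurableSet_pass κ θ v v')

/-- For a given timer of the node, `p` and `q` say that it is too late to block the respective
receiver; the two fading variables are independent, so the probabilities multiply. -/
lemma expMeasure_prod_pass {θ : ℝ} (hθ : 0 ≤ θ) (κ : Bool) (v v' : Plane) (p q : Prop)
    [Decidable p] [Decidable q] :
    (expMeasure c.μ).prod (expMeasure c.μ) {r | (p ∨ r.1 / c.pathLoss ‖v‖ ≤ θ) ∧
      (κ = true → q ∨ r.2 / c.pathLoss ‖v'‖ ≤ θ)} =
    ENNReal.ofReal ((1 - if p then 0 else c.exceedProb θ v) *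
      (1 - if q then 0 else c.exceedProb' κ θ v')) := by
  have := isProbabilityMeasure_expMeasure c.μ_pos
  have h1 : {r : ℝ × ℝ | (p ∨ r.1 / c.pathLoss ‖v‖ ≤ θ) ∧
      (κ = true → q ∨ r.2 / c.pathLoss ‖v'‖ ≤ θ)} =
      {f : ℝ | p ∨ f / c.pathLoss ‖v‖ ≤ θ} ×ˢ {f : ℝ | κ = true → q ∨ f / c.pathLoss ‖v'‖ ≤ θ} := rfl
  rw [h1, Measure.prod_prod, ENNReal.ofReal_mul]
  · congr 1
    · by_cases hp : p
      · simp [hp]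
      · simp [hp, c.expMeasure_div_pathLoss_le hθ]
    · cases κ
      · simp [exceedProb']
      · by_cases hq : q
        · simp [hq]
        · simp [hq, c.expMeasure_div_pathLoss_le hθ, exceedProb']
  · split_ifs
    · simp
    · simpa using c.exceedProb_le_one hθ v

/-- Integration over the uniform timer `u` of the node. The product of the indicators of `u < t` and
`u < s` is that of `u < min t s`, which is where the minimum in `passProb` comes from. -/
lemma measure_pass {θ : ℝ} (hθ : 0 ≤ θ) (κ : Bool) (v v' : Plane) {τ : ℝ × ℝ × ℝ}
    (ht : τ.1 ∈ Icc (0 : ℝ) 1) (hs : τ.2.1 ∈ Icc (0 : ℝ) 1) :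
    unif.prod ((expMeasure c.μ).prod (expMeasure c.μ)) {r | c.Pass κ θ v v' τ r} =
      ENNReal.ofReal (c.passProb κ θ τ.1 τ.2.1 v v') := by
  have := isProbabilityMeasure_expMeasure c.μ_pos
  set p := c.exceedProb θ v
  set p' := c.exceedProb' κ θ v'
  have hp0 : p ≤ 1 := c.exceedProb_le_one hθ v
  have hp0' : p' ≤ 1 := c.exceedProb'_le_one κ hθ v'
  have hmeas : MeasurableSet {r | c.Pass κ θ v v' τ r} :=
    c.measurableSet_pass_right κ θ v v' τ
  rw [Measure.prod_apply hmeas]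
  have h1 : ∀ u : ℝ, (expMeasure c.μ).prod (expMeasure c.μ)
      (Prod.mk u ⁻¹' {r | c.Pass κ θ v v' τ r}) = ENNReal.ofReal
        (1 - p * (Iio τ.1).indicator 1 u - p' * (Iio τ.2.1).indicator 1 u +
          p * p' * (Iio (min τ.1 τ.2.1)).indicator 1 u) := by
    intro u
    refine (c.expMeasure_prod_pass hθ κ v v' (τ.1 ≤ u) (τ.2.1 ≤ u)).trans ?_
    congr 1
    rcases lt_or_ge u τ.1 with h2 | h2 <;> rcases lt_or_ge u τ.2.1 with h3 | h3
    · simp [h2, h3, not_le_of_gt h2, not_le_of_gt h3, p, p']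
      ring
    · simp [h2, h3, not_le_of_gt h2, not_lt_of_ge h3, p]
    · simp [h2, h3, not_lt_of_ge h2, not_le_of_gt h3, p']
    · simp [h2, h3, not_lt_of_ge h2, not_lt_of_ge h3]
  have hint : ∀ a : ℝ, Integrable ((Iio a).indicator (1 : ℝ → ℝ)) unif := fun a =>
    (integrable_const (1 : ℝ)).indicator measurableSet_Iio
  have hval : ∀ a ∈ Icc (0 : ℝ) 1, ∫ u, (Iio a).indicator (1 : ℝ → ℝ) u ∂unif = a := by
    intro a ha
    rw [integral_indicator_one measurableSet_Iio, measureReal_def,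
      Measure.restrict_apply measurableSet_Iio]
    have : Iio a ∩ Icc 0 1 = Ico 0 a := by
      ext x
      simp only [mem_inter_iff, mem_Iio, mem_Icc, mem_Ico]
      exact ⟨fun h => ⟨h.2.1, h.1⟩, fun h => ⟨h.2, h.1, (h.2.trans_le ha.2).le⟩⟩
    rw [this, Real.volume_Ico, sub_zero, ENNReal.toReal_ofReal ha.1]
  have hmin : min τ.1 τ.2.1 ∈ Icc (0 : ℝ) 1 := ⟨le_min ht.1 hs.1, (min_le_left _ _).trans ht.2⟩
  have hi1 : Integrable (fun u => 1 - p * (Iio τ.1).indicator 1 u) unif :=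
    (integrable_const _).sub ((hint _).const_mul _)
  have hi2 : Integrable (fun u => 1 - p * (Iio τ.1).indicator 1 u -
      p' * (Iio τ.2.1).indicator 1 u) unif := hi1.sub ((hint _).const_mul _)
  have hi3 : Integrable (fun u => 1 - p * (Iio τ.1).indicator 1 u -
      p' * (Iio τ.2.1).indicator 1 u + p * p' * (Iio (min τ.1 τ.2.1)).indicator 1 u) unif :=
    hi2.add ((hint _).const_mul _)
  simp_rw [h1]
  rw [← ofReal_integral_eq_lintegral_ofReal hi3]
  · congr 1
    rw [integral_add hi2 ((hint _).const_mul _), integral_sub hi1 ((hint _).const_mul _),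
      integral_sub (integrable_const _) ((hint _).const_mul _), integral_const_mul,
      integral_const_mul, integral_const_mul, hval _ ht, hval _ hs, hval _ hmin, passProb]
    simp only [integral_const, probReal_univ, smul_eq_mul, mul_one]
    ring
  · refine ae_of_all _ fun u => ?_
    have h2 : (1 - p * (Iio τ.1).indicator 1 u) * (1 - p' * (Iio τ.2.1).indicator 1 u) =
      1 - p * (Iio τ.1).indicator 1 u - p' * (Iio τ.2.1).indicator 1 u +
        p * p' * (Iio (min τ.1 τ.2.1)).indicator 1 u := by
      by_cases h2 : u < τ.1 <;> by_cases h3 : u < τ.2.1 <;> simp [h2, h3]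
      ring
    have h3 : 0 ≤ (1 - p * (Iio τ.1).indicator 1 u) * (1 - p' * (Iio τ.2.1).indicator 1 u) := by
      refine mul_nonneg ?_ ?_
      · by_cases h2 : u < τ.1 <;> simp [h2, hp0]
      · by_cases h2 : u < τ.2.1 <;> simp [h2, hp0']
    rw [h2] at h3
    exact h3

end LBTParams

namespace LBTParams

variable (c : LBTParams)

/-- The probability that, of two APs at `z.1` and `z.2` with timers `t` and `s`, the first is
closest to the origin and neither is blocked by the other; blocking of the second one counts only if
`κ` is true. -/
def pairProb (κ : Bool) (t s : ℝ) (z : Plane × Plane) : ℝ :=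
  if ‖z.1‖ ≤ ‖z.2‖ then (1 - if t ≤ s then 0 else c.exceedProb (c.Γcs / c.powW) (z.2 - z.1)) *
    (1 - if s ≤ t then 0 else c.exceedProb' κ (c.Γcs / c.powW) (z.1 - z.2)) else 0

/-- The probability that an AP at `w` is not closer to the origin than `z.1` and does not block the
APs at `z.1` and `z.2`. -/
def apProb (κ : Bool) (t s : ℝ) (z : Plane × Plane) (w : Plane) : ℝ :=
  if ‖z.1‖ ≤ ‖w‖ then c.passProb κ (c.Γcs / c.powW) t s (w - z.1) (w - z.2) else 0

/-- The probability that an eNB at `w` does not block the APs at `z.1` and `z.2`. -/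
def enbProb (κ : Bool) (t s : ℝ) (z : Plane × Plane) (w : Plane) : ℝ :=
  c.passProb κ (c.Γed / c.powL) t s (w - z.1) (w - z.2)

lemma passProb_le_one (κ : Bool) {θ t s : ℝ} (hθ : 0 ≤ θ) (ht : 0 ≤ t) (hs : 0 ≤ s)
    (v v' : Plane) : c.passProb κ θ t s v v' ≤ 1 := by
  have h1 := c.exceedProb_nonneg θ v
  have h2 := c.exceedProb'_nonneg κ θ v'
  have h3 := c.exceedProb'_le_one κ hθ v'
  have h4 : min t s * (c.exceedProb θ v * c.exceedProb' κ θ v') ≤ t * (c.exceedProb θ v * 1) := by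
    gcongr
    exact min_le_left _ _
  have h5 := mul_nonneg hs h2
  unfold passProb
  linarith

lemma apProb_le_one (κ : Bool) {t s : ℝ} (ht : 0 ≤ t) (hs : 0 ≤ s) (z : Plane × Plane)
    (w : Plane) : c.apProb κ t s z w ≤ 1 := by
  unfold apProb
  split_ifs
  · exact c.passProb_le_one κ (div_pos c.Γcs_pos c.powW_pos).le ht hs _ _
  · exact zero_le_one

lemma pairProb_nonneg (κ : Bool) (t s : ℝ) (z : Plane × Plane) : 0 ≤ c.pairProb κ t s z := by
  have hθ := (div_pos c.Γcs_pos c.powW_pos).le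
  unfold pairProb
  refine ite_nonneg (mul_nonneg (sub_nonneg.2 ?_) (sub_nonneg.2 ?_)) le_rfl
  · split_ifs
    exacts [zero_le_one, c.exceedProb_le_one hθ _]
  · split_ifs
    exacts [zero_le_one, c.exceedProb'_le_one κ hθ _]

lemma pairProb_le_one (κ : Bool) (t s : ℝ) (z : Plane × Plane) : c.pairProb κ t s z ≤ 1 := by
  have hθ := (div_pos c.Γcs_pos c.powW_pos).le
  have h1 : ∀ (p : Prop) [Decidable p] (a : ℝ), 0 ≤ a → a ≤ 1 →
      0 ≤ (1 - if p then 0 else a) ∧ (1 - if p then 0 else a) ≤ 1 := fun p _ a h0 h1 => by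
    split_ifs <;> constructor <;> linarith
  unfold pairProb
  by_cases h : ‖z.1‖ ≤ ‖z.2‖
  · rw [if_pos h]
    have h2 := h1 (t ≤ s) _ (c.exceedProb_nonneg _ (z.2 - z.1)) (c.exceedProb_le_one hθ _)
    have h3 := h1 (s ≤ t) _ (c.exceedProb'_nonneg κ _ (z.1 - z.2)) (c.exceedProb'_le_one κ hθ _)
    exact mul_le_one₀ h2.2 h3.1 h3.2
  · rw [if_neg h]
    exact zero_le_one

lemma enbProb_le_one (κ : Bool) {t s : ℝ} (ht : 0 ≤ t) (hs : 0 ≤ s) (z : Plane × Plane)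
    (w : Plane) : c.enbProb κ t s z w ≤ 1 :=
  c.passProb_le_one κ (div_pos c.Γed_pos c.powL_pos).le ht hs _ _

end LBTParams

/-! ### Blocks of marks, and transmission for fixed locations. -/

/-- The groups of marks relevant for the transmissions of two given APs: the two timers, the two
fading variables between them, and the marks of every other AP and of every eNB. -/
inductive MarkBlock (ι : Type) where
  | timers
  | pair
  | ap (k : ι)
  | enb (m : ℕ)

namespace LBTNetwork

variable {Ω : Type*} [MeasurableSpace Ω] {c : LBTParams} {P : Measure Ω} {ι : Type}

/-- All marks of the network. -/
def marks (net : LBTNetwork c P ι) : ι ⊕ ℕ ⊕ ι × ι ⊕ ℕ × ι → Ω → ℝ :=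
  Sum.elim net.timerW (Sum.elim net.timerL (Sum.elim net.fadeW net.fadeLW))

lemma measurable_marks (net : LBTNetwork c P ι) (a : ι ⊕ ℕ ⊕ ι × ι ⊕ ℕ × ι) :
    Measurable (net.marks a) := by
  rcases a with a | a | a | a
  exacts [net.measurable_timerW a, net.measurable_timerL a, net.measurable_fadeW a,
    net.measurable_fadeLW a]

open Classical in
/-- The marks of a block. -/
def blockMarks (net : LBTNetwork c P ι) (i j : ι) : MarkBlock ι → Ω → ℝ × ℝ × ℝ
  | .timers => fun ω => (net.timerW i ω, net.timerW j ω, 0)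
  | .pair => fun ω => (0, net.fadeW (j, i) ω, net.fadeW (i, j) ω)
  | .ap k => fun ω => if k = i ∨ k = j then 0 else
      (net.timerW k ω, net.fadeW (k, i) ω, net.fadeW (k, j) ω)
  | .enb m => fun ω => (net.timerL m ω, net.fadeLW (m, i) ω, net.fadeLW (m, j) ω)

lemma measurable_blockMarks (net : LBTNetwork c P ι) (i j : ι) (b : MarkBlock ι) :
    Measurable (net.blockMarks i j b) := by
  have h1 := net.measurable_timerW
  have h2 := net.measurable_timerL
  have h3 := net.measurable_fadeW
  have h4 := net.measurable_fadeLW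
  cases b with
  | timers => exact (h1 i).prodMk ((h1 j).prodMk measurable_const)
  | pair => exact measurable_const.prodMk ((h3 _).prodMk (h3 _))
  | ap k =>
    by_cases hk : k = i ∨ k = j
    · simp only [blockMarks, if_pos hk]
      exact measurable_const
    · simp only [blockMarks, if_neg hk]
      exact (h1 k).prodMk ((h3 _).prodMk (h3 _))
  | enb m => exact (h2 m).prodMk ((h4 _).prodMk (h4 _))

lemma iIndepFun_blockMarks [IsProbabilityMeasure P] (net : LBTNetwork c P ι) (i j : ι) :
    iIndepFun (net.blockMarks i j) P := by
  classical
  -- Every mark is assigned to exactly one block, all fading emitted by `i` or `j` going to `.pair`.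
  -- Each entry of `blockMarks` is a function of the marks in its block, the zeros being padding
  -- that gives all blocks the same type.
  let π : ι ⊕ ℕ ⊕ ι × ι ⊕ ℕ × ι → MarkBlock ι :=
    Sum.elim (fun k => if k = i ∨ k = j then .timers else .ap k) (Sum.elim .enb
      (Sum.elim (fun p => if p.1 = i ∨ p.1 = j then .pair else .ap p.1) fun p => .enb p.1))
  have key := net.indep_marks.fibers net.measurable_marks π
  have hφ : ∀ b, ∃ φ : ({a // π a = b} → ℝ) → ℝ × ℝ × ℝ, Measurable φ ∧
      net.blockMarks i j b = φ ∘ fun ω (a : {a // π a = b}) => net.marks a ω := by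
    intro b
    cases b with
    | timers =>
      refine ⟨fun r => (r ⟨.inl i, by simp [π]⟩, r ⟨.inl j, by simp [π]⟩, 0), by fun_prop, rfl⟩
    | pair =>
      refine ⟨fun r => (0, r ⟨.inr (.inr (.inl (j, i))), by simp [π]⟩,
        r ⟨.inr (.inr (.inl (i, j))), by simp [π]⟩), by fun_prop, rfl⟩
    | ap k =>
      by_cases hk : k = i ∨ k = j
      · refine ⟨fun _ => 0, measurable_const, ?_⟩
        funext ω
        exact if_pos hk
      · refine ⟨fun r => (r ⟨.inl k, by simp [π, hk]⟩, r ⟨.inr (.inr (.inl (k, i))), by simp [π, hk]⟩,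
          r ⟨.inr (.inr (.inl (k, j))), by simp [π, hk]⟩), by fun_prop, ?_⟩
        funext ω
        exact if_neg hk
    | enb m =>
      refine ⟨fun r => (r ⟨.inr (.inl m), by simp [π]⟩, r ⟨.inr (.inr (.inr (m, i))), by simp [π]⟩,
        r ⟨.inr (.inr (.inr (m, j))), by simp [π]⟩), by fun_prop, rfl⟩
  choose φ hφm hφ using hφ
  rw [funext hφ]
  exact key.comp φ hφm

lemma map_timers [IsProbabilityMeasure P] (net : LBTNetwork c P ι) {i j : ι} (hij : i ≠ j) :
    P.map (fun ω => (net.timerW i ω, net.timerW j ω)) = LBTParams.unif.prod LBTParams.unif := by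
  have := net.indep_marks.indepFun (i := .inl i) (j := .inl j) (by simpa using hij)
  rw [LBTParams.unif]
  nth_rw 1 [← net.timerW_law i]
  rw [← net.timerW_law j]
  exact (indepFun_iff_map_prod_eq_prod_map_map (net.measurable_timerW i).aemeasurable
    (net.measurable_timerW j).aemeasurable).1 this

lemma map_fades [IsProbabilityMeasure P] (net : LBTNetwork c P ι) {i j : ι} (hij : i ≠ j) :
    P.map (fun ω => (net.fadeW (j, i) ω, net.fadeW (i, j) ω)) =
      (expMeasure c.μ).prod (expMeasure c.μ) := by
  have := net.indep_marks.indepFun (i := .inr (.inr (.inl (j, i))))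
    (j := .inr (.inr (.inl (i, j)))) (by simp [hij])
  nth_rw 1 [← net.fadeW_law (j, i)]
  rw [← net.fadeW_law (i, j)]
  exact (indepFun_iff_map_prod_eq_prod_map_map (net.measurable_fadeW _).aemeasurable
    (net.measurable_fadeW _).aemeasurable).1 this

lemma map_blockMarks_ap [IsProbabilityMeasure P] (net : LBTNetwork c P ι) {i j k : ι} (hij : i ≠ j)
    (hk : ¬(k = i ∨ k = j)) :
    P.map (net.blockMarks i j (.ap k)) =
      LBTParams.unif.prod ((expMeasure c.μ).prod (expMeasure c.μ)) := by
  have := net.indep_marks.map_triple net.measurable_marks (a := .inl k)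
    (b := .inr (.inr (.inl (k, i)))) (d := .inr (.inr (.inl (k, j)))) (by simp) (by simp)
    (by simpa using hij)
  simp only [Sum.elim_inl, Sum.elim_inr, net.timerW_law, net.fadeW_law] at this
  rw [LBTParams.unif, ← this]
  congr 1
  funext ω
  exact if_neg hk

lemma map_blockMarks_enb [IsProbabilityMeasure P] (net : LBTNetwork c P ι) {i j : ι} (hij : i ≠ j)
    (m : ℕ) :
    P.map (net.blockMarks i j (.enb m)) =
      LBTParams.unif.prod ((expMeasure c.μ).prod (expMeasure c.μ)) := by
  have := net.indep_marks.map_triple net.measurable_marks (a := .inr (.inl m))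
    (b := .inr (.inr (.inr (m, i)))) (d := .inr (.inr (.inr (m, j)))) (by simp) (by simp)
    (by simpa using hij)
  simp only [Sum.elim_inl, Sum.elim_inr, net.timerL_law, net.fadeLW_law] at this
  exact this

/-- For fixed AP locations `x` and eNB locations `y`, AP `i` is tagged, it transmits, and AP `j`
transmits as well if `κ` is true. -/
def FixedEvent (c : LBTParams) (κ : Bool) (i j : ι) (x : ι → Plane) (y : ℕ → Plane)
    (a : ι ⊕ ℕ ⊕ ι × ι ⊕ ℕ × ι → ℝ) : Prop :=
  (∀ k, ‖x i‖ ≤ ‖x k‖) ∧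
    ∀ l, (l = i ∨ l = j ∧ κ = true) →
      (∀ k, k ≠ l → a (.inl l) ≤ a (.inl k) ∨
        a (.inr (.inr (.inl (k, l)))) / c.pathLoss ‖x k - x l‖ ≤ c.Γcs / c.powW) ∧
      (∀ m, a (.inl l) ≤ a (.inr (.inl m)) ∨
        a (.inr (.inr (.inr (m, l)))) / c.pathLoss ‖y m - x l‖ ≤ c.Γed / c.powL)

open Classical in
/-- The condition imposed by `FixedEvent` on the two timers and the marks of another block. -/
def blockSet (c : LBTParams) (κ : Bool) (i j : ι) (x : ι → Plane) (y : ℕ → Plane) :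
    MarkBlock ι → Set ((ℝ × ℝ × ℝ) × (ℝ × ℝ × ℝ))
  | .timers => univ
  | .pair => {q | ‖x i‖ ≤ ‖x j‖ ∧
      (q.1.1 ≤ q.1.2.1 ∨ q.2.2.1 / c.pathLoss ‖x j - x i‖ ≤ c.Γcs / c.powW) ∧
      (κ = true → q.1.2.1 ≤ q.1.1 ∨ q.2.2.2 / c.pathLoss ‖x i - x j‖ ≤ c.Γcs / c.powW)}
  | .ap k => {q | k = i ∨ k = j ∨
      ‖x i‖ ≤ ‖x k‖ ∧ c.Pass κ (c.Γcs / c.powW) (x k - x i) (x k - x j) q.1 q.2}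
  | .enb m => {q | c.Pass κ (c.Γed / c.powL) (y m - x i) (y m - x j) q.1 q.2}

lemma measurableSet_blockSet (c : LBTParams) (κ : Bool) (i j : ι) (x : ι → Plane) (y : ℕ → Plane)
    (b : MarkBlock ι) : MeasurableSet (blockSet c κ i j x y b) := by
  cases b with
  | timers => exact .univ
  | pair =>
    have h1 := measurableSet_le (f := fun q : (ℝ × ℝ × ℝ) × (ℝ × ℝ × ℝ) => q.1.1)
      (g := fun q => q.1.2.1) (by fun_prop) (by fun_prop)
    have h2 := measurableSet_le (f := fun q : (ℝ × ℝ × ℝ) × (ℝ × ℝ × ℝ) =>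
      q.2.2.1 / c.pathLoss ‖x j - x i‖) (g := fun _ => c.Γcs / c.powW) (by fun_prop) (by fun_prop)
    have h3 := measurableSet_le (f := fun q : (ℝ × ℝ × ℝ) × (ℝ × ℝ × ℝ) => q.1.2.1)
      (g := fun q => q.1.1) (by fun_prop) (by fun_prop)
    have h4 := measurableSet_le (f := fun q : (ℝ × ℝ × ℝ) × (ℝ × ℝ × ℝ) =>
      q.2.2.2 / c.pathLoss ‖x i - x j‖) (g := fun _ => c.Γcs / c.powW) (by fun_prop) (by fun_prop)
    exact (MeasurableSet.const _).inter ((h1.union h2).inter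
      ((MeasurableSet.const (κ = true)).imp (h3.union h4)))
  | ap k =>
    exact (MeasurableSet.const _).union ((MeasurableSet.const _).union
      ((MeasurableSet.const _).inter (c.measurableSet_pass _ _ _ _)))
  | enb m => exact c.measurableSet_pass _ _ _ _

/-- The event splits into one condition per block, each involving the two timers and that block
alone. This is the form required by `iIndepFun.measure_forall_mem`. -/
lemma fixedEvent_iff (net : LBTNetwork c P ι) (κ : Bool) {i j : ι} (hij : i ≠ j) (x : ι → Plane)
    (y : ℕ → Plane) (ω : Ω) :
    FixedEvent c κ i j x y (fun a => net.marks a ω) ↔ ∀ b, b ≠ .timers →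
      (net.blockMarks i j .timers ω, net.blockMarks i j b ω) ∈ blockSet c κ i j x y b := by
  constructor
  · rintro ⟨h1, h2⟩ b hb
    have hi := h2 i (.inl rfl)
    have hj := fun h => h2 j (.inr ⟨rfl, h⟩)
    cases b with
    | timers => exact absurd rfl hb
    | pair => exact ⟨h1 j, hi.1 j hij.symm, fun h => (hj h).1 i hij⟩
    | ap k =>
      by_cases hk : k = i ∨ k = j
      · exact or_assoc.1 (.inl hk)
      · refine .inr (.inr ⟨h1 k, ?_⟩)
        have : net.blockMarks i j (.ap k) ω =
          (net.timerW k ω, net.fadeW (k, i) ω, net.fadeW (k, j) ω) := if_neg hk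
        rw [this]
        rw [not_or] at hk
        exact ⟨hi.1 k hk.1, fun h => (hj h).1 k hk.2⟩
    | enb m => exact ⟨hi.2 m, fun h => (hj h).2 m⟩
  · intro h
    have hp := h .pair (by simp)
    have ha : ∀ k, k ≠ i → k ≠ j → ‖x i‖ ≤ ‖x k‖ ∧
        c.Pass κ (c.Γcs / c.powW) (x k - x i) (x k - x j) (net.timerW i ω, net.timerW j ω, 0)
          (net.timerW k ω, net.fadeW (k, i) ω, net.fadeW (k, j) ω) := by
      intro k hki hkj
      have h1 : (net.blockMarks i j .timers ω, net.blockMarks i j (.ap k) ω) ∈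
        blockSet c κ i j x y (.ap k) := h (.ap k) (by simp)
      have : net.blockMarks i j (.ap k) ω =
        (net.timerW k ω, net.fadeW (k, i) ω, net.fadeW (k, j) ω) := if_neg (by simp [hki, hkj])
      rw [this] at h1
      exact (h1.resolve_left hki).resolve_left hkj
    have he := fun m => h (.enb m) (by simp)
    refine ⟨fun k => ?_, ?_⟩
    · by_cases hki : k = i
      · rw [hki]
      by_cases hkj : k = j
      · rw [hkj]; exact hp.1
      exact (ha k hki hkj).1
    · rintro l (rfl | ⟨rfl, hκ⟩)
      · refine ⟨fun k hk => ?_, fun m => (he m).1⟩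
        by_cases hkj : k = j
        · rw [hkj]; exact hp.2.1
        exact (ha k hk hkj).2.1
      · refine ⟨fun k hk => ?_, fun m => (he m).2 hκ⟩
        by_cases hki : k = i
        · rw [hki]; exact hp.2.2 hκ
        exact (ha k hki hk).2.2 hκ

end LBTNetwork

lemma ae_unif_prod_mem : ∀ᵐ q ∂(LBTParams.unif.prod LBTParams.unif),
    q.1 ∈ Icc (0 : ℝ) 1 ∧ q.2 ∈ Icc (0 : ℝ) 1 := by
  have h : ∀ᵐ t ∂LBTParams.unif, t ∈ Icc (0 : ℝ) 1 := ae_restrict_mem measurableSet_Icc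
  filter_upwards [Measure.quasiMeasurePreserving_fst.ae h,
    Measure.quasiMeasurePreserving_snd.ae h] with q h1 h2 using ⟨h1, h2⟩

namespace LBTNetwork

variable {Ω : Type*} [MeasurableSpace Ω] {c : LBTParams} {P : Measure Ω} {ι : Type}

lemma measure_blockSet_pair [IsProbabilityMeasure P] (net : LBTNetwork c P ι) (κ : Bool) {i j : ι}
    (hij : i ≠ j) (x : ι → Plane) (y : ℕ → Plane) (τ : ℝ × ℝ × ℝ) :
    P {ω | (τ, net.blockMarks i j .pair ω) ∈ blockSet c κ i j x y .pair} =
      ENNReal.ofReal (c.pairProb κ τ.1 τ.2.1 (x i, x j)) := by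
  have hθ : 0 ≤ c.Γcs / c.powW := (div_pos c.Γcs_pos c.powW_pos).le
  by_cases h : ‖x i‖ ≤ ‖x j‖
  · have h1 : P {ω | (τ, net.blockMarks i j .pair ω) ∈ blockSet c κ i j x y .pair} =
        P.map (fun ω => (net.fadeW (j, i) ω, net.fadeW (i, j) ω))
          {r | (τ.1 ≤ τ.2.1 ∨ r.1 / c.pathLoss ‖x j - x i‖ ≤ c.Γcs / c.powW) ∧
            (κ = true → τ.2.1 ≤ τ.1 ∨ r.2 / c.pathLoss ‖x i - x j‖ ≤ c.Γcs / c.powW)} := by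
      rw [Measure.map_apply ((net.measurable_fadeW _).prodMk (net.measurable_fadeW _))]
      · congr 1
        ext ω
        exact and_iff_right h
      · have h2 := measurableSet_le (f := fun r : ℝ × ℝ => r.1 / c.pathLoss ‖x j - x i‖)
          (g := fun _ => c.Γcs / c.powW) (by fun_prop) (by fun_prop)
        have h4 := measurableSet_le (f := fun r : ℝ × ℝ => r.2 / c.pathLoss ‖x i - x j‖)
          (g := fun _ => c.Γcs / c.powW) (by fun_prop) (by fun_prop)
        exact ((MeasurableSet.const _).union h2).inter ((MeasurableSet.const _).imp
          ((MeasurableSet.const _).union h4))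
    rw [h1, net.map_fades hij, c.expMeasure_prod_pass hθ, LBTParams.pairProb, if_pos h]
  · have h1 : {ω | (τ, net.blockMarks i j .pair ω) ∈ blockSet c κ i j x y .pair} = ∅ :=
      eq_empty_of_forall_notMem fun ω hω => h hω.1
    rw [h1, LBTParams.pairProb, if_neg h]
    simp

open Classical in
lemma measure_blockSet_ap [IsProbabilityMeasure P] (net : LBTNetwork c P ι) (κ : Bool) {i j : ι}
    (hij : i ≠ j) (x : ι → Plane) (y : ℕ → Plane) {τ : ℝ × ℝ × ℝ}
    (ht : τ.1 ∈ Icc (0 : ℝ) 1) (hs : τ.2.1 ∈ Icc (0 : ℝ) 1) (k : ι) :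
    P {ω | (τ, net.blockMarks i j (.ap k) ω) ∈ blockSet c κ i j x y (.ap k)} =
      if k = i ∨ k = j then 1 else
        ENNReal.ofReal (c.apProb κ τ.1 τ.2.1 (x i, x j) (x k)) := by
  have hθ : 0 ≤ c.Γcs / c.powW := (div_pos c.Γcs_pos c.powW_pos).le
  split_ifs with hk
  · have : {ω | (τ, net.blockMarks i j (.ap k) ω) ∈ blockSet c κ i j x y (.ap k)} = univ :=
      eq_univ_of_forall fun ω => or_assoc.1 (.inl hk)
    rw [this, measure_univ]
  · by_cases h : ‖x i‖ ≤ ‖x k‖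
    · rw [LBTParams.apProb, if_pos h, ← c.measure_pass hθ κ _ _ ht hs,
        ← net.map_blockMarks_ap hij hk, Measure.map_apply (net.measurable_blockMarks i j _)
        (c.measurableSet_pass_right κ _ _ _ _)]
      congr 1
      ext ω
      rw [not_or] at hk
      exact ⟨fun h1 => ((h1.resolve_left hk.1).resolve_left hk.2).2, fun h1 => .inr (.inr ⟨h, h1⟩)⟩
    · rw [LBTParams.apProb, if_neg h, ENNReal.ofReal_zero]
      have : {ω | (τ, net.blockMarks i j (.ap k) ω) ∈ blockSet c κ i j x y (.ap k)} = ∅ := by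
        rw [not_or] at hk
        exact eq_empty_of_forall_notMem fun ω h1 => h ((h1.resolve_left hk.1).resolve_left hk.2).1
      rw [this, measure_empty]

lemma measure_blockSet_enb [IsProbabilityMeasure P] (net : LBTNetwork c P ι) (κ : Bool) {i j : ι}
    (hij : i ≠ j) (x : ι → Plane) (y : ℕ → Plane) {τ : ℝ × ℝ × ℝ}
    (ht : τ.1 ∈ Icc (0 : ℝ) 1) (hs : τ.2.1 ∈ Icc (0 : ℝ) 1) (m : ℕ) :
    P {ω | (τ, net.blockMarks i j (.enb m) ω) ∈ blockSet c κ i j x y (.enb m)} =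
      ENNReal.ofReal (c.enbProb κ τ.1 τ.2.1 (x i, x j) (y m)) := by
  have hθ : 0 ≤ c.Γed / c.powL := (div_pos c.Γed_pos c.powL_pos).le
  rw [LBTParams.enbProb, ← c.measure_pass hθ κ _ _ ht hs,
    ← net.map_blockMarks_enb hij m, Measure.map_apply (net.measurable_blockMarks i j _)
        (c.measurableSet_pass_right κ _ _ _ _)]
  rfl

lemma ae_timer_mem (net : LBTNetwork c P ι) (i : ι) : ∀ᵐ ω ∂P, net.timerW i ω ∈ Icc (0 : ℝ) 1 := by
  have : ∀ᵐ t ∂P.map (net.timerW i), t ∈ Icc (0 : ℝ) 1 := by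
    rw [net.timerW_law]
    exact ae_restrict_mem measurableSet_Icc
  exact ae_of_ae_map (net.measurable_timerW i).aemeasurable this

open Classical in
/-- The finitely many blocks `pair`, `ap (e k)` and `enb k`, `k < n`. -/
def blocks (i j : ι) (e : ℕ → ι) (n : ℕ) : Finset (MarkBlock ι) :=
  insert .pair ((((Finset.range n).filter fun k => ¬(e k = i ∨ e k = j)).image fun k => .ap (e k)) ∪
    (Finset.range n).image .enb)

open Classical in
lemma prod_blocks (i j : ι) {e : ℕ → ι} (he : Function.Injective e) (n : ℕ)
    (f : MarkBlock ι → ℝ≥0∞) :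
    ∏ b ∈ blocks i j e n, f b = f .pair *
      ((∏ k ∈ Finset.range n, if e k = i ∨ e k = j then 1 else f (.ap (e k))) *
        ∏ m ∈ Finset.range n, f (.enb m)) := by
  rw [blocks, Finset.prod_insert, Finset.prod_union, Finset.prod_image, Finset.prod_image,
    Finset.prod_filter]
  · simp only [ite_not]
  · intro a _ b _ hab
    simpa using hab
  · intro a _ b _ hab
    exact he (by simpa using hab)
  · rw [Finset.disjoint_left]
    intro b hb hb'
    obtain ⟨k, _, rfl⟩ := Finset.mem_image.1 hb
    obtain ⟨m, _, hm⟩ := Finset.mem_image.1 hb'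
    cases hm
  · simp

lemma measurable_ofReal_pairProb (κ : Bool) (z : Plane × Plane) :
    Measurable fun q : ℝ × ℝ => ENNReal.ofReal (c.pairProb κ q.1 q.2 z) := by
  unfold LBTParams.pairProb
  refine ENNReal.measurable_ofReal.comp ?_
  split_ifs
  · refine Measurable.mul (measurable_const.sub ?_) (measurable_const.sub ?_)
    · exact Measurable.ite (measurableSet_le measurable_fst measurable_snd) measurable_const
        measurable_const
    · exact Measurable.ite (measurableSet_le measurable_snd measurable_fst) measurable_const
        measurable_const
  · exact measurable_const

-- The map `e` enumerates the other APs and may also meet `i` and `j`, whose factors are then `1`.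
-- This covers both the identity, when the APs are indexed by `ℕ`, and `Sum.inr`, when two APs are
-- added to a Poisson process.
open Classical in
lemma measure_fixedEvent [IsProbabilityMeasure P] (net : LBTNetwork c P ι) (κ : Bool) {i j : ι}
    (hij : i ≠ j) {e : ℕ → ι} (he : Function.Injective e)
    (hsurj : ∀ l, l ≠ i → l ≠ j → l ∈ range e) (x : ι → Plane) (y : ℕ → Plane) :
    P {ω | FixedEvent c κ i j x y (fun a => net.marks a ω)} =
      ∫⁻ q, ENNReal.ofReal (c.pairProb κ q.1 q.2 (x i, x j)) *
        (infProd (fun k => if e k = i ∨ e k = j then 1 else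
          ENNReal.ofReal (c.apProb κ q.1 q.2 (x i, x j) (x (e k)))) *
        infProd (fun m => ENNReal.ofReal (c.enbProb κ q.1 q.2 (x i, x j) (y m))))
          ∂(LBTParams.unif.prod LBTParams.unif) := by
  let V := net.blockMarks i j
  let D := blockSet c κ i j x y
  have hD := measurableSet_blockSet c κ i j x y
  have hV := net.measurable_blockMarks i j
  -- Finitely many blocks are imposed at a time: `E n` has an explicit probability by independence,
  -- and these sets decrease to the event.
  let E : ℕ → Set Ω := fun n => {ω | ∀ b ∈ blocks i j e n, (V .timers ω, V b ω) ∈ D b}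
  have hE : ∀ n, MeasurableSet (E n) := fun n => by
    have : E n = ⋂ b ∈ blocks i j e n, {ω | (V .timers ω, V b ω) ∈ D b} := by
      ext ω
      simp [E]
    rw [this]
    exact Finset.measurableSet_biInter _ fun b _ => ((hV _).prodMk (hV b)) (hD b)
  have hmono : Monotone (blocks i j e) := fun a b hab => by
    unfold blocks
    gcongr
  have hanti : Antitone E := fun a b hab ω hω d hd => hω d (hmono hab hd)
  have hEI : {ω | FixedEvent c κ i j x y (fun a => net.marks a ω)} = ⋂ n, E n := by
    ext ω
    rw [mem_ofPred_eq, net.fixedEvent_iff κ hij, mem_iInter]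
    constructor
    · intro h n b hb
      refine h b ?_
      rintro rfl
      simp [blocks] at hb
    · intro h b hb
      cases b with
      | timers => exact absurd rfl hb
      | pair => exact h 0 _ (by simp [blocks])
      | ap k =>
        by_cases hk : k = i ∨ k = j
        · exact or_assoc.1 (.inl hk)
        · have hk' := not_or.1 hk
          obtain ⟨n, rfl⟩ := hsurj k hk'.1 hk'.2
          refine h (n + 1) _ ?_
          simp only [blocks, Finset.mem_insert, Finset.mem_union, Finset.mem_image,
            Finset.mem_filter, Finset.mem_range]
          exact .inr (.inl ⟨n, ⟨n.lt_succ_self, hk⟩, rfl⟩)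
      | enb m =>
        refine h (m + 1) _ ?_
        simp [blocks]
  have hlim := tendsto_measure_iInter_atTop (μ := P) (fun n => (hE n).nullMeasurableSet) hanti
    ⟨0, measure_ne_top _ _⟩
  rw [← hEI] at hlim
  refine tendsto_nhds_unique hlim ?_
  let F : ℝ × ℝ → ℕ → ℝ≥0∞ := fun q k => if e k = i ∨ e k = j then 1 else
    ENNReal.ofReal (c.apProb κ q.1 q.2 (x i, x j) (x (e k)))
  let H : ℝ × ℝ → ℕ → ℝ≥0∞ := fun q m => ENNReal.ofReal (c.enbProb κ q.1 q.2 (x i, x j) (y m))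
  have hpass : ∀ θ v v', Measurable fun q : ℝ × ℝ => c.passProb κ θ q.1 q.2 v v' := fun θ v v' => by
    unfold LBTParams.passProb
    fun_prop
  have hF : ∀ k, Measurable fun q => F q k := fun k => by
    simp only [F]
    split_ifs
    · exact measurable_const
    · unfold LBTParams.apProb
      split_ifs
      · exact ENNReal.measurable_ofReal.comp (hpass _ _ _)
      · exact measurable_const
  have hH : ∀ k, Measurable fun q => H q k := fun k => ENNReal.measurable_ofReal.comp (hpass _ _ _)
  have hpair := measurable_ofReal_pairProb (c := c) κ (x i, x j)
  have hval : ∀ n, P (E n) = ∫⁻ q, ENNReal.ofReal (c.pairProb κ q.1 q.2 (x i, x j)) *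
      ((∏ k ∈ Finset.range n, F q k) * ∏ m ∈ Finset.range n, H q m)
        ∂(LBTParams.unif.prod LBTParams.unif) := fun n => by
    have h1 := (net.iIndepFun_blockMarks i j).measure_forall_mem hV (b₀ := .timers)
      (S := blocks i j e n) (by simp [blocks]) hD
    refine h1.trans ?_
    rw [← net.map_timers hij, lintegral_map]
    · refine lintegral_congr_ae ?_
      filter_upwards [net.ae_timer_mem i, net.ae_timer_mem j] with ω ht hs
      rw [prod_blocks i j he, net.measure_blockSet_pair κ hij]
      congr 2
      · refine Finset.prod_congr rfl fun k _ => ?_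
        rw [net.measure_blockSet_ap κ hij x y ht hs]
        simp only [F]
        split_ifs <;> rfl
      · exact Finset.prod_congr rfl fun m _ => net.measure_blockSet_enb κ hij x y ht hs m
    · exact hpair.mul ((Finset.measurable_fun_prod _ fun k _ => hF k).mul
        (Finset.measurable_fun_prod _ fun k _ => hH k))
    · exact (net.measurable_timerW i).prodMk (net.measurable_timerW j)
  refine Tendsto.congr (fun n => (hval n).symm) ?_
  have hmem : ∀ᵐ q ∂(LBTParams.unif.prod LBTParams.unif), 0 ≤ q.1 ∧ 0 ≤ q.2 := by
    filter_upwards [ae_unif_prod_mem] with q hq using ⟨hq.1.1, hq.2.1⟩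
  have hF1 : ∀ q : ℝ × ℝ, 0 ≤ q.1 ∧ 0 ≤ q.2 → ∀ k, F q k ≤ 1 := fun q hq k => by
    simp only [F]
    split_ifs
    · exact le_rfl
    · exact ENNReal.ofReal_le_one.2 (c.apProb_le_one κ hq.1 hq.2 _ _)
  have hH1 : ∀ q : ℝ × ℝ, 0 ≤ q.1 ∧ 0 ≤ q.2 → ∀ k, H q k ≤ 1 := fun q hq k =>
    ENNReal.ofReal_le_one.2 (c.enbProb_le_one κ hq.1 hq.2 _ _)
  refine tendsto_lintegral_of_dominated_convergence' 1 (fun n => (hpair.mul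
      ((Finset.measurable_fun_prod _ fun k _ => hF k).mul
        (Finset.measurable_fun_prod _ fun k _ => hH k))).aemeasurable) (fun n => ?_) (by simp) ?_
  · filter_upwards [hmem] with q hq
    exact mul_le_one' (ENNReal.ofReal_le_one.2 (c.pairProb_le_one κ _ _ _))
      (mul_le_one' (Finset.prod_le_one' fun k _ => hF1 q hq k)
        (Finset.prod_le_one' fun k _ => hH1 q hq k))
  · filter_upwards [hmem] with q hq
    have hne : ∀ f : ℕ → ℝ≥0∞, infProd f ≠ ∞ := fun f =>
      ((infProd_le_one f).trans_lt ENNReal.one_lt_top).ne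
    exact ENNReal.Tendsto.const_mul (ENNReal.Tendsto.mul (tendsto_prod_range_infProd (hF1 q hq))
      (.inr (hne _)) (tendsto_prod_range_infProd (hH1 q hq)) (.inr (hne _)))
      (.inr ENNReal.ofReal_ne_top)

end LBTNetwork

/-! ### The means as integrals of exceedance probabilities. -/

namespace LBTParams

variable (c : LBTParams)

lemma exceedProb_of_ne (θ : ℝ) {v : Plane} (hv : v ≠ 0) :
    c.exceedProb θ v = Real.exp (-c.μ * θ * c.pathLoss ‖v‖) := if_neg hv

lemma exceedProb_lt_one {θ : ℝ} (hθ : 0 < θ) (v : Plane) : c.exceedProb θ v < 1 := by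
  by_cases hv : v = 0
  · rw [exceedProb, if_pos hv]
    exact zero_lt_one
  · rw [c.exceedProb_of_ne θ hv, Real.exp_lt_one_iff]
    have := c.μ_pos
    have := c.pathLoss_pos (norm_pos_iff.2 hv)
    rw [neg_mul, neg_mul, neg_lt_zero]
    positivity

lemma exceedProb_pos (θ : ℝ) {v : Plane} (hv : v ≠ 0) : 0 < c.exceedProb θ v := by
  rw [c.exceedProb_of_ne θ hv]
  exact Real.exp_pos _

lemma exceedProb_neg (θ : ℝ) (v : Plane) : c.exceedProb θ (-v) = c.exceedProb θ v := by
  simp [exceedProb]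

lemma integrable_exceedProb {θ : ℝ} (hθ : 0 < θ) : Integrable (c.exceedProb θ) := by
  have hμ := c.μ_pos
  have hw := c.wavelength_pos
  have hb : 0 < c.μ * θ * (4 * Real.pi / c.wavelength) ^ 2 := by positivity
  have h1 : Integrable fun v : Plane => (fun r : ℝ =>
      Real.exp (-(c.μ * θ * (4 * Real.pi / c.wavelength) ^ 2) * r ^ c.α)) ‖v‖ := by
    refine (integrable_fun_norm_addHaar (f := fun r : ℝ =>
      Real.exp (-(c.μ * θ * (4 * Real.pi / c.wavelength) ^ 2) * r ^ c.α)) volume).2 ?_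
    -- The exponent `1` is that of the Jacobian `r` in polar coordinates of the plane.
    have := integrableOn_rpow_mul_exp_neg_mul_rpow (s := 1) (by norm_num) c.α_pos hb
    simpa using this
  refine h1.mono' (c.measurable_exceedProb θ).aestronglyMeasurable (ae_of_all _ fun v => ?_)
  rw [Real.norm_of_nonneg (c.exceedProb_nonneg θ v)]
  unfold exceedProb
  split_ifs
  · positivity
  · refine le_of_eq ?_
    congr 1
    unfold pathLoss
    ring

lemma integrable_exceedProb_sub {θ : ℝ} (hθ : 0 < θ) (z : Plane) :
    Integrable fun w => c.exceedProb θ (w - z) :=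
  (c.integrable_exceedProb hθ).comp_sub_right z

lemma integrable_exceedProb'_sub (κ : Bool) {θ : ℝ} (hθ : 0 < θ) (z : Plane) :
    Integrable fun w => c.exceedProb' κ θ (w - z) := by
  cases κ
  · simp [exceedProb']
  · simpa [exceedProb'] using c.integrable_exceedProb_sub hθ z

lemma integrable_exceedProb_mul (κ : Bool) {θ : ℝ} (hθ : 0 < θ) (z z' : Plane) :
    Integrable fun w => c.exceedProb θ (w - z) * c.exceedProb' κ θ (w - z') := by
  refine (c.integrable_exceedProb_sub hθ z).mul_of_top_left ?_
  refine memLp_top_of_bound (((c.measurable_exceedProb' κ θ).comp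
    (measurable_id.sub_const z')).aestronglyMeasurable) 1 (ae_of_all _ fun w => ?_)
  rw [Real.norm_of_nonneg (c.exceedProb'_nonneg κ θ _)]
  exact c.exceedProb'_le_one κ hθ.le _

lemma ae_sub_ne_zero (z : Plane) : ∀ᵐ w : Plane, w - z ≠ 0 := by
  have : volume ({z} : Set Plane) = 0 := measure_singleton z
  rw [ae_iff]
  convert this using 2
  ext w
  simp [sub_eq_zero]

lemma N₀W_eq (y : Plane) (r Γ : ℝ) :
    c.N₀W y r Γ = c.lamW * ∫ w in (Metric.closedBall (0 : Plane) r)ᶜ,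
      c.exceedProb (Γ / c.powW) (w - y) := by
  unfold N₀W
  congr 1
  refine integral_congr_ae (ae_restrict_of_ae ?_)
  filter_upwards [ae_sub_ne_zero y] with w hw
  rw [c.exceedProb_of_ne _ hw]

lemma C₁W_eq (y₁ y₂ : Plane) :
    c.C₁W y₁ y₂ = c.lamW * ∫ w in (Metric.closedBall (0 : Plane) ‖y₂‖)ᶜ,
      c.exceedProb (c.Γcs / c.powW) (w - y₂) * c.exceedProb (c.Γcs / c.powW) (w - y₁) := by
  unfold C₁W C₀W
  congr 1
  refine integral_congr_ae (ae_restrict_of_ae ?_)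
  filter_upwards [ae_sub_ne_zero y₁, ae_sub_ne_zero y₂] with w h1 h2
  rw [c.exceedProb_of_ne _ h1, c.exceedProb_of_ne _ h2, ← Real.exp_add]
  congr 1
  ring

lemma closedBall_zero_compl_ae : ((Metric.closedBall (0 : Plane) 0)ᶜ : Set Plane) =ᵐ[volume] univ := by
  rw [Metric.closedBall_zero]
  rw [ae_eq_univ, compl_compl]
  exact measure_singleton _

/-- The eNB mean is the same at every receiver by translation invariance: the excluded ball of
radius `0` is a single point, hence null. -/
lemma NL_eq (z : Plane) : c.NL = c.lamL * ∫ w, c.exceedProb (c.Γed / c.powL) (w - z) := by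
  unfold NL N₀L
  rw [integral_sub_right_eq_self, setIntegral_congr_set closedBall_zero_compl_ae, setIntegral_univ]
  congr 1
  refine integral_congr_ae ?_
  filter_upwards [ae_sub_ne_zero 0] with w hw
  rw [sub_zero] at hw ⊢
  rw [c.exceedProb_of_ne _ hw]

lemma C₂L_eq (y₁ y₂ : Plane) :
    c.C₂L (y₁ - y₂) = c.lamL * ∫ w,
      c.exceedProb (c.Γed / c.powL) (w - y₂) * c.exceedProb (c.Γed / c.powL) (w - y₁) := by
  unfold C₂L C₀L
  rw [norm_zero, setIntegral_congr_set closedBall_zero_compl_ae, setIntegral_univ,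
    ← integral_sub_right_eq_self _ y₂]
  congr 1
  refine integral_congr_ae ?_
  filter_upwards [ae_sub_ne_zero y₁, ae_sub_ne_zero y₂] with w h1 h2
  rw [c.exceedProb_of_ne _ h1, c.exceedProb_of_ne _ h2, ← Real.exp_add, sub_zero,
    sub_sub_sub_cancel_right]
  congr 1
  ring

/-- The reflection taking `x` to `(‖x‖, 0)` preserves Lebesgue measure, distances and the ball
around the origin. -/
lemma N₂W_norm (x : Plane) : c.N₂W ‖x‖ = c.N₀W x ‖x‖ c.Γcs := by
  have hn : ‖x‖ = ‖(!₂[‖x‖, 0] : Plane)‖ := by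
    rw [EuclideanSpace.norm_eq (!₂[‖x‖, 0] : Plane)]
    simp [Real.sqrt_sq]
  set φ := (ℝ ∙ (x - !₂[‖x‖, 0]))ᗮ.reflection
  have hφ : φ x = !₂[‖x‖, 0] := Submodule.reflection_sub hn
  unfold N₂W N₀W
  congr 1
  have hmp := φ.measurePreserving
  rw [← hmp.setIntegral_preimage_emb φ.toHomeomorph.measurableEmbedding]
  have hpre : φ ⁻¹' (Metric.closedBall (0 : Plane) ‖x‖)ᶜ = (Metric.closedBall (0 : Plane) ‖x‖)ᶜ := by
    ext w
    simp
  rw [hpre]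
  refine integral_congr_ae (ae_of_all _ fun w => ?_)
  dsimp only
  rw [← hφ, ← map_sub, φ.norm_map]

/-- The three means in `h₂W`, as functions of the positions of the tagged AP and of the other. -/
def mean₁ (z : Plane × Plane) : ℝ := c.N₀W z.2 ‖z.1‖ c.Γcs + c.NL

/-- The mean number of nodes outside the ball whose power at the tagged AP exceeds the threshold. -/
def mean₂ (z : Plane × Plane) : ℝ := c.N₂W ‖z.1‖ + c.NL

/-- The mean number of nodes outside the ball whose powers at both APs exceed the threshold. -/
def mean₃ (z : Plane × Plane) : ℝ := c.C₁W z.2 z.1 + c.C₂L (z.2 - z.1)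

end LBTParams

/-! ### Generating functionals of APs and eNBs, and inequalities between the means. -/

namespace LBTParams

variable (c : LBTParams)

lemma passProb_nonneg (κ : Bool) {θ t s : ℝ} (hθ : 0 ≤ θ) (ht : t ∈ Icc (0 : ℝ) 1)
    (hs : s ∈ Icc (0 : ℝ) 1) (v v' : Plane) : 0 ≤ c.passProb κ θ t s v v' := by
  unfold passProb
  have h1 := c.exceedProb_nonneg θ v
  have h2 := c.exceedProb'_nonneg κ θ v'
  have h3 := c.exceedProb'_le_one κ hθ v'
  have h4 := c.exceedProb_le_one hθ v
  set p := c.exceedProb θ v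
  set p' := c.exceedProb' κ θ v'
  rcases le_total t s with h | h
  · rw [min_eq_left h]
    have h5 : t * (p * (1 - p')) ≤ 1 * (1 * (1 - p')) := by
      have := sub_nonneg.2 h3
      have := ht.2
      gcongr
    have h6 : s * p' ≤ 1 * p' := by
      have := hs.2
      gcongr
    linarith
  · rw [min_eq_right h]
    have h5 : s * (p' * (1 - p)) ≤ 1 * (1 * (1 - p)) := by
      have := sub_nonneg.2 h4
      have := hs.2
      gcongr
    have h6 : t * p ≤ 1 * p := by
      have := ht.2
      gcongr
    linarith

/-- The exponent of the generating functional, expanded by linearity. It is given as a real number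
`I` so that no subtraction in `ℝ≥0∞` is needed. -/
lemma lintegral_one_sub_passProb (κ : Bool) {θ t s : ℝ} (hθ : 0 < θ) (ht : t ∈ Icc (0 : ℝ) 1)
    (hs : s ∈ Icc (0 : ℝ) 1) (z z' : Plane) (S : Set Plane) :
    ∃ I : ℝ, 0 ≤ I ∧ ∫⁻ w in S, 1 - ENNReal.ofReal (c.passProb κ θ t s (w - z) (w - z')) =
        ENNReal.ofReal I ∧
      I = t * (∫ w in S, c.exceedProb θ (w - z)) + s * (∫ w in S, c.exceedProb' κ θ (w - z')) -
        min t s * ∫ w in S, c.exceedProb θ (w - z) * c.exceedProb' κ θ (w - z') := by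
  have h1 := (c.integrable_exceedProb_sub hθ z).restrict (s := S)
  have h2 := (c.integrable_exceedProb'_sub κ hθ z').restrict (s := S)
  have h3 := (c.integrable_exceedProb_mul κ hθ z z').restrict (s := S)
  have h12 := (h1.const_mul t).add (h2.const_mul s)
  have h0 : ∀ w, 0 ≤ 1 - c.passProb κ θ t s (w - z) (w - z') := fun w =>
    sub_nonneg.2 (c.passProb_le_one κ hθ.le ht.1 hs.1 _ _)
  have heq : (fun w => 1 - c.passProb κ θ t s (w - z) (w - z')) = fun w =>
      t * c.exceedProb θ (w - z) + s * c.exceedProb' κ θ (w - z') -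
        min t s * (c.exceedProb θ (w - z) * c.exceedProb' κ θ (w - z')) := by
    funext w
    rw [passProb, sub_sub_cancel]
  refine ⟨∫ w in S, 1 - c.passProb κ θ t s (w - z) (w - z'), integral_nonneg h0, ?_, ?_⟩
  · rw [ofReal_integral_eq_lintegral_ofReal _ (ae_of_all _ h0)]
    · refine lintegral_congr fun w => ?_
      rw [ENNReal.ofReal_sub _ (c.passProb_nonneg κ hθ.le ht hs _ _), ENNReal.ofReal_one]
    · rw [heq]
      exact h12.sub (h3.const_mul _)
  · rw [heq]
    have h4 := integral_sub h12 (h3.const_mul (min t s))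
    have h5 := integral_add (h1.const_mul t) (h2.const_mul s)
    simp only [Pi.add_apply, integral_const_mul] at h4 h5
    rw [h4, h5]

/-- The mean number of APs closer to the origin than `z.1`. -/
def voidMean (z : Plane × Plane) : ℝ := c.lamW * (volume (Metric.ball (0 : Plane) ‖z.1‖)).toReal

/-- The mean number of nodes outside the ball that block the AP at `z.1` or, if `κ`, the AP at
`z.2`, given their timers `t` and `s`. -/
def blockMean (κ : Bool) (t s : ℝ) (z : Plane × Plane) : ℝ :=
  t * c.mean₂ z + if κ then s * c.mean₁ z - min t s * c.mean₃ z else 0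

lemma ball_compl_ae (r : ℝ) :
    ((Metric.ball (0 : Plane) r)ᶜ : Set Plane) =ᵐ[volume] (Metric.closedBall (0 : Plane) r)ᶜ := by
  refine ae_eq_set_compl_compl.2 ?_
  refine (ae_eq_of_subset_of_measure_ge Metric.ball_subset_closedBall ?_
    measurableSet_ball.nullMeasurableSet measure_closedBall_lt_top.ne)
  rw [Measure.addHaar_closedBall_eq_addHaar_ball]

lemma lintegral_one_sub_enbProb_ne_top (κ : Bool) {t s : ℝ} (ht : t ∈ Icc (0 : ℝ) 1)
    (hs : s ∈ Icc (0 : ℝ) 1) (z : Plane × Plane) :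
    ∫⁻ w, 1 - ENNReal.ofReal (c.enbProb κ t s z w) ≠ ∞ := by
  obtain ⟨I, -, h2, -⟩ := c.lintegral_one_sub_passProb κ (div_pos c.Γed_pos c.powL_pos) ht hs
    z.1 z.2 univ
  rw [setLIntegral_univ] at h2
  unfold enbProb
  rw [h2]
  exact ENNReal.ofReal_ne_top

lemma genFun_enbProb (κ : Bool) {t s : ℝ} (ht : t ∈ Icc (0 : ℝ) 1) (hs : s ∈ Icc (0 : ℝ) 1)
    (z : Plane × Plane) :
    genFun c.lamL (fun w => ENNReal.ofReal (c.enbProb κ t s z w)) = ENNReal.ofReal (Real.exp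
      (-(t * c.NL + if κ then s * c.NL - min t s * c.C₂L (z.2 - z.1) else 0))) := by
  obtain ⟨I, h1, h2, h3⟩ := c.lintegral_one_sub_passProb κ (div_pos c.Γed_pos c.powL_pos) ht hs
    z.1 z.2 univ
  simp only [Measure.restrict_univ] at h2 h3
  unfold genFun enbProb
  rw [h2, ENNReal.toReal_ofReal h1, h3]
  congr 3
  rw [c.C₂L_eq, mul_sub, mul_add, mul_left_comm, ← c.NL_eq]
  cases κ
  · simp [exceedProb']
  · simp only [exceedProb', if_true]
    rw [mul_left_comm, ← c.NL_eq]
    ring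

/-- Inside the ball `apProb` is `0`, so an AP there is forbidden and the ball contributes its full
area; this produces the void probability. The sphere is null, so open and closed balls may be
exchanged. -/
lemma lintegral_one_sub_apProb (κ : Bool) (t s : ℝ) (z : Plane × Plane) :
    ∫⁻ w, 1 - ENNReal.ofReal (c.apProb κ t s z w) = volume (Metric.ball (0 : Plane) ‖z.1‖) +
      ∫⁻ w in (Metric.closedBall (0 : Plane) ‖z.1‖)ᶜ,
        1 - ENNReal.ofReal (c.passProb κ (c.Γcs / c.powW) t s (w - z.1) (w - z.2)) := by
  rw [← lintegral_add_compl _ (measurableSet_ball (x := (0 : Plane)) (ε := ‖z.1‖))]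
  congr 1
  · rw [← setLIntegral_one]
    refine setLIntegral_congr_fun measurableSet_ball fun w hw => ?_
    have : ‖w‖ < ‖z.1‖ := by simpa using hw
    simp [apProb, not_le_of_gt this]
  · refine (setLIntegral_congr_fun measurableSet_ball.compl fun w hw => ?_).trans
      (setLIntegral_congr (ball_compl_ae _))
    have : ‖z.1‖ ≤ ‖w‖ := by simpa using hw
    simp only [apProb, if_pos this]

lemma lintegral_one_sub_apProb_ne_top (κ : Bool) {t s : ℝ} (ht : t ∈ Icc (0 : ℝ) 1)
    (hs : s ∈ Icc (0 : ℝ) 1) (z : Plane × Plane) :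
    ∫⁻ w, 1 - ENNReal.ofReal (c.apProb κ t s z w) ≠ ∞ := by
  obtain ⟨I, -, h2, -⟩ := c.lintegral_one_sub_passProb κ (div_pos c.Γcs_pos c.powW_pos) ht hs
    z.1 z.2 (Metric.closedBall (0 : Plane) ‖z.1‖)ᶜ
  rw [lintegral_one_sub_apProb, h2]
  exact ENNReal.add_ne_top.2 ⟨measure_ball_lt_top.ne, ENNReal.ofReal_ne_top⟩

lemma genFun_apProb (κ : Bool) {t s : ℝ} (ht : t ∈ Icc (0 : ℝ) 1) (hs : s ∈ Icc (0 : ℝ) 1)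
    (z : Plane × Plane) :
    genFun c.lamW (fun w => ENNReal.ofReal (c.apProb κ t s z w)) = ENNReal.ofReal (Real.exp
      (-(c.voidMean z + (t * c.N₂W ‖z.1‖ + if κ then s * c.N₀W z.2 ‖z.1‖ c.Γcs -
        min t s * c.C₁W z.2 z.1 else 0)))) := by
  obtain ⟨I, h1, h2, h3⟩ := c.lintegral_one_sub_passProb κ (div_pos c.Γcs_pos c.powW_pos) ht hs
    z.1 z.2 (Metric.closedBall (0 : Plane) ‖z.1‖)ᶜ
  unfold genFun
  rw [lintegral_one_sub_apProb, h2, ENNReal.toReal_add measure_ball_lt_top.ne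
    ENNReal.ofReal_ne_top, ENNReal.toReal_ofReal h1, h3, mul_add, voidMean, c.C₁W_eq, c.N₂W_norm,
    c.N₀W_eq, c.N₀W_eq]
  congr 4
  cases κ
  · simp only [exceedProb', Bool.false_eq_true, if_false, mul_zero, integral_zero]
    ring
  · simp only [exceedProb', if_true]
    ring

lemma genFun_enbProb_mul_apProb (κ : Bool) {t s : ℝ} (ht : t ∈ Icc (0 : ℝ) 1)
    (hs : s ∈ Icc (0 : ℝ) 1) (z : Plane × Plane) :
    genFun c.lamL (fun w => ENNReal.ofReal (c.enbProb κ t s z w)) *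
      genFun c.lamW (fun w => ENNReal.ofReal (c.apProb κ t s z w)) =
    ENNReal.ofReal (Real.exp (-c.voidMean z) * Real.exp (-c.blockMean κ t s z)) := by
  rw [c.genFun_enbProb κ ht hs, c.genFun_apProb κ ht hs,
    ← ENNReal.ofReal_mul (Real.exp_pos _).le, ← Real.exp_add, ← Real.exp_add]
  congr 2
  unfold blockMean mean₁ mean₂ mean₃
  cases κ
  · simp only [Bool.false_eq_true, if_false]
    ring
  · simp only [if_true]
    ring

lemma NL_pos : 0 < c.NL := by
  have hθ := div_pos c.Γed_pos c.powL_pos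
  rw [c.NL_eq 0]
  refine mul_pos c.lamL_pos ((integral_pos_iff_support_of_nonneg (fun w => c.exceedProb_nonneg _ _)
    (c.integrable_exceedProb_sub hθ 0)).2 ?_)
  have : (Function.support fun w : Plane => c.exceedProb (c.Γed / c.powL) (w - 0)) =ᵐ[volume] univ := by
    rw [eventuallyEq_univ]
    filter_upwards [ae_sub_ne_zero 0] with w hw using (c.exceedProb_pos _ hw).ne'
  rw [measure_congr this]
  exact NeZero.pos _

/-- The difference is the integral of `p * (1 - p')`, which is positive almost everywhere.
Strictness is what keeps the denominators `N₁ - N₃` and `N₂ - N₃` of `M` away from zero. -/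
lemma C₂L_lt_NL (y₁ y₂ : Plane) : c.C₂L (y₁ - y₂) < c.NL := by
  have hθ := div_pos c.Γed_pos c.powL_pos
  have h3 := c.integrable_exceedProb_mul true hθ y₂ y₁
  simp only [exceedProb', if_true] at h3
  have h1 := c.integrable_exceedProb_sub hθ y₂
  rw [c.NL_eq y₂, c.C₂L_eq, ← sub_pos, ← mul_sub, ← integral_sub h1 h3]
  refine mul_pos c.lamL_pos ((integral_pos_iff_support_of_nonneg (fun w => ?_) (h1.sub h3)).2 ?_)
  · have h5 := mul_le_of_le_one_right (c.exceedProb_nonneg (c.Γed / c.powL) (w - y₂))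
      (c.exceedProb_le_one hθ.le (w - y₁))
    exact sub_nonneg.2 h5
  · have : (Function.support fun w : Plane => c.exceedProb (c.Γed / c.powL) (w - y₂) -
        c.exceedProb (c.Γed / c.powL) (w - y₂) * c.exceedProb (c.Γed / c.powL) (w - y₁))
        =ᵐ[volume] univ := by
      rw [eventuallyEq_univ]
      filter_upwards [ae_sub_ne_zero y₂] with w hw
      exact (sub_pos.2 (mul_lt_of_lt_one_right (c.exceedProb_pos _ hw)
        (c.exceedProb_lt_one hθ _))).ne'
    exact (NeZero.pos _).trans_eq (measure_congr this).symm

lemma N₀W_nonneg (y : Plane) (r Γ : ℝ) : 0 ≤ c.N₀W y r Γ :=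
  mul_nonneg c.lamW_pos.le (integral_nonneg fun _ => (Real.exp_pos _).le)

lemma C₁W_le_left (y₁ y₂ : Plane) : c.C₁W y₁ y₂ ≤ c.N₀W y₁ ‖y₂‖ c.Γcs := by
  have hθ := div_pos c.Γcs_pos c.powW_pos
  have h3 := c.integrable_exceedProb_mul true hθ y₂ y₁
  simp only [exceedProb', if_true] at h3
  rw [c.C₁W_eq, c.N₀W_eq]
  refine mul_le_mul_of_nonneg_left (integral_mono h3.restrict
    (c.integrable_exceedProb_sub hθ y₁).restrict fun w => ?_) c.lamW_pos.le
  exact mul_le_of_le_one_left (c.exceedProb_nonneg _ _) (c.exceedProb_le_one hθ.le _)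

lemma C₁W_le_right (y₁ y₂ : Plane) : c.C₁W y₁ y₂ ≤ c.N₀W y₂ ‖y₂‖ c.Γcs := by
  have hθ := div_pos c.Γcs_pos c.powW_pos
  have h3 := c.integrable_exceedProb_mul true hθ y₂ y₁
  simp only [exceedProb', if_true] at h3
  rw [c.C₁W_eq, c.N₀W_eq]
  refine mul_le_mul_of_nonneg_left (integral_mono h3.restrict
    (c.integrable_exceedProb_sub hθ y₂).restrict fun w => ?_) c.lamW_pos.le
  exact mul_le_of_le_one_right (c.exceedProb_nonneg _ _) (c.exceedProb_le_one hθ.le _)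

lemma mean₁_pos (z : Plane × Plane) : 0 < c.mean₁ z :=
  add_pos_of_nonneg_of_pos (c.N₀W_nonneg _ _ _) c.NL_pos

lemma mean₂_pos (z : Plane × Plane) : 0 < c.mean₂ z :=
  add_pos_of_nonneg_of_pos (c.N₀W_nonneg _ _ _) c.NL_pos

/-- A weak inequality suffices for the APs because the eNBs give a strict one. -/
lemma mean₃_lt_mean₁ (z : Plane × Plane) : c.mean₃ z < c.mean₁ z :=
  add_lt_add_of_le_of_lt (c.C₁W_le_left _ _) (c.C₂L_lt_NL _ _)

lemma mean₃_lt_mean₂ (z : Plane × Plane) : c.mean₃ z < c.mean₂ z := by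
  unfold mean₂
  rw [c.N₂W_norm]
  exact add_lt_add_of_le_of_lt (c.C₁W_le_right _ _) (c.C₂L_lt_NL _ _)

end LBTParams

/-! ### Integration over the timers: the functions `M`, `U` and `V`. -/

lemma integral_exp_neg_mul (a b : ℝ) {k : ℝ} (hk : k ≠ 0) :
    ∫ t in a..b, Real.exp (-(t * k)) = (Real.exp (-(a * k)) - Real.exp (-(b * k))) / k := by
  have h : ∀ t ∈ uIcc a b, HasDerivAt (fun t => -Real.exp (-(t * k)) / k) (Real.exp (-(t * k))) t := by
    intro t _
    have h1 : HasDerivAt (fun t => -(t * k)) (-k) t := by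
      simpa [Function.comp_def] using (hasDerivAt_mul_const (x := t) k).fun_neg
    refine (h1.exp.fun_neg.div_const k).congr_deriv ?_
    field_simp
  rw [intervalIntegral.integral_eq_sub_of_hasDerivAt h
    (by apply Continuous.intervalIntegrable; fun_prop)]
  ring

/-- The right-hand side is the shape of `U`, with `p` the exceedance probability between the two APs
and `k` the mean `N₂`. -/
lemma integral_one_sub_mul_exp_neg_mul (p : ℝ) {k : ℝ} (hk : k ≠ 0) :
    ∫ t in (0 : ℝ)..1, (1 - t * p) * Real.exp (-(t * k)) =
      (1 - Real.exp (-k)) / k - p * ((1 - Real.exp (-k)) / k ^ 2 - Real.exp (-k) / k) := by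
  have h : ∀ t ∈ uIcc (0 : ℝ) 1, HasDerivAt
      (fun t => Real.exp (-(t * k)) * ((t * p - 1) / k + p / k ^ 2))
      ((1 - t * p) * Real.exp (-(t * k))) t := by
    intro t _
    have h1 : HasDerivAt (fun t => -(t * k)) (-k) t := by
      simpa [Function.comp_def] using (hasDerivAt_mul_const (x := t) k).fun_neg
    have h2 : HasDerivAt (fun t => (t * p - 1) / k + p / k ^ 2) (p / k) t := by
      simpa using ((((hasDerivAt_id t).mul_const p).sub_const 1).div_const k).add_const (p / k ^ 2)
    refine (h1.exp.fun_mul h2).congr_deriv ?_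
    field_simp
    ring
  rw [intervalIntegral.integral_eq_sub_of_hasDerivAt h
    (by apply Continuous.intervalIntegrable; fun_prop)]
  simp only [one_mul, zero_mul, neg_zero, Real.exp_zero]
  field_simp
  ring

/-- The value at the tie `s = t` is irrelevant, being taken on a null set. -/
lemma integral_unif_split {f A B : ℝ → ℝ} (hA : Continuous A) (hB : Continuous B) {t : ℝ}
    (ht : t ∈ Icc (0 : ℝ) 1) (hfA : ∀ s < t, f s = A s) (hfB : ∀ s, t < s → f s = B s) :
    ∫ s, f s ∂LBTParams.unif = (∫ s in (0 : ℝ)..t, A s) + ∫ s in t..1, B s := by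
  have hne : ∀ᵐ s : ℝ, s ≠ t := by simp [ae_iff]
  have h1 : ∀ᵐ s : ℝ, s ∈ uIoc 0 t → A s = f s := by
    filter_upwards [hne] with s hs h
    rw [uIoc_of_le ht.1] at h
    exact (hfA s (lt_of_le_of_ne h.2 hs)).symm
  have h2 : ∀ᵐ s : ℝ, s ∈ uIoc t 1 → B s = f s := by
    filter_upwards with s h
    rw [uIoc_of_le ht.2] at h
    exact (hfB s h.1).symm
  rw [LBTParams.unif, integral_Icc_eq_integral_Ioc, ← intervalIntegral.integral_of_le zero_le_one,
    intervalIntegral.integral_congr_ae h1, intervalIntegral.integral_congr_ae h2,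
    intervalIntegral.integral_add_adjacent_intervals]
  · exact (hA.intervalIntegrable 0 t).congr_ae ((ae_restrict_iff' measurableSet_uIoc).2 h1)
  · exact (hB.intervalIntegrable t 1).congr_ae ((ae_restrict_iff' measurableSet_uIoc).2 h2)

namespace LBTParams

lemma integral_unif_eq (f : ℝ → ℝ) : ∫ t, f t ∂unif = ∫ t in (0 : ℝ)..1, f t := by
  rw [unif, integral_Icc_eq_integral_Ioc, ← intervalIntegral.integral_of_le zero_le_one]

/-- The region `s < t` contributes `M N₂ N₁ N₃` and the region `t < s` contributes `M N₁ N₂ N₃`,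
since `min t s` is `s` on the first and `t` on the second. -/
lemma integral_timers_eq_M {N₁ N₂ N₃ : ℝ} (h1 : 0 < N₁) (h2 : 0 < N₂) (h13 : N₃ < N₁)
    (h23 : N₃ < N₂) :
    ∫ t in (0 : ℝ)..1, ((∫ s in (0 : ℝ)..t, Real.exp (-(t * N₂ + (s * N₁ - s * N₃)))) +
      ∫ s in t..1, Real.exp (-(t * N₂ + (s * N₁ - t * N₃)))) = M N₁ N₂ N₃ + M N₂ N₁ N₃ := by
  have hd1 : N₁ - N₃ ≠ 0 := (sub_pos.2 h13).ne'
  have hd2 : N₂ - N₃ ≠ 0 := (sub_pos.2 h23).ne'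
  have hS : N₁ + N₂ - N₃ ≠ 0 := by linarith
  have hS' : N₂ + N₁ - N₃ ≠ 0 := by linarith
  have hA : ∀ t, (∫ s in (0 : ℝ)..t, Real.exp (-(t * N₂ + (s * N₁ - s * N₃)))) =
      (Real.exp (-(t * N₂)) - Real.exp (-(t * (N₁ + N₂ - N₃)))) / (N₁ - N₃) := fun t => by
    have : ∀ s, Real.exp (-(t * N₂ + (s * N₁ - s * N₃))) =
        Real.exp (-(t * N₂)) * Real.exp (-(s * (N₁ - N₃))) := fun s => by
      rw [← Real.exp_add]
      ring_nf
    simp_rw [this]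
    rw [intervalIntegral.integral_const_mul, integral_exp_neg_mul _ _ hd1, zero_mul, neg_zero,
      Real.exp_zero, mul_div_assoc', mul_sub, mul_one, ← Real.exp_add]
    ring_nf
  have hB : ∀ t, (∫ s in t..1, Real.exp (-(t * N₂ + (s * N₁ - t * N₃)))) =
      (Real.exp (-(t * (N₁ + N₂ - N₃))) - Real.exp (-N₁) * Real.exp (-(t * (N₂ - N₃)))) / N₁ :=
      fun t => by
    have : ∀ s, Real.exp (-(t * N₂ + (s * N₁ - t * N₃))) =
        Real.exp (-(t * (N₂ - N₃))) * Real.exp (-(s * N₁)) := fun s => by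
      rw [← Real.exp_add]
      ring_nf
    simp_rw [this]
    rw [intervalIntegral.integral_const_mul, integral_exp_neg_mul _ _ h1.ne', one_mul,
      mul_div_assoc', mul_sub, ← Real.exp_add, ← Real.exp_add, ← Real.exp_add]
    ring_nf
  simp_rw [hA, hB]
  have hi : ∀ k : ℝ, IntervalIntegrable (fun t => Real.exp (-(t * k))) volume 0 1 := fun k => by
    apply Continuous.intervalIntegrable
    fun_prop
  rw [intervalIntegral.integral_add (((hi _).sub (hi _)).div_const _)
    (((hi _).sub ((hi _).const_mul _)).div_const _), intervalIntegral.integral_div,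
    intervalIntegral.integral_div, intervalIntegral.integral_sub (hi _) (hi _),
    intervalIntegral.integral_sub (hi _) ((hi _).const_mul _), intervalIntegral.integral_const_mul,
    integral_exp_neg_mul _ _ h2.ne', integral_exp_neg_mul _ _ hS, integral_exp_neg_mul _ _ hd2]
  have e1 : Real.exp (-N₁ - N₂ + N₃) = Real.exp (-N₁) * Real.exp (-(N₂ - N₃)) := by
    rw [← Real.exp_add]
    ring_nf
  have e2 : Real.exp (-N₂ - N₁ + N₃) = Real.exp (-N₁) * Real.exp (-(N₂ - N₃)) := by
    rw [← Real.exp_add]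
    ring_nf
  have e3 : Real.exp (-(N₁ + N₂ - N₃)) = Real.exp (-N₁) * Real.exp (-(N₂ - N₃)) := by
    rw [← Real.exp_add]
    ring_nf
  have e4 : N₂ + N₁ - N₃ = N₁ + N₂ - N₃ := by ring
  unfold M
  simp only [zero_mul, one_mul, neg_zero, Real.exp_zero, e1, e2, e3, e4]
  have h1' := h1.ne'
  have h2' := h2.ne'
  -- Once all exponentials are expressed through three of them, the identity is one of rational
  -- functions in independent variables.
  generalize Real.exp (-N₁) = x
  generalize Real.exp (-(N₂ - N₃)) = y
  generalize Real.exp (-N₂) = w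
  field_simp
  ring

variable (c : LBTParams)

lemma blockMean_nonneg (κ : Bool) {t s : ℝ} (ht : 0 ≤ t) (hs : 0 ≤ s) (z : Plane × Plane) :
    0 ≤ c.blockMean κ t s z := by
  have h1 := c.mean₁_pos z
  have h2 := c.mean₂_pos z
  have h3 := c.mean₃_lt_mean₂ z
  unfold blockMean
  split_ifs
  · have h4 : min t s * c.mean₃ z ≤ min t s * c.mean₂ z := by gcongr
    have h5 : min t s * c.mean₂ z ≤ t * c.mean₂ z := by
      gcongr
      exact min_le_left _ _
    have h6 : 0 ≤ s * c.mean₁ z := by positivity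
    linarith
  · positivity

lemma measurable_pairProb (κ : Bool) :
    Measurable fun r : (ℝ × ℝ) × Plane × Plane => c.pairProb κ r.1.1 r.1.2 r.2 := by
  have h1 := c.measurable_exceedProb (c.Γcs / c.powW)
  have h2 := c.measurable_exceedProb' κ (c.Γcs / c.powW)
  unfold pairProb
  refine Measurable.ite (measurableSet_le (by fun_prop) (by fun_prop))
    (Measurable.mul (measurable_const.sub ?_) (measurable_const.sub ?_)) measurable_const
  · exact Measurable.ite (measurableSet_le (by fun_prop) (by fun_prop)) measurable_const
      (h1.comp (by fun_prop))
  · exact Measurable.ite (measurableSet_le (by fun_prop) (by fun_prop)) measurable_const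
      (h2.comp (by fun_prop))

/-- The probability that, for a Poisson process of eNBs and two APs at `z.1` and `z.2` in addition
to a Poisson process of APs, the AP at `z.1` is tagged, it transmits, and the one at `z.2` transmits
as well if `κ` is true. -/
def pairMass (κ : Bool) (z : Plane × Plane) : ℝ≥0∞ :=
  ∫⁻ q, ENNReal.ofReal (c.pairProb κ q.1 q.2 z) *
    (genFun c.lamL (fun w => ENNReal.ofReal (c.enbProb κ q.1 q.2 z w)) *
      genFun c.lamW (fun w => ENNReal.ofReal (c.apProb κ q.1 q.2 z w))) ∂(unif.prod unif)

/-- The void probability does not depend on the timers and leaves the integral. The remaining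
integrand is at most `1` because `blockMean` is nonnegative. -/
lemma pairMass_eq_integral (κ : Bool) (z : Plane × Plane) :
    c.pairMass κ z = ENNReal.ofReal (Real.exp (-c.voidMean z) *
      ∫ t, ∫ s, c.pairProb κ t s z * Real.exp (-c.blockMean κ t s z) ∂unif ∂unif) := by
  have hm : Measurable fun q : ℝ × ℝ =>
      c.pairProb κ q.1 q.2 z * Real.exp (-c.blockMean κ q.1 q.2 z) := by
    refine ((c.measurable_pairProb κ).comp (measurable_id.prodMk measurable_const)).mul ?_
    unfold blockMean
    split_ifs <;> fun_prop
  have hi : Integrable (fun q : ℝ × ℝ =>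
      c.pairProb κ q.1 q.2 z * Real.exp (-c.blockMean κ q.1 q.2 z)) (unif.prod unif) := by
    refine Integrable.of_bound hm.aestronglyMeasurable 1 ?_
    filter_upwards [ae_unif_prod_mem] with q hq
    have h0 := c.pairProb_nonneg κ q.1 q.2 z
    rw [Real.norm_of_nonneg (by positivity)]
    refine mul_le_one₀ (c.pairProb_le_one κ _ _ z) (Real.exp_pos _).le ?_
    rw [Real.exp_le_one_iff, neg_nonpos]
    exact c.blockMean_nonneg κ hq.1.1 hq.2.1 z
  rw [← integral_prod _ hi, ← integral_const_mul, ofReal_integral_eq_lintegral_ofReal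
    (hi.const_mul _)]
  · refine lintegral_congr_ae ?_
    filter_upwards [ae_unif_prod_mem] with q hq
    rw [c.genFun_enbProb_mul_apProb κ hq.1 hq.2, ← ENNReal.ofReal_mul (c.pairProb_nonneg κ _ _ _),
      mul_left_comm]
  · refine ae_of_all _ fun q => ?_
    have h0 := c.pairProb_nonneg κ q.1 q.2 z
    positivity

lemma pairProb_of_lt (κ : Bool) {t s : ℝ} {z : Plane × Plane} (hz : ‖z.1‖ ≤ ‖z.2‖) (h : s < t) :
    c.pairProb κ t s z = 1 - c.exceedProb (c.Γcs / c.powW) (z.2 - z.1) := by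
  simp [pairProb, hz, not_le_of_gt h, h.le]

lemma pairProb_of_gt (κ : Bool) {t s : ℝ} {z : Plane × Plane} (hz : ‖z.1‖ ≤ ‖z.2‖) (h : t < s) :
    c.pairProb κ t s z =
      1 - if κ then c.exceedProb (c.Γcs / c.powW) (z.2 - z.1) else 0 := by
  rw [← neg_sub z.1, c.exceedProb_neg]
  simp [pairProb, hz, not_le_of_gt h, h.le, exceedProb']

/-- The AP at `z.1` has to escape the other one only if `s < t`. Averaging over `s` gives `t (1 - p)
+ (1 - t) = 1 - t p`, and the integral over `t` is then `U`. -/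
lemma pairMass_false {z : Plane × Plane} (hz : ‖z.1‖ ≤ ‖z.2‖) (hne : z.1 ≠ z.2) :
    c.pairMass false z = ENNReal.ofReal (Real.exp (-c.voidMean z) *
      c.U (z.2 - z.1) (c.Γcs / c.powW) (c.mean₂ z)) := by
  rw [pairMass_eq_integral]
  congr 2
  rw [U, ← c.exceedProb_of_ne _ (sub_ne_zero.2 hne.symm),
    ← integral_one_sub_mul_exp_neg_mul _ (c.mean₂_pos z).ne', ← integral_unif_eq]
  refine integral_congr_ae ?_
  filter_upwards [ae_restrict_mem measurableSet_Icc] with t ht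
  rw [integral_unif_split (A := fun _ => (1 - c.exceedProb (c.Γcs / c.powW) (z.2 - z.1)) *
    Real.exp (-(t * c.mean₂ z))) (B := fun _ => Real.exp (-(t * c.mean₂ z))) continuous_const
    continuous_const ht]
  · simp only [intervalIntegral.integral_const, smul_eq_mul]
    ring
  · intro s hs
    simp [c.pairProb_of_lt false hz hs, blockMean]
  · intro s hs
    simp [c.pairProb_of_gt false hz hs, blockMean]

/-- Whichever timer is larger, exactly one of the two APs has to escape the other. The factor `1 -
p` is therefore common to both regions, in accordance with the equal thresholds in `V`. -/
lemma pairMass_true {z : Plane × Plane} (hz : ‖z.1‖ ≤ ‖z.2‖) (hne : z.1 ≠ z.2) :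
    c.pairMass true z = ENNReal.ofReal (Real.exp (-c.voidMean z) *
      c.V (z.2 - z.1) (c.Γcs / c.powW) (c.Γcs / c.powW) (c.mean₁ z) (c.mean₂ z) (c.mean₃ z)) := by
  rw [pairMass_eq_integral]
  congr 2
  rw [V, ← c.exceedProb_of_ne _ (sub_ne_zero.2 hne.symm), ← mul_add,
    ← integral_timers_eq_M (c.mean₁_pos z) (c.mean₂_pos z) (c.mean₃_lt_mean₁ z)
    (c.mean₃_lt_mean₂ z), ← intervalIntegral.integral_const_mul, ← integral_unif_eq]
  refine integral_congr_ae ?_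
  filter_upwards [ae_restrict_mem measurableSet_Icc] with t ht
  rw [mul_add, ← intervalIntegral.integral_const_mul, ← intervalIntegral.integral_const_mul]
  refine integral_unif_split (by fun_prop) (by fun_prop) ht (fun s hs => ?_) (fun s hs => ?_)
  · simp [c.pairProb_of_lt true hz hs, blockMean, min_eq_right hs.le]
  · simp [c.pairProb_of_gt true hz hs, blockMean, min_eq_left hs.le]

lemma pairMass_of_lt (κ : Bool) {z : Plane × Plane} (hz : ‖z.2‖ < ‖z.1‖) : c.pairMass κ z = 0 := by
  simp [pairMass, pairProb, not_le_of_gt hz]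

/-- `U` is the integral of `(1 - t p) * exp (-t N₂)`, positive because `p < 1`. Hence the
conditioning event in the second part has positive probability. -/
lemma U_pos {z : Plane × Plane} (hne : z.1 ≠ z.2) :
    0 < c.U (z.2 - z.1) (c.Γcs / c.powW) (c.mean₂ z) := by
  rw [U, ← c.exceedProb_of_ne _ (sub_ne_zero.2 hne.symm),
    ← integral_one_sub_mul_exp_neg_mul _ (c.mean₂_pos z).ne']
  refine intervalIntegral.intervalIntegral_pos_of_pos_on
    (by apply Continuous.intervalIntegrable; fun_prop) (fun t ht => ?_) zero_lt_one
  have h1 := c.exceedProb_lt_one (div_pos c.Γcs_pos c.powW_pos) (z.2 - z.1)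
  have h2 : t * c.exceedProb (c.Γcs / c.powW) (z.2 - z.1) < 1 :=
    (mul_le_of_le_one_left (c.exceedProb_nonneg _ _) ht.2.le).trans_lt h1
  exact mul_pos (sub_pos.2 h2) (Real.exp_pos _)

lemma h₂W_eq (z : Plane × Plane) : c.h₂W z.1 z.2 =
    c.V (z.2 - z.1) (c.Γcs / c.powW) (c.Γcs / c.powW) (c.mean₁ z) (c.mean₂ z) (c.mean₃ z) /
      c.U (z.2 - z.1) (c.Γcs / c.powW) (c.mean₂ z) := rfl

lemma V_nonneg {z : Plane × Plane} (hne : z.1 ≠ z.2) :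
    0 ≤ c.V (z.2 - z.1) (c.Γcs / c.powW) (c.Γcs / c.powW) (c.mean₁ z) (c.mean₂ z) (c.mean₃ z) := by
  rw [V, ← c.exceedProb_of_ne _ (sub_ne_zero.2 hne.symm), ← mul_add,
    ← integral_timers_eq_M (c.mean₁_pos z) (c.mean₂_pos z) (c.mean₃_lt_mean₁ z)
    (c.mean₃_lt_mean₂ z)]
  refine mul_nonneg (sub_nonneg.2 (c.exceedProb_le_one (div_pos c.Γcs_pos c.powW_pos).le _))
    (intervalIntegral.integral_nonneg zero_le_one fun t ht => add_nonneg ?_ ?_)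
  · exact intervalIntegral.integral_nonneg ht.1 fun s _ => (Real.exp_pos _).le
  · exact intervalIntegral.integral_nonneg ht.2 fun s _ => (Real.exp_pos _).le

lemma h₂W_nonneg {z : Plane × Plane} (hne : z.1 ≠ z.2) : 0 ≤ c.h₂W z.1 z.2 :=
  div_nonneg (c.V_nonneg hne) (c.U_pos hne).le

lemma pairMass_ne_top (κ : Bool) (z : Plane × Plane) : c.pairMass κ z ≠ ∞ := by
  rw [pairMass_eq_integral]
  exact ENNReal.ofReal_ne_top

/-- The void probability cancels. If the second AP is closer to the origin, both sides vanish; equal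
norms are left out, a null set of pairs. -/
lemma pairMass_true_eq_mul {z : Plane × Plane} (hz : ‖z.1‖ ≠ ‖z.2‖) :
    c.pairMass true z = c.pairMass false z * ENNReal.ofReal (c.h₂W z.1 z.2) := by
  have hne : z.1 ≠ z.2 := fun h => hz (by rw [h])
  rcases hz.lt_or_gt with h | h
  · have hU := c.U_pos hne
    rw [c.pairMass_true h.le hne, c.pairMass_false h.le hne, ← ENNReal.ofReal_mul (by positivity),
      h₂W_eq, mul_assoc, mul_div_cancel₀ _ hU.ne']
  · rw [c.pairMass_of_lt true h, c.pairMass_of_lt false h, zero_mul]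

end LBTParams

/-! ### Averaging over the random locations. -/

namespace LBTParams

variable (c : LBTParams)

lemma measurable_passProb (κ : Bool) (θ : ℝ) :
    Measurable fun r : (ℝ × ℝ) × Plane × Plane => c.passProb κ θ r.1.1 r.1.2 r.2.1 r.2.2 := by
  have h1 := c.measurable_exceedProb θ
  have h2 := c.measurable_exceedProb' κ θ
  unfold passProb
  have h3 : Measurable fun r : (ℝ × ℝ) × Plane × Plane => c.exceedProb θ r.2.1 :=
    h1.comp (by fun_prop)
  have h4 : Measurable fun r : (ℝ × ℝ) × Plane × Plane => c.exceedProb' κ θ r.2.2 :=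
    h2.comp (by fun_prop)
  fun_prop

lemma measurable_apProb (κ : Bool) : Measurable fun r : (ℝ × ℝ) × (Plane × Plane) × Plane =>
    c.apProb κ r.1.1 r.1.2 r.2.1 r.2.2 := by
  unfold apProb
  exact Measurable.ite (measurableSet_le (by fun_prop) (by fun_prop))
    ((c.measurable_passProb κ (c.Γcs / c.powW)).comp
      (f := fun r : (ℝ × ℝ) × (Plane × Plane) × Plane => (r.1, r.2.2 - r.2.1.1, r.2.2 - r.2.1.2))
      (by fun_prop)) measurable_const

lemma measurable_enbProb (κ : Bool) : Measurable fun r : (ℝ × ℝ) × (Plane × Plane) × Plane =>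
    c.enbProb κ r.1.1 r.1.2 r.2.1 r.2.2 :=
  (c.measurable_passProb κ (c.Γed / c.powL)).comp
    (f := fun r : (ℝ × ℝ) × (Plane × Plane) × Plane => (r.1, r.2.2 - r.2.1.1, r.2.2 - r.2.1.2))
    (by fun_prop)

end LBTParams

namespace LBTNetwork

variable {Ω : Type*} [MeasurableSpace Ω] {c : LBTParams} {P : Measure Ω} {ι : Type}

lemma measurableSet_fixedEvent [Countable ι] (c : LBTParams) (κ : Bool) (i j : ι) :
    MeasurableSet {r : ((ι → Plane) × (ℕ → Plane)) × (ι ⊕ ℕ ⊕ ι × ι ⊕ ℕ × ι → ℝ) |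
      FixedEvent c κ i j r.1.1 r.1.2 r.2} := by
  let T := ((ι → Plane) × (ℕ → Plane)) × (ι ⊕ ℕ ⊕ ι × ι ⊕ ℕ × ι → ℝ)
  have hx : ∀ k, Measurable fun r : T => r.1.1 k := fun k =>
    (measurable_pi_apply k).comp (measurable_fst.comp measurable_fst)
  have hy : ∀ m, Measurable fun r : T => r.1.2 m := fun m =>
    (measurable_pi_apply m).comp (measurable_snd.comp measurable_fst)
  have ha : ∀ b, Measurable fun r : T => r.2 b := fun b =>
    (measurable_pi_apply b).comp measurable_snd
  have hp : Measurable fun v : Plane => c.pathLoss ‖v‖ := by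
    unfold LBTParams.pathLoss
    fun_prop
  unfold FixedEvent
  refine measurableSet_setOfPred.2 (Measurable.and (.forall fun k => measurableSet_setOfPred.1 ?_)
    (.forall fun l => .imp measurable_const (Measurable.and
      (.forall fun k => .imp measurable_const (.or (measurableSet_setOfPred.1 ?_)
        (measurableSet_setOfPred.1 ?_)))
      (.forall fun m => .or (measurableSet_setOfPred.1 ?_) (measurableSet_setOfPred.1 ?_)))))
  · exact measurableSet_le (hx i).norm (hx k).norm
  · exact measurableSet_le (ha _) (ha _)
  · exact measurableSet_le ((ha _).div (hp.comp ((hx k).sub (hx l)))) measurable_const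
  · exact measurableSet_le (ha _) (ha _)
  · exact measurableSet_le ((ha _).div (hp.comp ((hy m).sub (hx l)))) measurable_const

/-- AP `i` is tagged, it transmits, and AP `j` transmits as well if `κ` is true. -/
def event (net : LBTNetwork c P ι) (κ : Bool) (i j : ι) : Set Ω :=
  {ω | FixedEvent c κ i j (fun k => net.ap k ω) (fun m => net.enb m ω) fun a => net.marks a ω}

lemma event_false (net : LBTNetwork c P ι) (i j : ι) :
    net.event false i j = net.tagged i ∩ net.transmits i := by
  ext ω
  simp [event, FixedEvent, tagged, transmits, marks]

lemma event_true (net : LBTNetwork c P ι) (i j : ι) :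
    net.event true i j = net.tagged i ∩ net.transmits i ∩ net.transmits j := by
  ext ω
  simp [event, FixedEvent, tagged, transmits, marks, and_assoc]

lemma measurable_locations (net : LBTNetwork c P ι) :
    Measurable fun ω => ((fun i => net.ap i ω), fun m => net.enb m ω) :=
  (measurable_pi_lambda _ net.measurable_ap).prodMk
    (measurable_pi_lambda _ net.enb_poisson.measurable)

lemma measurableSet_event [Countable ι] (net : LBTNetwork c P ι) (κ : Bool) (i j : ι) :
    MeasurableSet (net.event κ i j) :=
  (net.measurable_locations.prodMk (measurable_pi_lambda _ net.measurable_marks))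
    (measurableSet_fixedEvent c κ i j)

-- Marks and eNB locations are integrated out, the former by `measure_fixedEvent` and the latter by
-- the generating functional. The AP locations remain inside the integral, so the formula serves
-- Poisson APs as well as two fixed APs with a Poisson process added.
open Classical in
lemma measure_event_inter [IsProbabilityMeasure P] [Countable ι] (net : LBTNetwork c P ι)
    (κ : Bool) {i j : ι} (hij : i ≠ j) {e : ℕ → ι} (he : Function.Injective e)
    (hsurj : ∀ l, l ≠ i → l ≠ j → l ∈ range e) {A : Set (Plane × Plane)} (hA : MeasurableSet A) :
    P (net.event κ i j ∩ {ω | (net.ap i ω, net.ap j ω) ∈ A}) =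
      ∫⁻ q, ∫⁻ ω, A.indicator 1 (net.ap i ω, net.ap j ω) *
        (ENNReal.ofReal (c.pairProb κ q.1 q.2 (net.ap i ω, net.ap j ω)) *
        (infProd (fun k => if e k = i ∨ e k = j then 1 else
          ENNReal.ofReal (c.apProb κ q.1 q.2 (net.ap i ω, net.ap j ω) (net.ap (e k) ω))) *
        genFun c.lamL fun w =>
          ENNReal.ofReal (c.enbProb κ q.1 q.2 (net.ap i ω, net.ap j ω) w))) ∂P
        ∂(LBTParams.unif.prod LBTParams.unif) := by
  let F : (ℝ × ℝ) × (ι → Plane) → ℝ≥0∞ := fun r =>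
    infProd fun k => if e k = i ∨ e k = j then 1 else
      ENNReal.ofReal (c.apProb κ r.1.1 r.1.2 (r.2 i, r.2 j) (r.2 (e k)))
  let H : (ℝ × ℝ) × (ι → Plane) × (ℕ → Plane) → ℝ≥0∞ := fun r =>
    infProd fun m => ENNReal.ofReal (c.enbProb κ r.1.1 r.1.2 (r.2.1 i, r.2.1 j) (r.2.2 m))
  let K : (ℝ × ℝ) × (ι → Plane) → ℝ≥0∞ := fun r =>
    ENNReal.ofReal (c.pairProb κ r.1.1 r.1.2 (r.2 i, r.2 j))
  let I : (ι → Plane) → ℝ≥0∞ := fun x => A.indicator 1 (x i, x j)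
  have hF : Measurable F := by
    refine measurable_infProd fun k => ?_
    split_ifs
    · exact measurable_const
    · exact ENNReal.measurable_ofReal.comp ((c.measurable_apProb κ).comp
        (f := fun r : (ℝ × ℝ) × (ι → Plane) => (r.1, (r.2 i, r.2 j), r.2 (e k))) (by fun_prop))
  have hH : Measurable H := by
    refine measurable_infProd fun m => ?_
    exact ENNReal.measurable_ofReal.comp ((c.measurable_enbProb κ).comp
      (f := fun r : (ℝ × ℝ) × (ι → Plane) × (ℕ → Plane) => (r.1, (r.2.1 i, r.2.1 j), r.2.2 m))
      (by fun_prop))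
  have hK : Measurable K := ENNReal.measurable_ofReal.comp ((c.measurable_pairProb κ).comp
    (f := fun r : (ℝ × ℝ) × (ι → Plane) => (r.1, r.2 i, r.2 j)) (by fun_prop))
  have hI : Measurable I := (measurable_one.indicator hA).comp
    (f := fun x : ι → Plane => (x i, x j)) (by fun_prop)
  let G : (ℝ × ℝ) × (ι → Plane) × (ℕ → Plane) → ℝ≥0∞ := fun r =>
    I r.2.1 * (K (r.1, r.2.1) * (F (r.1, r.2.1) * H r))
  have hG : Measurable G := by fun_prop
  have hloc := net.measurable_locations
  have hD : MeasurableSet {r : ((ι → Plane) × (ℕ → Plane)) × (ι ⊕ ℕ ⊕ ι × ι ⊕ ℕ × ι → ℝ) |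
      FixedEvent c κ i j r.1.1 r.1.2 r.2 ∧ (r.1.1 i, r.1.1 j) ∈ A} :=
    (measurableSet_fixedEvent c κ i j).inter ((show Measurable fun
      r : ((ι → Plane) × (ℕ → Plane)) × (ι ⊕ ℕ ⊕ ι × ι ⊕ ℕ × ι → ℝ) => (r.1.1 i, r.1.1 j) by
        fun_prop) hA)
  have h1 := net.indep_locations_marks.measure_prodMk hloc
    (measurable_pi_lambda _ net.measurable_marks) hD
  have h2 : ∀ ω, P {ω' | FixedEvent c κ i j (fun k => net.ap k ω) (fun m => net.enb m ω)
      (fun a => net.marks a ω') ∧ (net.ap i ω, net.ap j ω) ∈ A} =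
      ∫⁻ q, G (q, (fun k => net.ap k ω), fun m => net.enb m ω)
        ∂(LBTParams.unif.prod LBTParams.unif) := by
    intro ω
    simp only [G, I]
    by_cases hω : (net.ap i ω, net.ap j ω) ∈ A
    · simp only [hω, and_true, indicator_of_mem, Pi.one_apply, one_mul]
      exact net.measure_fixedEvent κ hij he hsurj _ _
    · simp [hω]
  refine (h1.trans (lintegral_congr h2)).trans ?_
  rw [lintegral_lintegral_swap (f := fun ω q => G (q, (fun k => net.ap k ω), fun m => net.enb m ω))
    (hG.comp (measurable_snd.prodMk (hloc.comp measurable_fst))).aemeasurable]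
  refine lintegral_congr_ae ?_
  filter_upwards [ae_unif_prod_mem] with q hq
  refine (net.indep_locations.lintegral_prodMk (measurable_pi_lambda _ net.measurable_ap)
    (measurable_pi_lambda _ net.enb_poisson.measurable)
    (hG.comp (measurable_const.prodMk measurable_id))).trans (lintegral_congr fun ω => ?_)
  have hHω : Measurable fun ω' => H (q, (fun k => net.ap k ω), fun m => net.enb m ω') :=
    hH.comp (measurable_const.prodMk (measurable_const.prodMk
      (measurable_pi_lambda _ net.enb_poisson.measurable)))
  simp only [Function.comp_apply, id, G]
  rw [lintegral_const_mul _ ((hHω.const_mul _).const_mul _), lintegral_const_mul _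
    (hHω.const_mul _), lintegral_const_mul _ hHω]
  congr 3
  refine net.enb_poisson.lintegral_infProd c.lamL_pos.le (g := fun w =>
    ENNReal.ofReal (c.enbProb κ q.1 q.2 (net.ap i ω, net.ap j ω) w)) ?_ (fun w => ?_) ?_
  · exact ENNReal.measurable_ofReal.comp ((c.measurable_enbProb κ).comp
      (measurable_const.prodMk (measurable_const.prodMk measurable_id)))
  · exact ENNReal.ofReal_le_one.2 (c.enbProb_le_one κ hq.1.1 hq.2.1 _ _)
  · exact c.lintegral_one_sub_enbProb_ne_top κ hq.1 hq.2 _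

end LBTNetwork

namespace LBTParams

variable (c : LBTParams)

lemma continuousAt_exceedProb (θ : ℝ) {v : Plane} (hv : v ≠ 0) :
    ContinuousAt (c.exceedProb θ) v := by
  have h1 : Continuous fun v : Plane => Real.exp (-c.μ * θ * c.pathLoss ‖v‖) := by
    unfold pathLoss
    have := continuous_norm.rpow_const (α := Plane) fun v => .inr c.α_pos.le
    fun_prop
  refine h1.continuousAt.congr ?_
  filter_upwards [isOpen_ne.mem_nhds hv] with w hw
  exact (c.exceedProb_of_ne θ hw).symm

lemma continuousAt_exceedProb' (κ : Bool) (θ : ℝ) {v : Plane} (hv : v ≠ 0) :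
    ContinuousAt (c.exceedProb' κ θ) v := by
  unfold exceedProb'
  split_ifs
  exacts [c.continuousAt_exceedProb θ hv, continuousAt_const]

/-- Away from the two norms the indicator `‖z.1‖ ≤ ‖w‖` is locally constant and `w` differs from
both APs, so neither discontinuity of the factor is met. This is the continuity that
`pairMeasure_eq` demands. -/
lemma continuousAt_apProb (κ : Bool) (t s : ℝ) {z : Plane × Plane} {w : Plane}
    (h1 : ‖w‖ ≠ ‖z.1‖) (h2 : ‖w‖ ≠ ‖z.2‖) :
    ContinuousAt (fun z' => c.apProb κ t s z' w) z := by
  have hn : ContinuousAt (fun z' : Plane × Plane => ‖z'.1‖) z := by fun_prop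
  rcases h1.lt_or_gt with h | h
  · refine continuousAt_const.congr (f := fun _ => (0 : ℝ)) ?_
    filter_upwards [hn.eventually (eventually_gt_nhds h)] with z' hz'
    exact (if_neg (not_le_of_gt hz')).symm
  · have hc1 : ContinuousAt (fun z' : Plane × Plane => c.exceedProb (c.Γcs / c.powW) (w - z'.1)) z :=
      ContinuousAt.comp (f := fun z' : Plane × Plane => w - z'.1)
        (c.continuousAt_exceedProb _ (sub_ne_zero.2 fun h => h1 (by rw [h]))) (by fun_prop)
    have hc2 : ContinuousAt
        (fun z' : Plane × Plane => c.exceedProb' κ (c.Γcs / c.powW) (w - z'.2)) z :=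
      ContinuousAt.comp (f := fun z' : Plane × Plane => w - z'.2)
        (c.continuousAt_exceedProb' κ _ (sub_ne_zero.2 fun h => h2 (by rw [h]))) (by fun_prop)
    have hc : ContinuousAt (fun z' : Plane × Plane =>
        c.passProb κ (c.Γcs / c.powW) t s (w - z'.1) (w - z'.2)) z := by
      unfold passProb
      fun_prop
    refine hc.congr ?_
    filter_upwards [hn.eventually (eventually_lt_nhds h)] with z' hz'
    exact (if_pos hz'.le).symm

lemma measurable_genFun_enbProb (κ : Bool) : Measurable fun r : (ℝ × ℝ) × Plane × Plane =>
    genFun c.lamL fun w => ENNReal.ofReal (c.enbProb κ r.1.1 r.1.2 r.2 w) := by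
  refine measurable_genFun c.lamL (G := fun (r : (ℝ × ℝ) × Plane × Plane) w =>
    ENNReal.ofReal (c.enbProb κ r.1.1 r.1.2 r.2 w)) (ENNReal.measurable_ofReal.comp ?_)
  exact (c.measurable_enbProb κ).comp
    (f := fun r : ((ℝ × ℝ) × Plane × Plane) × Plane => (r.1.1, r.1.2, r.2)) (by fun_prop)

lemma measurable_genFun_apProb (κ : Bool) : Measurable fun r : (ℝ × ℝ) × Plane × Plane =>
    genFun c.lamW fun w => ENNReal.ofReal (c.apProb κ r.1.1 r.1.2 r.2 w) := by
  refine measurable_genFun c.lamW (G := fun (r : (ℝ × ℝ) × Plane × Plane) w =>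
    ENNReal.ofReal (c.apProb κ r.1.1 r.1.2 r.2 w)) (ENNReal.measurable_ofReal.comp ?_)
  exact (c.measurable_apProb κ).comp
    (f := fun r : ((ℝ × ℝ) × Plane × Plane) × Plane => (r.1.1, r.1.2, r.2)) (by fun_prop)

lemma measurable_pairMass_integrand (κ : Bool) : Measurable fun r : (ℝ × ℝ) × Plane × Plane =>
    ENNReal.ofReal (c.pairProb κ r.1.1 r.1.2 r.2) *
      (genFun c.lamL (fun w => ENNReal.ofReal (c.enbProb κ r.1.1 r.1.2 r.2 w)) *
        genFun c.lamW (fun w => ENNReal.ofReal (c.apProb κ r.1.1 r.1.2 r.2 w))) :=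
  (ENNReal.measurable_ofReal.comp (c.measurable_pairProb κ)).mul
    ((c.measurable_genFun_enbProb κ).mul (c.measurable_genFun_apProb κ))

lemma measurable_pairMass (κ : Bool) : Measurable (c.pairMass κ) :=
  (c.measurable_pairMass_integrand κ).lintegral_prod_left'

end LBTParams

/-! ### Campbell measures and conclusion. -/

lemma measurable_pairTerm_param {Ω β : Type*} [MeasurableSpace Ω] [MeasurableSpace β]
    {X : ℕ → Ω → Plane} (hX : ∀ n, Measurable (X n)) {F : β → Plane × Plane → ℝ≥0∞}
    {G : β → Plane × Plane → Plane → ℝ≥0∞} (hF : Measurable (Function.uncurry F))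
    (hG : Measurable fun r : β × (Plane × Plane) × Plane => G r.1 r.2.1 r.2.2) (p : ℕ × ℕ) :
    Measurable fun r : β × Ω => pairTerm X (F r.1) (G r.1) p r.2 := by
  have hX' : ∀ k, Measurable fun r : β × Ω => X k r.2 := fun k => (hX k).comp measurable_snd
  unfold pairTerm
  split_ifs
  · exact measurable_const
  · refine Measurable.mul (hF.comp (measurable_fst.prodMk ((hX' _).prodMk (hX' _))))
      (measurable_infProd fun k => ?_)
    split_ifs
    · exact measurable_const
    · exact hG.comp (measurable_fst.prodMk (((hX' _).prodMk (hX' _)).prodMk (hX' _)))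

namespace LBTNetwork

variable {Ω : Type*} [MeasurableSpace Ω] {c : LBTParams} {P : Measure Ω}

lemma campbell_apply {ι : Type} (net : LBTNetwork c P ι) (E : ι → ι → Set Ω)
    {A : Set (Plane × Plane)} (hA : MeasurableSet A) :
    net.campbell E A = ∑' p : ι × ι, {p : ι × ι | p.1 ≠ p.2}.indicator
      (fun p => P (E p.1 p.2 ∩ {ω | (net.ap p.1 ω, net.ap p.2 ω) ∈ A})) p := by
  rw [campbell, Measure.sum_apply _ hA, ← tsum_subtype]
  refine tsum_congr fun p => ?_
  have hm := (net.measurable_ap p.1.1).prodMk (net.measurable_ap p.1.2)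
  rw [Measure.map_apply hm hA, Measure.restrict_apply (hm hA), inter_comm]
  rfl

/-- For fixed timers the sum over pairs of indices is an integral against the pair measure with
factors `apProb`. The Mecke formula replaces that measure by its density, and the timers are
integrated last, which yields `pairMass`. -/
lemma campbell_event [IsProbabilityMeasure P] (net : LBTNetwork c P ℕ)
    (hap : IsPoissonProcess P c.lamW net.ap) (κ : Bool) :
    net.campbell (net.event κ) =
      volume.withDensity fun z => ENNReal.ofReal c.lamW ^ 2 * c.pairMass κ z := by
  ext A hA
  rw [net.campbell_apply _ hA]
  let F : ℝ × ℝ → Plane × Plane → ℝ≥0∞ := fun q z => A.indicator 1 z *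
    (ENNReal.ofReal (c.pairProb κ q.1 q.2 z) *
      genFun c.lamL fun w => ENNReal.ofReal (c.enbProb κ q.1 q.2 z w))
  let G : ℝ × ℝ → Plane × Plane → Plane → ℝ≥0∞ := fun q z w =>
    ENNReal.ofReal (c.apProb κ q.1 q.2 z w)
  have hA1 : Measurable (A.indicator (1 : Plane × Plane → ℝ≥0∞)) := measurable_one.indicator hA
  have hF1 : Measurable fun r : (ℝ × ℝ) × Plane × Plane => A.indicator 1 r.2 *
      (ENNReal.ofReal (c.pairProb κ r.1.1 r.1.2 r.2) *
        genFun c.lamL fun w => ENNReal.ofReal (c.enbProb κ r.1.1 r.1.2 r.2 w)) :=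
    Measurable.mul (hA1.comp measurable_snd) (Measurable.mul
      (ENNReal.measurable_ofReal.comp (c.measurable_pairProb κ)) (c.measurable_genFun_enbProb κ))
  have hF : Measurable (Function.uncurry F) := hF1
  have hG1 : Measurable fun r : (ℝ × ℝ) × (Plane × Plane) × Plane =>
      ENNReal.ofReal (c.apProb κ r.1.1 r.1.2 r.2.1 r.2.2) :=
    ENNReal.measurable_ofReal.comp (c.measurable_apProb κ)
  have hG : Measurable fun r : (ℝ × ℝ) × (Plane × Plane) × Plane => G r.1 r.2.1 r.2.2 := hG1
  have hFq : ∀ q, Measurable (F q) := fun q => hF.of_uncurry_left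
  have hGq : ∀ q, Measurable (Function.uncurry (G q)) := fun q => by
    have h := hG1.comp (measurable_prodMk_left (x := q))
    exact h
  have hterm : ∀ p : ℕ × ℕ, {p : ℕ × ℕ | p.1 ≠ p.2}.indicator
      (fun p => P (net.event κ p.1 p.2 ∩ {ω | (net.ap p.1 ω, net.ap p.2 ω) ∈ A})) p =
      ∫⁻ q, ∫⁻ ω, pairTerm net.ap (F q) (G q) p ω ∂P ∂(LBTParams.unif.prod LBTParams.unif) := by
    intro p
    by_cases hp : p.1 = p.2
    · simp [pairTerm, hp]
    · rw [indicator_of_mem (show p ∈ {p : ℕ × ℕ | p.1 ≠ p.2} from hp),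
        net.measure_event_inter κ hp (e := id) Function.injective_id (by simp) hA]
      refine lintegral_congr fun q => lintegral_congr fun ω => ?_
      rw [pairTerm, if_neg hp]
      simp only [F, G, id]
      rw [mul_assoc, mul_assoc]
      congr 2
      rw [mul_comm]
  have hmeas : ∀ p : ℕ × ℕ, Measurable fun q => ∫⁻ ω, pairTerm net.ap (F q) (G q) p ω ∂P := by
    intro p
    exact (measurable_pairTerm_param net.measurable_ap hF hG p).lintegral_prod_right'
  rw [tsum_congr hterm, ← lintegral_tsum fun p => (hmeas p).aemeasurable]
  have hq : ∀ᵐ q ∂(LBTParams.unif.prod LBTParams.unif),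
      ∑' p, ∫⁻ ω, pairTerm net.ap (F q) (G q) p ω ∂P =
      ∫⁻ z, ENNReal.ofReal c.lamW ^ 2 * A.indicator 1 z *
        (ENNReal.ofReal (c.pairProb κ q.1 q.2 z) *
        (genFun c.lamL (fun w => ENNReal.ofReal (c.enbProb κ q.1 q.2 z w)) *
          genFun c.lamW (fun w => ENNReal.ofReal (c.apProb κ q.1 q.2 z w)))) := by
    filter_upwards [ae_unif_prod_mem] with q hq
    rw [← lintegral_pairMeasure net.measurable_ap (hFq q) (hGq q),
      hap.pairMeasure_eq c.lamW_pos.le (hGq q)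
        (fun z w => ENNReal.ofReal_le_one.2 (c.apProb_le_one κ hq.1.1 hq.2.1 z w))
        (fun z => c.lintegral_one_sub_apProb_ne_top κ hq.1 hq.2 z)
        (fun z w h1 h2 => ENNReal.continuous_ofReal.continuousAt.comp
          (c.continuousAt_apProb κ q.1 q.2 h1 h2)),
      lintegral_withDensity_eq_lintegral_mul _ ((measurable_genFun _ (hGq q)).const_mul _) (hFq q)]
    refine lintegral_congr fun z => ?_
    simp only [F, G, Pi.mul_apply]
    ring
  rw [lintegral_congr_ae hq, lintegral_lintegral_swap, withDensity_apply _ hA,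
    ← lintegral_indicator hA]
  · refine lintegral_congr fun z => ?_
    by_cases h : z ∈ A
    · simp only [indicator_of_mem h, Pi.one_apply, mul_one]
      exact lintegral_const_mul' _ _ (by simp)
    · simp [h]
  · exact (((hA1.comp measurable_snd).const_mul _).mul
      (c.measurable_pairMass_integrand κ)).aemeasurable

end LBTNetwork

lemma LBTParams.withDensity_pairMass_true (c : LBTParams) :
    (volume.withDensity fun z => ENNReal.ofReal c.lamW ^ 2 * c.pairMass true z) =
      (volume.withDensity fun z => ENNReal.ofReal c.lamW ^ 2 * c.pairMass false z).withDensity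
        fun p => ENNReal.ofReal (c.h₂W p.1 p.2) := by
  have hm := fun κ => (c.measurable_pairMass κ).const_mul (ENNReal.ofReal c.lamW ^ 2)
  have hfin := c.pairMass_ne_top false
  have hne : ∀ᵐ z : Plane × Plane, ‖z.1‖ ≠ ‖z.2‖ := by
    simpa [ae_iff] using IsPoissonProcess.volume_norm_eq_norm
  -- The quotient of the two masses is measurable and equals `h₂W` almost everywhere for the measure
  -- in question, so composing the densities does not require measurability of `h₂W`.
  have h1 : (fun p => ENNReal.ofReal (c.h₂W p.1 p.2)) =ᵐ[volume.withDensity fun z =>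
      ENNReal.ofReal c.lamW ^ 2 * c.pairMass false z]
      c.pairMass true / c.pairMass false := by
    refine (ae_withDensity_iff (hm false)).2 ?_
    filter_upwards [hne] with z hz h0
    rw [Pi.div_apply, c.pairMass_true_eq_mul hz, mul_comm,
      ENNReal.mul_div_cancel_right (right_ne_zero_of_mul h0) (hfin z)]
  rw [withDensity_congr_ae h1, ← withDensity_mul _ (hm false)
    ((c.measurable_pairMass true).div (c.measurable_pairMass false))]
  refine withDensity_congr_ae ?_
  filter_upwards [hne] with z hz
  rw [Pi.mul_apply, Pi.div_apply, mul_assoc]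
  congr 1
  refine (ENNReal.mul_div_cancel' (fun h0 => ?_) fun h => absurd h (hfin z)).symm
  rw [c.pairMass_true_eq_mul hz, h0, zero_mul]

/-- With `x₀` and `x` deterministic, only the remaining APs are averaged, and their generating
functional completes the integrand of `pairMass`. -/
lemma LBTNetwork.measure_event_inl {Ω : Type*} [MeasurableSpace Ω] {P : Measure Ω}
    [IsProbabilityMeasure P] {c : LBTParams} (net : LBTNetwork c P (Fin 2 ⊕ ℕ)) {x₀ x : Plane}
    (h0 : ∀ ω, net.ap (Sum.inl 0) ω = x₀) (h1 : ∀ ω, net.ap (Sum.inl 1) ω = x)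
    (hap : IsPoissonProcess P c.lamW fun n => net.ap (Sum.inr n)) (κ : Bool) :
    P (net.event κ (Sum.inl 0) (Sum.inl 1)) = c.pairMass κ (x₀, x) := by
  have h := net.measure_event_inter κ (i := Sum.inl 0) (j := Sum.inl 1) (by simp) (e := Sum.inr)
    Sum.inr_injective (by
      rintro (l | n) h2 h3
      · fin_cases l <;> simp at h2 h3
      · exact ⟨n, rfl⟩) (A := univ) .univ
  simp only [h0, h1, mem_univ, ofPred_true, inter_univ, indicator_univ, Pi.one_apply, one_mul,
    reduceCtorEq, or_self, if_false] at h
  rw [h, LBTParams.pairMass]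
  refine lintegral_congr_ae ?_
  filter_upwards [ae_unif_prod_mem] with q hq
  have hg : Measurable fun w => ENNReal.ofReal (c.apProb κ q.1 q.2 (x₀, x) w) := by
    have h2 : Measurable fun w : Plane => (q, ((x₀, x) : Plane × Plane), w) :=
      measurable_const.prodMk (measurable_const.prodMk measurable_id)
    have h3 := ENNReal.measurable_ofReal.comp ((c.measurable_apProb κ).comp h2)
    exact h3
  have hm : Measurable fun ω => infProd fun k =>
      ENNReal.ofReal (c.apProb κ q.1 q.2 (x₀, x) (net.ap (Sum.inr k) ω)) :=
    measurable_infProd fun k => hg.comp (net.measurable_ap _)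
  rw [lintegral_const_mul _ (hm.mul_const _), lintegral_mul_const _ hm,
    hap.lintegral_infProd c.lamW_pos.le hg
      (fun w => ENNReal.ofReal_le_one.2 (c.apProb_le_one κ hq.1.1 hq.2.1 _ w))
      (c.lintegral_one_sub_apProb_ne_top κ hq.1 hq.2 _), mul_comm (genFun c.lamW _)]

/-- First part: for a Poisson process of APs, `h₂W x₀ x` is the Palm conditional probability that
an AP at `x` transmits, given that the tagged AP is at `x₀` and transmits, i.e. the density of the
Campbell measure of the pairs (transmitting tagged AP, transmitting other AP) with respect to that of
the pairs (transmitting tagged AP, other AP). Second part: for every single choice of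
`x₀ = (r₀, 0)` and `x` with `‖x‖ > r₀`, it is the conditional probability in the network whose APs
are `x₀`, `x` and the points of a Poisson process, given that `x₀` transmits and that no AP is
closer to the origin than `x₀`. -/
theorem mainTheorem6 {Ω : Type*} [MeasurableSpace Ω] (P : Measure Ω) [IsProbabilityMeasure P]
    (c : LBTParams) :
    (∀ net : LBTNetwork c P ℕ, IsPoissonProcess P c.lamW net.ap →
      net.campbell (fun i j => net.tagged i ∩ net.transmits i ∩ net.transmits j) =
        (net.campbell (fun i _ => net.tagged i ∩ net.transmits i)).withDensity
          (fun p => ENNReal.ofReal (c.h₂W p.1 p.2))) ∧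
    (∀ (r₀ : ℝ) (x : Plane), 0 ≤ r₀ → r₀ < ‖x‖ →
      ∀ net : LBTNetwork c P (Fin 2 ⊕ ℕ),
        (∀ ω, net.ap (Sum.inl 0) ω = !₂[r₀, 0]) →
        (∀ ω, net.ap (Sum.inl 1) ω = x) →
        IsPoissonProcess P c.lamW (fun n => net.ap (Sum.inr n)) →
        0 < P (net.transmits (Sum.inl 0) ∩ net.tagged (Sum.inl 0)) ∧
        (P[net.transmits (Sum.inl 1) |
            net.transmits (Sum.inl 0) ∩ net.tagged (Sum.inl 0)]).toReal
          = c.h₂W !₂[r₀, 0] x) := by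
  refine ⟨fun net hap => ?_, fun r₀ x hr hx net h0 h1 hap => ?_⟩
  · have ht : net.campbell (fun i j => net.tagged i ∩ net.transmits i ∩ net.transmits j) =
        net.campbell (net.event true) :=
      congrArg net.campbell (funext₂ fun i j => (net.event_true i j).symm)
    have hf : net.campbell (fun i _ => net.tagged i ∩ net.transmits i) =
        net.campbell (net.event false) :=
      congrArg net.campbell (funext₂ fun i j => (net.event_false i j).symm)
    rw [ht, hf, net.campbell_event hap, net.campbell_event hap, c.withDensity_pairMass_true]
  · have hn : ‖(!₂[r₀, 0] : Plane)‖ = r₀ := by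
      rw [EuclideanSpace.norm_eq]
      simp [Real.sqrt_sq hr]
    have hlt : ‖((!₂[r₀, 0] : Plane), x).1‖ < ‖((!₂[r₀, 0] : Plane), x).2‖ := by
      rw [hn]
      exact hx
    have hne : ((!₂[r₀, 0] : Plane), x).1 ≠ ((!₂[r₀, 0] : Plane), x).2 := fun h => by
      rw [h] at hlt
      exact lt_irrefl _ hlt
    have hU := c.U_pos hne
    have hE := net.event_false (Sum.inl 0) (Sum.inl 1)
    rw [inter_comm] at hE
    have hI : net.event false (Sum.inl 0) (Sum.inl 1) ∩ net.transmits (Sum.inl 1) =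
        net.event true (Sum.inl 0) (Sum.inl 1) := by
      rw [net.event_true, net.event_false]
    have hpos : 0 < c.pairMass false (!₂[r₀, 0], x) := by
      rw [c.pairMass_false hlt.le hne]
      exact ENNReal.ofReal_pos.2 (by positivity)
    rw [← hE, cond_apply (net.measurableSet_event _ _ _), hI, net.measure_event_inl h0 h1 hap,
      net.measure_event_inl h0 h1 hap]
    refine ⟨hpos, ?_⟩
    rw [c.pairMass_true_eq_mul hlt.ne, ENNReal.inv_mul_cancel_left hpos.ne' (c.pairMass_ne_top _ _),
      ENNReal.toReal_ofReal (c.h₂W_nonneg hne)]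

end
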